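/- **Setting.** Let $d\ge 2$, let $\overline\Omega\subset\mathbb R^d$ be a compact connected polytope with interior $\Omega\neq\emptyset$, and let $\partial\Omega=\partial\Omega_t\cup\partial\Omega_R\cup\partial\Omega_D$ be a partition into three disjoint sets. A generalised face is the intersection of an open $(d-1)$-dimensional face of $\overline\Omega$ with one of the three sets; $PC(\partial\Omega)$ is the space of bounded functions on $\partial\Omega$ that are continuous on each generalised face, with the supremum norm. For $x\in\partial\Omega$ let $K(x)$ be the set of $p\in\mathbb R^d$ with $x+\lambda p\in\overline\Omega$ for all sufficiently small $\lambda\ge0$. Let $A$ be a compact metric space, $T>0$, and let $\alpha\mapsto(a^\alpha,b^\alpha,c^\alpha,f^\alpha)\in C(\overline\Omega)\times C(\overline\Omega,\mathbb R^d)\times C(\overline\Omega)^2$ and $\alpha\mapsto(b^\alpha_{\partial\Omega},c^\alpha_{\partial\Omega},g^\alpha)\in PC(\partial\Omega,\mathbb R^d)\times PC(\partial\Omega)^2$ be continuous, $g\in C(\partial\Omega)$, $v_T\in C(\overline\Omega)$, with $a^\alpha,c^\alpha,c^\alpha_{\partial\Omega},g^\alpha,g,v_T\ge0$, $v_T=g$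 on $\partial\Omega_D$ and $b^\alpha_{\partial\Omega}(x)\in K(x)$. Put $L^\alpha w=-a^\alpha\Delta w-b^\alpha\cdot\nabla w+c^\alpha w$ and $L^\alpha_{\partial\Omega}w=-b^\alpha_{\partial\Omega}\cdot\nabla w+c^\alpha_{\partial\Omega}w$. **Discretisation.** For $i\in\mathbb N$ let $\mathcal T_i$ be conforming simplicial meshes of $\overline\Omega$, shape-regular uniformly in $i$, with mesh size tending to $0$ and such that every open boundary face of the mesh lies in exactly one generalised face. Let $V_i$ be the continuous piecewise affine functions, $y$ the nodes, $\phi_y$ the hat functions, $\hat\phi_y=\phi_y/\|\phi_y\|_{L^1(\Omega)}$. Let $h_i=T/n_i$ with $n_i\in\mathbb N_{>0}$, $h_i\to0$, $s^k=kh_i$ and $S_i=\{s^0,\dots,s^{n_i}\}$. Let explicit coefficients $\bar a_i^\alpha,\bar b_i^\alpha,\bar c_i^\alpha$, implicit coefficients $\bar{\bar a}_i^\alpha,\bar{\bar b}_i^\alpha,\bar{\bar c}_i^\alpha$ and $f_i^\alpha$ be given in $C(\overline\Omega)$, and boundary coefficients $\bar b_{\partial,i}^\alpha,\bar c_{\partial,i}^\alpha,\bar{\bar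 b}_{\partial,i}^\alpha,\bar{\bar c}_{\partial,i}^\alpha,g_i^\alpha$ in $PC(\partial\Omega)$, all depending continuously on $\alpha$. For $w\in V_i$ and a node $y$ let $$(\mathsf E_i^\alpha w)_y=\begin{cases}\bar a_i^\alpha(y)\langle\nabla w,\nabla\hat\phi_y\rangle+\langle-\bar b_i^\alpha\cdot\nabla w+\bar c_i^\alpha w,\hat\phi_y\rangle& y\in\Omega,\\ \partial_{-\bar b_{\partial,i}^\alpha(y)}w(y)+\bar c_{\partial,i}^\alpha(y)w(y)& y\in\partial\Omega_t\cup\partial\Omega_R,\\ 0& y\in\partial\Omega_D,\end{cases}$$ where $\langle\cdot,\cdot\rangle$ is the $L^2(\Omega)$ inner product and $\partial_{-p}w(y)=\lim_{\lambda\downarrow0}(w(y)-w(y+\lambda p))/\lambda$. Let $\mathsf I_i^\alpha$ be defined in the same way with the implicit coefficients, except that $(\mathsf I_i^\alpha w)_y=w(y)$ for $y\in\partial\Omega_D$, and let $(\mathsf F_i^\alpha)_y$ be $\langle f_i^\alpha,\hat\phi_y\rangle$, $g_i^\alpha(y)$, $g(y)$ for $y$ in $\Omega$, $\partial\Omega_t\cup\partial\Omega_R$,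 $\partial\Omega_D$. Let $(d_iv(s^k))_y=(v(s^{k+1},y)-v(s^k,y))/h_i$ for $y\in\Omega\cup\partial\Omega_t$ and $0$ for the other nodes. A numerical solution $v_i:S_i\to V_i$ is one for which $v_i(T,\cdot)$ is the nodal interpolant of $v_T$ and, for $k=n_i-1,\dots,0$ and every node, $$-d_iv_i(s^k,\cdot)+\sup_{\alpha\in A}\bigl(\mathsf E_i^\alpha v_i(s^{k+1},\cdot)+\mathsf I_i^\alpha v_i(s^k,\cdot)-\mathsf F_i^\alpha\bigr)=0 .$$ **Assumptions.** 1. As $i\to\infty$, uniformly in $\alpha$: $a^\alpha-(\bar a_i^\alpha(y)+\bar{\bar a}_i^\alpha(y))\to0$ uniformly on $\operatorname{supp}\hat\phi_y$ and over the nodes $y\notin\partial\Omega_D$; $\bar b_i^\alpha+\bar{\bar b}_i^\alpha\to b^\alpha$, $\bar c_i^\alpha+\bar{\bar c}_i^\alpha\to c^\alpha$, $f_i^\alpha\to f^\alpha$ uniformly on $\overline\Omega$; $\bar b_{\partial,i}^\alpha+\bar{\bar b}_{\partial,i}^\alpha\to b_{\partial\Omega}^\alpha$, $\bar c_{\partial,i}^\alpha+\bar{\bar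 c}_{\partial,i}^\alpha\to c_{\partial\Omega}^\alpha$, $g_i^\alpha\to g^\alpha$ uniformly on $\partial\Omega$. On $\partial\Omega_R$: $\bar a_i^\alpha=\bar c_i^\alpha=\bar c_{\partial,i}^\alpha=0$, $\bar b_i^\alpha=\bar b_{\partial,i}^\alpha=0$, $\bar{\bar c}_{\partial,i}^\alpha>0$. The functions $\bar c_i^\alpha,\bar{\bar c}_i^\alpha,\bar c_{\partial,i}^\alpha,\bar{\bar c}_{\partial,i}^\alpha,f_i^\alpha,g_i^\alpha$ are non-negative; $\bar b_{\partial,i}^\alpha(y),\bar{\bar b}_{\partial,i}^\alpha(y)\in K(y)$ at the nodes $y\in\partial\Omega_t\cup\partial\Omega_R$; and $\bar b_{\partial,i}^\alpha,\bar{\bar b}_{\partial,i}^\alpha$ are bounded on $\partial\Omega_t$ uniformly in $i$ and $\alpha$. 2. For each $i$ there is $\theta\in(0,\pi/2)$ with $\nabla\phi_y\cdot\nabla\phi_z\le-\sin\theta\,|\nabla\phi_y|\,|\nabla\phi_z|$ on every element, for all nodes $y\ne z$; and for every $\alpha$ and interior node $y$ there are numbers $0\le\bar\nu\le\bar a_i^\alpha(y)$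 and $0\le\bar{\bar\nu}\le\bar{\bar a}_i^\alpha(y)$ such that on every element $K$ with vertex $y$ $$|\bar b_i^\alpha|_K+\operatorname{diam}(K)\|\bar c_i^\alpha\|_{L^\infty(K)}\le\bar\nu\sin\theta\,|\nabla\hat\phi_y|_K\operatorname{vol}(K),\qquad |\bar{\bar b}_i^\alpha|_K+\operatorname{diam}(K)\|\bar{\bar c}_i^\alpha\|_{L^\infty(K)}\le\bar{\bar\nu}\sin\theta\,|\nabla\hat\phi_y|_K\operatorname{vol}(K),$$ where $|u|_K=(\sum_j\|u_j\|_{L^\infty(K)}^2)^{1/2}$. The time steps are small enough that the explicit part is monotone: $h_i(\mathsf E_i^\alpha\phi_y)_y\le1$ for all $i$, $\alpha$ and nodes $y\in\Omega\cup\partial\Omega_t$. 3. There are linear maps $P_i$ from $C^\infty(\mathbb R^d)$ to $V_i$ with $\langle\nabla P_iw,\nabla\hat\phi_y\rangle=\langle\nabla w,\nabla\hat\phi_y\rangle$ for all interior nodes $y$, $\|P_iw\|_{W^{1,\infty}(\Omega)}\le C\|w\|_{W^{1,\infty}(\Omega)}$ with $C$ independent of $i$ and $w$, and $\|P_iw-w\|_{W^{1,\infty}(\Omega)}\to0$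 for each $w$. 4. There are $\alpha\in A$, $\varepsilon>0$ and $w\in C^2(\mathbb R\times\mathbb R^d)$ such that $-\partial_tw+L^\alpha w-f^\alpha\ge\varepsilon$ on $[0,T)\times\Omega$, $-\partial_tw+L^\alpha_{\partial\Omega}w-g^\alpha\ge\varepsilon$ on $[0,T)\times\partial\Omega_t$, $L^\alpha_{\partial\Omega}w-g^\alpha\ge\varepsilon$ on $[0,T)\times\partial\Omega_R$, $w-g\ge\varepsilon$ on $[0,T)\times\partial\Omega_D$ and $w-v_T\ge\varepsilon$ on $\{T\}\times\overline\Omega$. **Theorem.** Under these assumptions the numerical solutions $v_i$ are bounded uniformly in $i$: there is a finite constant $C>0$ such that $$\|v_i\|_{L^\infty(S_i\times\overline\Omega)}\le C\qquad\text{for all } i\in\mathbb N.$$ -/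

import Mathlib

open Set Filter Topology MeasureTheory
open scoped ENNReal

noncomputable section

namespace BellmanFEM

/-- The Euclidean space `ℝ^d`. -/
abbrev Sp (d : ℕ) : Type := EuclideanSpace ℝ (Fin d)

/-! ### The domain and the boundary regions -/

/-- The points of the boundary of `D` near which the boundary is a piece of a hyperplane. -/
def flatBoundary {d : ℕ} (D : Set (Sp d)) : Set (Sp d) :=
  {x | x ∈ frontier D ∧ ∃ n : Sp d, n ≠ 0 ∧ ∀ᶠ y in 𝓝 x, (y ∈ frontier D ↔ inner ℝ n (y - x) = 0)}

/-- The open `(d-1)`-dimensional faces of `D`: the connected components of the flat part of the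
boundary. -/
def openFaces {d : ℕ} (D : Set (Sp d)) : Set (Set (Sp d)) :=
  {ω | ∃ x ∈ flatBoundary D, ω = connectedComponentIn (flatBoundary D) x}

/-- The tangent cone `K(x)`: directions in which a line segment issuing from `x` stays in `D`. -/
def tangentDirections {d : ℕ} (D : Set (Sp d)) (x : Sp d) : Set (Sp d) :=
  {p | ∃ Λ : ℝ, 0 < Λ ∧ ∀ r ∈ Icc (0 : ℝ) Λ, x + r • p ∈ D}

/-- A bounded connected closed domain `cl = Ω̄` with interior `Ω`, whose boundary is split into the
Robin part with time derivative `bdT`, the Robin part without time derivative `bdR` and the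
Dirichlet part `bdD`. (That `Ω̄` is a polytope is expressed by the meshes, which triangulate it.) -/
structure MixedDomain (d : ℕ) where
  cl : Set (Sp d)
  bdT : Set (Sp d)
  bdR : Set (Sp d)
  bdD : Set (Sp d)
  isCompact_cl : IsCompact cl
  isConnected_cl : IsConnected cl
  nonempty_interior : (interior cl).Nonempty
  disjoint_TR : Disjoint bdT bdR
  disjoint_TD : Disjoint bdT bdD
  disjoint_RD : Disjoint bdR bdD
  union_eq : bdT ∪ bdR ∪ bdD = frontier cl

/-- The generalised faces: intersections of an open face with one of the boundary regions. -/
def MixedDomain.genFaces {d : ℕ} (G : MixedDomain d) : Set (Set (Sp d)) :=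
  {ω | ∃ ω' ∈ openFaces G.cl, ω = ω' ∩ G.bdD ∨ ω = ω' ∩ G.bdR ∨ ω = ω' ∩ G.bdT}

/-- `α ↦ u α` is a continuous map from `A` into `C(Ω̄, F)`. Since `A` and `Ω̄` are compact, this is
joint continuity, and the family `u α` is then equicontinuous. -/
def MixedDomain.CFamily {d : ℕ} (G : MixedDomain d) {A F : Type*} [TopologicalSpace A]
    [TopologicalSpace F] (u : A → Sp d → F) : Prop :=
  ContinuousOn (fun p : A × Sp d => u p.1 p.2) (univ ×ˢ G.cl)

/-- `α ↦ u α` is a continuous map from `A` into the piecewise continuous functions `PC(∂Ω, F)`: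
bounded functions on `∂Ω` which are continuous on each generalised face, with the supremum norm. -/
structure MixedDomain.PCFamily {d : ℕ} (G : MixedDomain d) {A F : Type*} [TopologicalSpace A]
    [NormedAddCommGroup F] (u : A → Sp d → F) : Prop where
  bounded : ∀ α, ∃ B : ℝ, ∀ x ∈ frontier G.cl, ‖u α x‖ ≤ B
  continuousOn : ∀ α, ∀ ω ∈ G.genFaces, ContinuousOn (u α) ω
  continuous_control : ∀ α, TendstoUniformlyOn u (u α) (𝓝 α) (frontier G.cl)

/-! ### The Bellman problem -/

/-- The data of the final time boundary value problem
`-∂ₜv + sup (Lᵅv - fᵅ) = 0` in `[0,T) × Ω`, `-∂ₜv + sup (Lᵅ_∂ v - gᵅ) = 0` on `[0,T) × bdT`,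
`sup (Lᵅ_∂ v - gᵅ) = 0` on `[0,T) × bdR`, `v = g` on `[0,T) × bdD`, `v(T) = v_T`, where
`Lᵅv = -aᵅ Δv - bᵅ·∇v + cᵅ v` and `Lᵅ_∂ v = -bBᵅ·∇v + cBᵅ v` (and `gᵅ` is `gB α`). -/
structure BellmanProblem (d : ℕ) (A : Type*) [TopologicalSpace A] extends MixedDomain d where
  T : ℝ
  a : A → Sp d → ℝ
  b : A → Sp d → Sp d
  c : A → Sp d → ℝ
  f : A → Sp d → ℝ
  bB : A → Sp d → Sp d
  cB : A → Sp d → ℝ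
  gB : A → Sp d → ℝ
  g : Sp d → ℝ
  vT : Sp d → ℝ
  T_pos : 0 < T
  a_cont : toMixedDomain.CFamily a
  b_cont : toMixedDomain.CFamily b
  c_cont : toMixedDomain.CFamily c
  f_cont : toMixedDomain.CFamily f
  bB_pc : toMixedDomain.PCFamily bB
  cB_pc : toMixedDomain.PCFamily cB
  gB_pc : toMixedDomain.PCFamily gB
  g_cont : ContinuousOn g (frontier cl)
  vT_cont : ContinuousOn vT cl
  a_nonneg : ∀ α, ∀ x ∈ cl, 0 ≤ a α x
  c_nonneg : ∀ α, ∀ x ∈ cl, 0 ≤ c α x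
  cB_nonneg : ∀ α, ∀ x ∈ frontier cl, 0 ≤ cB α x
  gB_nonneg : ∀ α, ∀ x ∈ frontier cl, 0 ≤ gB α x
  g_nonneg : ∀ x ∈ frontier cl, 0 ≤ g x
  vT_nonneg : ∀ x ∈ cl, 0 ≤ vT x
  vT_eq_g : ∀ x ∈ bdD, vT x = g x
  bB_cone : ∀ α, ∀ x ∈ frontier cl, bB α x ∈ tangentDirections cl x

open Classical in
/-- The operator `Fᵅ(t, x, q, p, r, s)` of the linear problem with fixed control `α`; the arguments
`q, p, r, s` stand for `Δw`, `∇w`, `∂ₜw` and `w`. -/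
def BellmanProblem.linOp {d : ℕ} {A : Type*} [TopologicalSpace A] (pb : BellmanProblem d A)
    (α : A) (t : ℝ) (x : Sp d) (q : ℝ) (p : Sp d) (r s : ℝ) : ℝ :=
  if t = pb.T then s - pb.vT x
  else if x ∈ pb.bdD then s - pb.g x
  else if x ∈ pb.bdR then (-inner ℝ (pb.bB α x) p + pb.cB α x * s) - pb.gB α x
  else if x ∈ pb.bdT then -r + (-inner ℝ (pb.bB α x) p + pb.cB α x * s) - pb.gB α x
  else -r + (-(pb.a α x * q) - inner ℝ (pb.b α x) p + pb.c α x * s) - pb.f α x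

/-- For some control `α` the linear problem has a strict supersolution `w ∈ C²(ℝ × ℝ^d)`. -/
def BellmanProblem.HasStrictSupersolution {d : ℕ} {A : Type*} [TopologicalSpace A]
    (pb : BellmanProblem d A) : Prop :=
  ∃ (α : A) (w : ℝ × Sp d → ℝ) (ε : ℝ), ContDiff ℝ 2 w ∧ 0 < ε ∧
    ∀ t ∈ Icc (0 : ℝ) pb.T, ∀ x ∈ pb.cl,
      ε ≤ pb.linOp α t x (Laplacian.laplacian (fun y => w (t, y)) x)
        (gradient (fun y => w (t, y)) x) (deriv (fun τ => w (τ, x)) t) (w (t, x))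

/-! ### Simplicial meshes and P1 finite elements -/

/-- A (conforming, simplicial) mesh. Elements are the convex hulls of the faces with `d + 1`
vertices, nodes are the vertices. -/
abbrev Mesh (d : ℕ) : Type := Geometry.SimplicialComplex ℝ (Sp d)

/-- The elements, given by their vertex sets. -/
def elements {d : ℕ} (K : Mesh d) : Set (Finset (Sp d)) := {s | s ∈ K.faces ∧ s.card = d + 1}

/-- The closed simplex spanned by `s`. -/
def simplex {d : ℕ} (s : Finset (Sp d)) : Set (Sp d) := convexHull ℝ (s : Set (Sp d))

/-- The largest diameter of an element. -/
def meshSize {d : ℕ} (K : Mesh d) : ℝ := sSup ((fun s => Metric.diam (simplex s)) '' elements K)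

/-- `K` is a finite mesh of `Ω̄` consisting of `d`-simplices and their faces. -/
structure IsMeshOf {d : ℕ} (K : Mesh d) (D : Set (Sp d)) : Prop where
  finite : K.faces.Finite
  space_eq : K.space = D
  pure : ∀ s ∈ K.faces, ∃ t ∈ elements K, s ⊆ t

/-- The boundary mesh is subordinate to the generalised faces: each open boundary face of the mesh
lies in exactly one generalised face. -/
def IsSubordinate {d : ℕ} (K : Mesh d) (G : MixedDomain d) : Prop :=
  ∀ s ∈ K.faces, s.card = d → simplex s ⊆ frontier G.cl →
    ∃! ω, ω ∈ G.genFaces ∧ intrinsicInterior ℝ (simplex s) ⊆ ω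

/-- The P1 finite element space: functions on `Ω̄` (extended by `0` to `ℝ^d`) which are affine on
each closed simplex of the mesh. -/
def P1 {d : ℕ} (K : Mesh d) : Submodule ℝ (Sp d → ℝ) where
  carrier := {v | (∀ s ∈ K.faces, ∃ L : Sp d →ᵃ[ℝ] ℝ, EqOn v L (simplex s)) ∧
    ∀ x, x ∉ K.space → v x = 0}
  zero_mem' := ⟨fun _ _ => ⟨0, fun _ _ => rfl⟩, fun _ _ => rfl⟩
  add_mem' := by
    rintro u v ⟨hu, hu'⟩ ⟨hv, hv'⟩
    refine ⟨fun s hs => ?_, fun x hx => by simp [hu' x hx, hv' x hx]⟩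
    obtain ⟨L, hL⟩ := hu s hs
    obtain ⟨M, hM⟩ := hv s hs
    exact ⟨L + M, fun x hx => by simp [hL hx, hM hx]⟩
  smul_mem' := by
    rintro r v ⟨hv, hv'⟩
    refine ⟨fun s hs => ?_, fun x hx => by simp [hv' x hx]⟩
    obtain ⟨M, hM⟩ := hv s hs
    exact ⟨r • M, fun x hx => by simp [hM hx]⟩

/-- `w` are the barycentric coordinates of `x` in the simplex with vertex set `s`, extended by `0`
to the other points. -/
def IsBarycentric {d : ℕ} (s : Finset (Sp d)) (x : Sp d) (w : Sp d → ℝ) : Prop :=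
  (∀ y ∈ s, 0 ≤ w y) ∧ (∀ y, y ∉ s → w y = 0) ∧ ∑ y ∈ s, w y = 1 ∧ ∑ y ∈ s, w y • y = x

open Classical in
/-- The hat function of the node `y`: the P1 function which is `1` at `y` and `0` at the other
nodes. Its value at `x` is the barycentric coordinate of `x` belonging to `y`, in any simplex of the
mesh that contains `x`. -/
def hat {d : ℕ} (K : Mesh d) (y x : Sp d) : ℝ :=
  if h : ∃ w : Sp d → ℝ, ∃ s ∈ K.faces, IsBarycentric s x w then h.choose y else 0

/-- The hat function normalised in `L¹(Ω)`. -/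
def nhat {d : ℕ} (K : Mesh d) (y x : Sp d) : ℝ := hat K y x / ∫ z in K.space, |hat K y z|

/-- Strict acuteness with angle `θ` (gradients of hat functions are constant inside elements). -/
def StrictlyAcute {d : ℕ} (K : Mesh d) (θ : ℝ) : Prop :=
  ∀ y ∈ K.vertices, ∀ z ∈ K.vertices, y ≠ z → ∀ s ∈ elements K, ∀ x ∈ interior (simplex s),
    inner ℝ (gradient (hat K y) x) (gradient (hat K z) x) ≤
      -Real.sin θ * ‖gradient (hat K y) x‖ * ‖gradient (hat K z) x‖

/-- The supremum of `|u|` over `S`. -/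
def supOn {d : ℕ} (S : Set (Sp d)) (u : Sp d → ℝ) : ℝ := ⨆ x : S, |u x|

/-- `|u|_S = (∑ⱼ ‖uⱼ‖²_{L^∞(S)})^{1/2}`. -/
def vecSupOn {d : ℕ} (S : Set (Sp d)) (u : Sp d → Sp d) : ℝ :=
  √(∑ j : Fin d, supOn S (fun x => u x j) ^ 2)

/-- The one-sided directional derivative
`∂_{-p} w (y) = lim_{r ↓ 0} (w y - w (y + r p)) / r`. -/
def diniDeriv {d : ℕ} (p : Sp d) (w : Sp d → ℝ) (y : Sp d) : ℝ :=
  limUnder (𝓝[>] (0 : ℝ)) (fun r : ℝ => (w y - w (y + r • p)) / r)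

/-- The norm of `W^{1,∞}(Ω)`, for functions that are differentiable almost everywhere in `Ω` and
Lipschitz continuous there. -/
def w1infNorm {d : ℕ} (D : Set (Sp d)) (w : Sp d → ℝ) : ℝ≥0∞ :=
  eLpNorm w ∞ (volume.restrict D) + eLpNorm (gradient w) ∞ (volume.restrict D)

/-- `C^∞(ℝ^d)`. -/
def smoothFunctions (d : ℕ) : Submodule ℝ (Sp d → ℝ) where
  carrier := {w | ContDiff ℝ ((⊤ : ℕ∞) : WithTop ℕ∞) w}
  zero_mem' := by
    simp only [Set.mem_ofPred_eq]
    exact contDiff_const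
  add_mem' := by
    intro u v hu hv
    simp only [Set.mem_ofPred_eq] at hu hv ⊢
    exact hu.add hv
  smul_mem' := by
    intro r v hv
    simp only [Set.mem_ofPred_eq] at hv ⊢
    exact contDiff_const.smul hv

/-! ### The numerical scheme -/

/-- A sequence of meshes, time grids and coefficients of the IMEX scheme. The suffix `E` marks
coefficients of the explicit part, `I` of the implicit part; `bBE, cBE, bBI, cBI` belong to the
boundary operators, `fh` and `gh` approximate `fᵅ` and `gᵅ`. -/
structure Discretisation {d : ℕ} {A : Type*} [TopologicalSpace A] (pb : BellmanProblem d A) where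
  mesh : ℕ → Mesh d
  /-- the number `T / h_i` of time steps -/
  n : ℕ → ℕ
  aE : ℕ → A → Sp d → ℝ
  aI : ℕ → A → Sp d → ℝ
  bE : ℕ → A → Sp d → Sp d
  bI : ℕ → A → Sp d → Sp d
  cE : ℕ → A → Sp d → ℝ
  cI : ℕ → A → Sp d → ℝ
  fh : ℕ → A → Sp d → ℝ
  bBE : ℕ → A → Sp d → Sp d
  bBI : ℕ → A → Sp d → Sp d
  cBE : ℕ → A → Sp d → ℝ
  cBI : ℕ → A → Sp d → ℝ
  gh : ℕ → A → Sp d → ℝ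
  isMesh : ∀ i, IsMeshOf (mesh i) pb.cl
  subordinate : ∀ i, IsSubordinate (mesh i) pb.toMixedDomain
  shapeRegular : ∃ σ : ℝ, 0 < σ ∧ ∀ i, ∀ s ∈ elements (mesh i),
    ∃ x, Metric.ball x (σ * Metric.diam (simplex s)) ⊆ simplex s
  meshSize_tendsto : Tendsto (fun i => meshSize (mesh i)) atTop (𝓝 0)
  n_pos : ∀ i, 0 < n i
  timeStep_tendsto : Tendsto (fun i => pb.T / n i) atTop (𝓝 0)

namespace Discretisation

variable {d : ℕ} {A : Type*} [TopologicalSpace A] {pb : BellmanProblem d A}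

/-- The time step size `h_i`; the time steps are `k h_i`, `0 ≤ k ≤ n i`. -/
def h (S : Discretisation pb) (i : ℕ) : ℝ := pb.T / S.n i

/-- The integral over `Ω`. -/
def integ (_S : Discretisation pb) (u : Sp d → ℝ) : ℝ := ∫ x in pb.cl, u x

/-- The discretisation at the interior node `y` of `w ↦ -a Δw - b·∇w + c w`, namely
`a(y) ⟨∇w, ∇φ̂⟩ + ⟨-b·∇w + c w, φ̂⟩`. -/
def interiorOp (S : Discretisation pb) (i : ℕ) (a : Sp d → ℝ) (b : Sp d → Sp d) (c : Sp d → ℝ)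
    (w : Sp d → ℝ) (y : Sp d) : ℝ :=
  a y * S.integ (fun x => inner ℝ (gradient w x) (gradient (nhat (S.mesh i) y) x)) +
    S.integ (fun x => (-inner ℝ (b x) (gradient w x) + c x * w x) * nhat (S.mesh i) y x)

open Classical in
/-- The explicit operator, at the node `y`. -/
def opE (S : Discretisation pb) (i : ℕ) (α : A) (w : Sp d → ℝ) (y : Sp d) : ℝ :=
  if y ∈ interior pb.cl then S.interiorOp i (S.aE i α) (S.bE i α) (S.cE i α) w y
  else if y ∈ pb.bdD then 0
  else diniDeriv (S.bBE i α y) w y + S.cBE i α y * w y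

open Classical in
/-- The implicit operator, at the node `y`. -/
def opI (S : Discretisation pb) (i : ℕ) (α : A) (w : Sp d → ℝ) (y : Sp d) : ℝ :=
  if y ∈ interior pb.cl then S.interiorOp i (S.aI i α) (S.bI i α) (S.cI i α) w y
  else if y ∈ pb.bdD then w y
  else diniDeriv (S.bBI i α y) w y + S.cBI i α y * w y

open Classical in
/-- The right-hand side, at the node `y`. -/
def rhs (S : Discretisation pb) (i : ℕ) (α : A) (y : Sp d) : ℝ :=
  if y ∈ interior pb.cl then S.integ (fun x => S.fh i α x * nhat (S.mesh i) y x)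
  else if y ∈ pb.bdD then pb.g y
  else S.gh i α y

open Classical in
/-- The discrete time derivative `d_i v` at time step `k` and node `y`; it is `0` on the Robin
boundary without time derivative and on the Dirichlet boundary. -/
def timeDiff (S : Discretisation pb) (i : ℕ) (v : ℕ → Sp d → ℝ) (k : ℕ) (y : Sp d) : ℝ :=
  if y ∈ interior pb.cl ∪ pb.bdT then (v (k + 1) y - v k y) / S.h i else 0

/-- `v k = v_i(k h_i, ·)`, `0 ≤ k ≤ n i`, is a numerical solution at refinement level `i`: each
`v k` is a P1 function, `v (n i)` interpolates `v_T`, and at each earlier time step and at each node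
`-d_i v + sup_α (E^α v(k+1) + I^α v(k) - F^α) = 0`. -/
structure IsNumericalSolution (S : Discretisation pb) (i : ℕ) (v : ℕ → Sp d → ℝ) : Prop where
  mem : ∀ k ≤ S.n i, v k ∈ P1 (S.mesh i)
  final : ∀ y ∈ (S.mesh i).vertices, v (S.n i) y = pb.vT y
  step : ∀ k < S.n i, ∀ y ∈ (S.mesh i).vertices,
    IsLUB (range fun α : A => S.opE i α (v (k + 1)) y + S.opI i α (v k) y - S.rhs i α y)
      (S.timeDiff i v k y)

/-- The assumptions on the coefficients of the scheme: regularity in space and in the control,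
sign conditions, admissible directions of the boundary drifts, full implicitness on `bdR`, and
consistency with the coefficients of the Bellman problem. -/
structure ConsistentCoefficients (S : Discretisation pb) : Prop where
  aE_cont : ∀ i, pb.CFamily (S.aE i)
  aI_cont : ∀ i, pb.CFamily (S.aI i)
  bE_cont : ∀ i, pb.CFamily (S.bE i)
  bI_cont : ∀ i, pb.CFamily (S.bI i)
  cE_cont : ∀ i, pb.CFamily (S.cE i)
  cI_cont : ∀ i, pb.CFamily (S.cI i)
  fh_cont : ∀ i, pb.CFamily (S.fh i)
  bBE_pc : ∀ i, pb.PCFamily (S.bBE i)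
  bBI_pc : ∀ i, pb.PCFamily (S.bBI i)
  cBE_pc : ∀ i, pb.PCFamily (S.cBE i)
  cBI_pc : ∀ i, pb.PCFamily (S.cBI i)
  gh_pc : ∀ i, pb.PCFamily (S.gh i)
  cE_nonneg : ∀ i α, ∀ x ∈ pb.cl, 0 ≤ S.cE i α x
  cI_nonneg : ∀ i α, ∀ x ∈ pb.cl, 0 ≤ S.cI i α x
  fh_nonneg : ∀ i α, ∀ x ∈ pb.cl, 0 ≤ S.fh i α x
  cBE_nonneg : ∀ i α, ∀ x ∈ frontier pb.cl, 0 ≤ S.cBE i α x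
  cBI_nonneg : ∀ i α, ∀ x ∈ frontier pb.cl, 0 ≤ S.cBI i α x
  gh_nonneg : ∀ i α, ∀ x ∈ frontier pb.cl, 0 ≤ S.gh i α x
  /-- the one-sided derivatives in the scheme are taken along segments inside `Ω̄` -/
  cone : ∀ i α, ∀ y ∈ (S.mesh i).vertices, y ∈ pb.bdT ∪ pb.bdR →
    S.bBE i α y ∈ tangentDirections pb.cl y ∧ S.bBI i α y ∈ tangentDirections pb.cl y
  /-- the two parts of the boundary drift are bounded independently of `i` and `α` -/
  bB_bounded : ∃ B : ℝ, ∀ i α, ∀ x ∈ pb.bdT, ‖S.bBE i α x‖ ≤ B ∧ ‖S.bBI i α x‖ ≤ B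
  implicit_R : ∀ i α, ∀ x ∈ pb.bdR, S.aE i α x = 0 ∧ S.bE i α x = 0 ∧ S.cE i α x = 0 ∧
    S.bBE i α x = 0 ∧ S.cBE i α x = 0 ∧ 0 < S.cBI i α x
  consistent_a : ∀ ε > 0, ∀ᶠ i in atTop, ∀ α, ∀ y ∈ (S.mesh i).vertices, y ∉ pb.bdD →
    ∀ x ∈ tsupport (nhat (S.mesh i) y), |pb.a α x - (S.aE i α y + S.aI i α y)| ≤ ε
  consistent_interior : ∀ ε > 0, ∀ᶠ i in atTop, ∀ α, ∀ x ∈ pb.cl,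
    ‖pb.b α x - (S.bE i α x + S.bI i α x)‖ ≤ ε ∧ |pb.c α x - (S.cE i α x + S.cI i α x)| ≤ ε ∧
      |pb.f α x - S.fh i α x| ≤ ε
  consistent_boundary : ∀ ε > 0, ∀ᶠ i in atTop, ∀ α, ∀ x ∈ frontier pb.cl,
    ‖pb.bB α x - (S.bBE i α x + S.bBI i α x)‖ ≤ ε ∧
      |pb.cB α x - (S.cBE i α x + S.cBI i α x)| ≤ ε ∧ |pb.gB α x - S.gh i α x| ≤ ε

/-- The mesh is strictly acute and the second-order coefficients at interior nodes dominate
artificial diffusion coefficients `νE`, `νI` that balance the lower order terms. -/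
def ArtificialDiffusion (S : Discretisation pb) : Prop :=
  ∀ i, ∃ θ ∈ Ioo (0 : ℝ) (Real.pi / 2), StrictlyAcute (S.mesh i) θ ∧
    ∀ α, ∀ y ∈ (S.mesh i).vertices, y ∈ interior pb.cl →
      ∃ νE νI : ℝ, 0 ≤ νE ∧ 0 ≤ νI ∧ νE ≤ S.aE i α y ∧ νI ≤ S.aI i α y ∧
        ∀ s ∈ elements (S.mesh i), y ∈ s → ∀ x ∈ interior (simplex s),
          vecSupOn (simplex s) (S.bE i α) +
              Metric.diam (simplex s) * supOn (simplex s) (S.cE i α) ≤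
            νE * Real.sin θ * ‖gradient (nhat (S.mesh i) y) x‖ * volume.real (simplex s) ∧
          vecSupOn (simplex s) (S.bI i α) +
              Metric.diam (simplex s) * supOn (simplex s) (S.cI i α) ≤
            νI * Real.sin θ * ‖gradient (nhat (S.mesh i) y) x‖ * volume.real (simplex s)

/-- The time step restriction: the diagonal entries of `h_i E^α - Id` on `Ω ∪ bdT` are
non-positive. -/
def TimeStepRestriction (S : Discretisation pb) : Prop :=
  ∀ i α, ∀ y ∈ (S.mesh i).vertices, y ∈ interior pb.cl ∪ pb.bdT →
    S.h i * S.opE i α (hat (S.mesh i) y) y ≤ 1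

/-- Existence of elliptic projections `P_i` onto the finite element spaces which are stable and
convergent in `W^{1,∞}(Ω)`. -/
def HasEllipticProjections (S : Discretisation pb) : Prop :=
  ∃ P : ∀ i, smoothFunctions d →ₗ[ℝ] P1 (S.mesh i),
    (∀ i (w : smoothFunctions d), ∀ y ∈ (S.mesh i).vertices, y ∈ interior pb.cl →
      S.integ (fun x => inner ℝ (gradient (P i w : Sp d → ℝ) x)
          (gradient (nhat (S.mesh i) y) x)) =
        S.integ (fun x => inner ℝ (gradient (w : Sp d → ℝ) x)
          (gradient (nhat (S.mesh i) y) x))) ∧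
    (∃ C : NNReal, ∀ i (w : smoothFunctions d),
      w1infNorm pb.cl (P i w : Sp d → ℝ) ≤ C * w1infNorm pb.cl (w : Sp d → ℝ)) ∧
    ∀ w : smoothFunctions d,
      Tendsto (fun i => w1infNorm pb.cl ((P i w : Sp d → ℝ) - (w : Sp d → ℝ))) atTop (𝓝 0)

end Discretisation

end BellmanFEM

end

/-
Subtracting a discrete supersolution turns the scheme into a comparison principle: acuteness of the
mesh and artificial diffusion make every nodal operator monotone, and a first negative minimum of
the difference is impossible. Comparison with `0` gives `0 ≤ v i`.

For the upper bound, freeze the strict supersolution at a time `τ`, smooth it, and let `U`, `R` be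
the elliptic projections of its value and of its time derivative. By consistency the affine barrier
`U + ρ R + C` in `ρ = t - τ` is a strict discrete supersolution for all `C ≥ 0`, as soon as `|ρ|` is
small and `i` is large. It carries a bound of `v i` on `[τ + Δ, T]` over to `[τ - Δ, T]`, so the
infimum of the times after which the solutions are eventually bounded is `0` and is attained. Each
of the finitely many remaining `v i` has finitely many nodal values.
-/

namespace BellmanFEM

variable {d : ℕ} {K : Mesh d} {s t : Finset (Sp d)} {x y z : Sp d} {D : Set (Sp d)}
  {w w' u v : Sp d → ℝ}

/-! ### Barycentric coordinates and hat functions -/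

theorem exists_isBarycentric (hx : x ∈ simplex s) : ∃ w, IsBarycentric s x w := by
  classical
  obtain ⟨w, h0, h1, h2⟩ := Finset.mem_convexHull'.1 hx
  refine ⟨fun y => if y ∈ s then w y else 0, fun y hy => by simpa [hy] using h0 y hy,
    fun y hy => by simp [hy], ?_, ?_⟩
  · rw [← h1]; exact Finset.sum_congr rfl fun y hy => by simp [hy]
  · rw [← h2]; exact Finset.sum_congr rfl fun y hy => by simp [hy]

namespace IsBarycentric

theorem mem_simplex (h : IsBarycentric s x w) : x ∈ simplex s :=
  Finset.mem_convexHull'.2 ⟨w, h.1, h.2.2.1, h.2.2.2⟩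

theorem nonneg (h : IsBarycentric s x w) (y : Sp d) : 0 ≤ w y := by
  by_cases hy : y ∈ s
  · exact h.1 y hy
  · exact (h.2.1 y hy).ge

theorem mono (h : IsBarycentric s x w) (hst : s ⊆ t) : IsBarycentric t x w := by
  refine ⟨fun y _ => h.nonneg y, fun y hy => h.2.1 y fun h' => hy (hst h'), ?_, ?_⟩
  · rw [← h.2.2.1]
    exact (Finset.sum_subset hst fun y _ hy => h.2.1 y hy).symm
  · rw [← h.2.2.2]
    exact (Finset.sum_subset hst fun y _ hy => by simp [h.2.1 y hy]).symm

theorem unique (hs : AffineIndependent ℝ ((↑) : s → Sp d))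
    (h : IsBarycentric s x w) (h' : IsBarycentric s x w') : w = w' := by
  have hzero := affineIndependent_iff.1 hs Finset.univ (fun y => w y - w' y)
    (by rw [Finset.sum_coe_sort s (fun y => w y - w' y), Finset.sum_sub_distrib, h.2.2.1,
          h'.2.2.1, sub_self])
    (by rw [Finset.sum_coe_sort s (fun y => (w y - w' y) • y)]
        simp only [sub_smul, Finset.sum_sub_distrib, h.2.2.2, h'.2.2.2, sub_self])
  funext y
  by_cases hy : y ∈ s
  · exact sub_eq_zero.1 (hzero ⟨y, hy⟩ (Finset.mem_univ _))
  · rw [h.2.1 y hy, h'.2.1 y hy]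

theorem unique_of_faces (hs : s ∈ K.faces) (ht : t ∈ K.faces)
    (h : IsBarycentric s x w) (h' : IsBarycentric t x w') : w = w' := by
  classical
  have hx : x ∈ simplex (s ∩ t) := by
    have := K.inter_subset_convexHull hs ht ⟨h.mem_simplex, h'.mem_simplex⟩
    rwa [← Finset.coe_inter] at this
  obtain ⟨w'', hw''⟩ := exists_isBarycentric hx
  rw [h.unique (K.indep hs) (hw''.mono Finset.inter_subset_left),
    h'.unique (K.indep ht) (hw''.mono Finset.inter_subset_right)]

theorem hat_eq (h : IsBarycentric s x w) (hs : s ∈ K.faces) (y : Sp d) : hat K y x = w y := by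
  have hex : ∃ w : Sp d → ℝ, ∃ s ∈ K.faces, IsBarycentric s x w := ⟨w, s, hs, h⟩
  obtain ⟨t, ht, h'⟩ := hex.choose_spec
  rw [hat, dif_pos hex, unique_of_faces ht hs h' h]

end IsBarycentric

theorem mem_simplex_of_mem (hy : y ∈ s) : y ∈ simplex s := subset_convexHull ℝ _ hy

theorem convex_simplex (s : Finset (Sp d)) : Convex ℝ (simplex s) := convex_convexHull ℝ _

theorem isCompact_simplex (s : Finset (Sp d)) : IsCompact (simplex s) :=
  s.finite_toSet.isCompact_convexHull (𝕜 := ℝ)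

theorem mem_vertices_of_mem (hs : s ∈ K.faces) (hy : y ∈ s) : y ∈ K.vertices :=
  K.down_closed hs (Finset.singleton_subset_iff.2 hy) (by simp)

theorem isBarycentric_hat (hs : s ∈ K.faces) (hx : x ∈ simplex s) :
    IsBarycentric s x (fun y => hat K y x) := by
  obtain ⟨w, hw⟩ := exists_isBarycentric hx
  simpa only [hw.hat_eq hs] using hw

theorem hat_eq_zero_of_notMem_space (hx : x ∉ K.space) (y : Sp d) : hat K y x = 0 := by
  rw [hat, dif_neg]
  rintro ⟨w, s, hs, h⟩
  exact hx (K.convexHull_subset_space hs h.mem_simplex)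

theorem hat_eq_zero_of_notMem (hs : s ∈ K.faces) (hx : x ∈ simplex s) (hy : y ∉ s) :
    hat K y x = 0 :=
  (isBarycentric_hat hs hx).2.1 y hy

theorem hat_nonneg (K : Mesh d) (y x : Sp d) : 0 ≤ hat K y x := by
  by_cases hx : x ∈ K.space
  · obtain ⟨s, hs, hxs⟩ := K.mem_space_iff.1 hx
    exact (isBarycentric_hat hs hxs).nonneg y
  · exact (hat_eq_zero_of_notMem_space hx y).ge

theorem hat_self (hy : y ∈ K.vertices) : hat K y y = 1 := by
  simpa using (isBarycentric_hat hy (mem_simplex_of_mem (Finset.mem_singleton_self y))).2.2.1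

theorem hat_of_ne (hz : z ∈ K.vertices) (hyz : y ≠ z) : hat K y z = 0 :=
  hat_eq_zero_of_notMem hz (mem_simplex_of_mem (Finset.mem_singleton_self z)) (by simpa)

/-! ### Elements -/

/-- The vertices of an element, as an affine basis of `ℝ^d`; its coordinate functions are the
barycentric coordinates. -/
noncomputable def elementBasis (hs : s ∈ elements K) : AffineBasis s ℝ (Sp d) :=
  ⟨(↑), K.indep hs.1, by
    rw [(K.indep hs.1).affineSpan_eq_top_iff_card_eq_finrank_add_one]
    simp [hs.2]⟩

theorem elementBasis_apply (hs : s ∈ elements K) (z : s) : elementBasis hs z = z := rfl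

theorem range_elementBasis (hs : s ∈ elements K) : range (elementBasis hs) = (s : Set (Sp d)) := by
  ext z; simp [elementBasis_apply]

theorem simplex_eq_coord_nonneg (hs : s ∈ elements K) :
    simplex s = {x | ∀ z, 0 ≤ (elementBasis hs).coord z x} := by
  rw [simplex, ← range_elementBasis hs, AffineBasis.convexHull_eq_nonneg_coord]

theorem interior_simplex_eq_coord_pos (hs : s ∈ elements K) :
    interior (simplex s) = {x | ∀ z, 0 < (elementBasis hs).coord z x} := by
  rw [simplex, ← range_elementBasis hs, AffineBasis.interior_convexHull]

theorem hat_eq_coord (hs : s ∈ elements K) (hx : x ∈ simplex s) (hy : y ∈ s) :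
    hat K y x = (elementBasis hs).coord ⟨y, hy⟩ x := by
  classical
  set b := elementBasis hs with hb
  have h : IsBarycentric s x fun z => if h : z ∈ s then b.coord ⟨z, h⟩ x else 0 := by
    rw [simplex_eq_coord_nonneg hs] at hx
    refine ⟨fun z hz => by simpa [hz] using hx ⟨z, hz⟩, fun z hz => by simp [hz], ?_, ?_⟩
    · rw [← Finset.sum_coe_sort, ← b.sum_coord_apply_eq_one x]
      simp
    · rw [← Finset.sum_coe_sort s fun z => (if h : z ∈ s then b.coord ⟨z, h⟩ x else 0) • z]
      conv_rhs => rw [← b.linear_combination_coord_eq_self x]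
      simp [hb, elementBasis_apply]
  rw [h.hat_eq hs.1 y, dif_pos hy]

theorem hat_pos_of_mem_interior (hs : s ∈ elements K) (hx : x ∈ interior (simplex s))
    (hy : y ∈ s) : 0 < hat K y x := by
  rw [hat_eq_coord hs (interior_subset hx) hy]
  rw [interior_simplex_eq_coord_pos hs] at hx
  exact hx _

theorem centroid_mem_interior (hs : s ∈ elements K) :
    s.centroid ℝ id ∈ interior (simplex s) := by
  rw [← Finset.centroid_univ, simplex, ← range_elementBasis hs]
  exact (elementBasis hs).centroid_mem_interior_convexHull

theorem closure_interior_simplex (hs : s ∈ elements K) :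
    closure (interior (simplex s)) = simplex s := by
  rw [(convex_simplex s).closure_interior_eq_closure_of_nonempty_interior
    ⟨_, centroid_mem_interior hs⟩, (isCompact_simplex s).isClosed.closure_eq]

theorem disjoint_interior_simplex (hs : s ∈ elements K) (ht : t ∈ elements K) (hst : s ≠ t) :
    Disjoint (interior (simplex s)) (interior (simplex t)) := by
  rw [Set.disjoint_left]
  intro x hxs hxt
  have hsub : s ⊆ t := fun y hy => by
    by_contra hyt
    exact (hat_pos_of_mem_interior hs hxs hy).ne'
      (hat_eq_zero_of_notMem ht.1 (interior_subset hxt) hyt)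
  exact hst (Finset.eq_of_subset_of_card_le hsub (by rw [hs.2, ht.2]))

namespace IsMeshOf

theorem exists_element (hK : IsMeshOf K D) (hx : x ∈ D) : ∃ s ∈ elements K, x ∈ simplex s := by
  rw [← hK.space_eq, K.mem_space_iff] at hx
  obtain ⟨s, hs, hxs⟩ := hx
  obtain ⟨t, ht, hst⟩ := hK.pure s hs
  exact ⟨t, ht, convexHull_mono (Finset.coe_subset.2 hst) hxs⟩

theorem exists_element_of_mem_vertices (hK : IsMeshOf K D) (hy : y ∈ K.vertices) :
    ∃ s ∈ elements K, y ∈ s := by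
  obtain ⟨t, ht, hst⟩ := hK.pure {y} hy
  exact ⟨t, ht, hst (Finset.mem_singleton_self y)⟩

theorem simplex_subset (hK : IsMeshOf K D) (hs : s ∈ elements K) : simplex s ⊆ D := by
  rw [← hK.space_eq]; exact K.convexHull_subset_space hs.1

theorem finite_elements (hK : IsMeshOf K D) : (elements K).Finite :=
  hK.finite.subset fun _ h => h.1

theorem finite_vertices (hK : IsMeshOf K D) : K.vertices.Finite := by
  rw [K.vertices_eq]
  exact hK.finite.biUnion fun s _ => s.finite_toSet

theorem vertices_subset (hK : IsMeshOf K D) : K.vertices ⊆ D := by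
  rw [← hK.space_eq]; exact K.vertices_subset_space

theorem diam_le_meshSize (hK : IsMeshOf K D) (hs : s ∈ elements K) :
    Metric.diam (simplex s) ≤ meshSize K :=
  le_csSup (hK.finite_elements.image _).bddAbove (mem_image_of_mem _ hs)

theorem dist_le_meshSize (hK : IsMeshOf K D) (hs : s ∈ elements K) (hx : x ∈ simplex s)
    (hy : y ∈ simplex s) : dist x y ≤ meshSize K :=
  (Metric.dist_le_diam_of_mem (isCompact_simplex s).isBounded hx hy).trans (hK.diam_le_meshSize hs)

end IsMeshOf

/-! ### Finite element functions -/

theorem hat_mem_P1 (hK : IsMeshOf K D) (y : Sp d) : hat K y ∈ P1 K := by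
  refine ⟨fun s hs => ?_, fun x hx => hat_eq_zero_of_notMem_space hx y⟩
  obtain ⟨t, ht, hst⟩ := hK.pure s hs
  have hsub : simplex s ⊆ simplex t := convexHull_mono (Finset.coe_subset.2 hst)
  by_cases hy : y ∈ t
  · exact ⟨(elementBasis ht).coord ⟨y, hy⟩, fun x hx => hat_eq_coord ht (hsub hx) hy⟩
  · exact ⟨0, fun x hx => hat_eq_zero_of_notMem ht.1 (hsub hx) hy⟩

theorem nhat_eq_smul (K : Mesh d) (y : Sp d) :
    nhat K y = (∫ z in K.space, |hat K y z|)⁻¹ • hat K y := by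
  funext x; simp [nhat, div_eq_inv_mul]

theorem nhat_mem_P1 (hK : IsMeshOf K D) (y : Sp d) : nhat K y ∈ P1 K := by
  rw [nhat_eq_smul]; exact (P1 K).smul_mem _ (hat_mem_P1 hK y)

theorem nhat_nonneg (K : Mesh d) (y x : Sp d) : 0 ≤ nhat K y x :=
  div_nonneg (hat_nonneg K y x) (integral_nonneg fun _ => abs_nonneg _)

open Classical in
/-- The constant function `1`, cut off outside the mesh so that it lies in `P1 K`. -/
noncomputable def unit (K : Mesh d) : Sp d → ℝ := fun x => if x ∈ K.space then 1 else 0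

theorem unit_mem_P1 (K : Mesh d) : unit K ∈ P1 K :=
  ⟨fun s hs => ⟨AffineMap.const ℝ _ 1, fun x hx => by
    simp [unit, K.convexHull_subset_space hs hx]⟩, fun x hx => by simp [unit, hx]⟩

theorem IsMeshOf.unit_apply (hK : IsMeshOf K D) (hx : x ∈ D) : unit K x = 1 := by
  simp [unit, hK.space_eq, hx]

/-- The gradient on the element `s` of the P1 function with the nodal values of `v`. Built from the
gradients of the hat functions (which are constant in the element), it is linear in `v`. -/
noncomputable def elemGrad (K : Mesh d) (s : Finset (Sp d)) : (Sp d → ℝ) →ₗ[ℝ] Sp d :=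
  ∑ z ∈ s, (LinearMap.proj z).smulRight (gradient (hat K z) (s.centroid ℝ id))

theorem elemGrad_apply (K : Mesh d) (s : Finset (Sp d)) (v : Sp d → ℝ) :
    elemGrad K s v = ∑ z ∈ s, v z • gradient (hat K z) (s.centroid ℝ id) := by
  simp [elemGrad]

theorem elemGrad_congr (h : EqOn u v s) : elemGrad K s u = elemGrad K s v := by
  simp only [elemGrad_apply]
  exact Finset.sum_congr rfl fun z hz => by rw [h hz]

theorem hasGradientAt_of_sub_eq_inner {S : Set (Sp d)} {g : Sp d} (hx : x ∈ interior S)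
    (h : ∀ x' ∈ S, v x' - v x = inner ℝ g (x' - x)) : HasGradientAt v g x := by
  have hL : HasFDerivAt (fun x' => v x + InnerProductSpace.toDual ℝ (Sp d) g (x' - x))
      (InnerProductSpace.toDual ℝ (Sp d) g) x := by
    simpa using ((InnerProductSpace.toDual ℝ (Sp d) g).hasFDerivAt.comp x
      ((hasFDerivAt_id x).sub_const x)).const_add (v x)
  refine hL.congr_of_eventuallyEq ?_
  filter_upwards [mem_interior_iff_mem_nhds.1 hx] with x' hx'
  rw [InnerProductSpace.toDual_apply_apply, ← h x' hx', add_sub_cancel]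

namespace P1

theorem exists_sub_eq_inner (hv : v ∈ P1 K) (hs : s ∈ K.faces) :
    ∃ g : Sp d, ∀ x ∈ simplex s, ∀ x' ∈ simplex s, v x - v x' = inner ℝ g (x - x') := by
  obtain ⟨L, hL⟩ := hv.1 s hs
  refine ⟨(InnerProductSpace.toDual ℝ (Sp d)).symm (LinearMap.toContinuousLinearMap L.linear),
    fun x hx x' hx' => ?_⟩
  rw [hL hx, hL hx', InnerProductSpace.toDual_symm_apply]
  simpa using (L.linearMap_vsub x x').symm

theorem continuousOn_simplex (hv : v ∈ P1 K) (hs : s ∈ K.faces) :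
    ContinuousOn v (simplex s) := by
  obtain ⟨L, hL⟩ := hv.1 s hs
  exact (L.continuous_of_finiteDimensional.continuousOn).congr hL

theorem eq_sum (hv : v ∈ P1 K) (hs : s ∈ K.faces) (hx : x ∈ simplex s) :
    v x = ∑ z ∈ s, hat K z x * v z := by
  obtain ⟨g, hg⟩ := exists_sub_eq_inner hv hs
  have hb := isBarycentric_hat hs hx
  have hzero : ∑ z ∈ s, hat K z x • (z - x) = 0 := by
    simp_rw [smul_sub]
    rw [Finset.sum_sub_distrib, hb.2.2.2, ← Finset.sum_smul, hb.2.2.1, one_smul, sub_self]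
  have hdiff : ∑ z ∈ s, hat K z x * (v z - v x) = 0 := by
    rw [← inner_zero_right (𝕜 := ℝ) g, ← hzero, inner_sum]
    exact Finset.sum_congr rfl fun z hz => by
      rw [hg z (mem_simplex_of_mem hz) x hx, real_inner_smul_right]
  simp only [mul_sub, Finset.sum_sub_distrib, ← Finset.sum_mul, hb.2.2.1] at hdiff
  linarith

theorem mem_of_convex {C : Set ℝ} (hC : Convex ℝ C) (hK : IsMeshOf K D) (hv : v ∈ P1 K)
    (h : ∀ y ∈ K.vertices, v y ∈ C) (hx : x ∈ D) : v x ∈ C := by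
  obtain ⟨s, hs, hxs⟩ := hK.exists_element hx
  rw [eq_sum hv hs.1 hxs]
  exact hC.sum_mem (fun z _ => hat_nonneg K z x) (isBarycentric_hat hs.1 hxs).2.2.1
    fun z hz => h z (mem_vertices_of_mem hs.1 hz)

theorem abs_le (hK : IsMeshOf K D) (hv : v ∈ P1 K) {C : ℝ}
    (h : ∀ y ∈ K.vertices, |v y| ≤ C) (hx : x ∈ D) : |v x| ≤ C :=
  _root_.abs_le.2 (mem_of_convex (convex_Icc (-C) C) hK hv
    (fun y hy => _root_.abs_le.1 (h y hy)) hx)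

theorem nonneg (hK : IsMeshOf K D) (hv : v ∈ P1 K)
    (h : ∀ y ∈ K.vertices, 0 ≤ v y) (hx : x ∈ D) : 0 ≤ v x :=
  mem_of_convex (convex_Ici 0) hK hv h hx

theorem sub_eq_inner (hK : IsMeshOf K D) (hv : v ∈ P1 K) (hs : s ∈ elements K) {x x' : Sp d}
    (hx : x ∈ simplex s) (hx' : x' ∈ simplex s) :
    v x - v x' = inner ℝ (elemGrad K s v) (x - x') := by
  have hhat (z : Sp d) : hat K z x - hat K z x' =
      inner ℝ (gradient (hat K z) (s.centroid ℝ id)) (x - x') := by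
    obtain ⟨g, hg⟩ := exists_sub_eq_inner (hat_mem_P1 hK z) hs.1
    have hc := centroid_mem_interior hs
    rw [hg x hx x' hx', (hasGradientAt_of_sub_eq_inner hc
      fun p hp => hg p hp _ (interior_subset hc)).gradient]
  rw [eq_sum hv hs.1 hx, eq_sum hv hs.1 hx', elemGrad_apply, sum_inner, ← Finset.sum_sub_distrib]
  exact Finset.sum_congr rfl fun z _ => by rw [real_inner_smul_left, ← hhat]; ring

theorem hasGradientAt (hK : IsMeshOf K D) (hv : v ∈ P1 K) (hs : s ∈ elements K)
    (hx : x ∈ interior (simplex s)) : HasGradientAt v (elemGrad K s v) x :=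
  hasGradientAt_of_sub_eq_inner hx fun _ hx' => sub_eq_inner hK hv hs hx' (interior_subset hx)

theorem gradient_eq (hK : IsMeshOf K D) (hv : v ∈ P1 K) (hs : s ∈ elements K)
    (hx : x ∈ interior (simplex s)) : gradient v x = elemGrad K s v :=
  (hasGradientAt hK hv hs hx).gradient

end P1

theorem elemGrad_unit (hK : IsMeshOf K D) (hs : s ∈ elements K) : elemGrad K s (unit K) = 0 := by
  have hx := centroid_mem_interior hs
  have hone : unit K =ᶠ[𝓝 (s.centroid ℝ id)] fun _ => 1 := by
    filter_upwards [mem_interior_iff_mem_nhds.1 hx] with x' hx'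
    exact hK.unit_apply (hK.simplex_subset hs hx')
  rw [← P1.gradient_eq hK (unit_mem_P1 K) hs hx, hone.gradient_eq, gradient_fun_const]

theorem elemGrad_hat_eq_zero (hs : s ∈ K.faces) (hy : y ∉ s) : elemGrad K s (hat K y) = 0 := by
  rw [← map_zero (elemGrad K s)]
  exact elemGrad_congr fun z hz => hat_of_ne (mem_vertices_of_mem hs hz) fun h => hy (h ▸ hz)

theorem elemGrad_eq_sum (hs : s ∈ K.faces) (v : Sp d → ℝ) :
    elemGrad K s v = ∑ z ∈ s, v z • elemGrad K s (hat K z) := by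
  rw [← funext fun z => map_smul (elemGrad K s) (v z) (hat K z), ← map_sum]
  refine elemGrad_congr fun z hz => ?_
  have hz' := mem_vertices_of_mem hs hz
  rw [Finset.sum_apply, Finset.sum_eq_single_of_mem z hz fun z' _ h => by simp [hat_of_ne hz' h]]
  simp [hat_self hz']

theorem sum_elemGrad_hat (hK : IsMeshOf K D) (hs : s ∈ elements K) :
    ∑ z ∈ s, elemGrad K s (hat K z) = 0 := by
  rw [← elemGrad_unit hK hs, elemGrad_eq_sum hs.1 (unit K)]
  exact Finset.sum_congr rfl fun z hz => by
    rw [hK.unit_apply (hK.simplex_subset hs (mem_simplex_of_mem hz)), one_smul]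

theorem elemGrad_nhat (K : Mesh d) (s : Finset (Sp d)) (y : Sp d) :
    elemGrad K s (nhat K y) = (∫ z in K.space, |hat K y z|)⁻¹ • elemGrad K s (hat K y) := by
  rw [nhat_eq_smul, map_smul]

theorem one_le_norm_elemGrad_hat_mul_diam (hK : IsMeshOf K D) (hd : 1 ≤ d) (hs : s ∈ elements K)
    (hy : y ∈ s) : 1 ≤ ‖elemGrad K s (hat K y)‖ * Metric.diam (simplex s) := by
  obtain ⟨z, hz, hzy⟩ : ∃ z ∈ s, z ≠ y := Finset.exists_mem_ne (by rw [hs.2]; lia) y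
  have hys := mem_simplex_of_mem hy
  have hzs := mem_simplex_of_mem hz
  calc (1 : ℝ) = hat K y y - hat K y z := by
        rw [hat_self (mem_vertices_of_mem hs.1 hy),
          hat_of_ne (mem_vertices_of_mem hs.1 hz) hzy.symm, sub_zero]
    _ = inner ℝ (elemGrad K s (hat K y)) (y - z) :=
        P1.sub_eq_inner hK (hat_mem_P1 hK y) hs hys hzs
    _ ≤ ‖elemGrad K s (hat K y)‖ * dist y z := by
        rw [dist_eq_norm]; exact real_inner_le_norm _ _
    _ ≤ _ := by
        gcongr
        exact Metric.dist_le_diam_of_mem (isCompact_simplex s).isBounded hys hzs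

/-! ### Piecewise continuous functions and their integrals -/

/-- Piecewise continuity with respect to the mesh: in the interior of each element `ψ` agrees with a
function that is continuous on the closed element. -/
def PwCont (K : Mesh d) {F : Type*} [TopologicalSpace F] (ψ : Sp d → F) : Prop :=
  ∀ s ∈ elements K, ∃ ψ' : Sp d → F, ContinuousOn ψ' (simplex s) ∧ EqOn ψ ψ' (interior (simplex s))

namespace PwCont

variable {F G H : Type*} [TopologicalSpace F] [TopologicalSpace G] [TopologicalSpace H]

theorem const (c : F) : PwCont K fun _ : Sp d => c :=
  fun _ _ => ⟨fun _ => c, continuousOn_const, fun _ _ => rfl⟩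

theorem of_continuousOn (hK : IsMeshOf K D) {ψ : Sp d → F} (h : ContinuousOn ψ D) :
    PwCont K ψ := fun _ hs => ⟨ψ, h.mono (hK.simplex_subset hs), fun _ _ => rfl⟩

theorem of_mem_P1 (hv : v ∈ P1 K) : PwCont K v :=
  fun _ hs => ⟨v, P1.continuousOn_simplex hv hs.1, fun _ _ => rfl⟩

theorem gradient (hK : IsMeshOf K D) (hv : v ∈ P1 K) : PwCont K (gradient v) :=
  fun s hs => ⟨fun _ => elemGrad K s v, continuousOn_const,
    fun _ hx => P1.gradient_eq hK hv hs hx⟩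

theorem comp₂ {ψ : Sp d → F} {χ : Sp d → G} (hψ : PwCont K ψ) (hχ : PwCont K χ)
    {op : F → G → H} (hop : Continuous fun p : F × G => op p.1 p.2) :
    PwCont K fun x => op (ψ x) (χ x) := by
  intro s hs
  obtain ⟨ψ', hψ', hψeq⟩ := hψ s hs
  obtain ⟨χ', hχ', hχeq⟩ := hχ s hs
  exact ⟨fun x => op (ψ' x) (χ' x), hop.comp_continuousOn (hψ'.prodMk hχ'),
    fun x hx => by simp only [hψeq hx, hχeq hx]⟩

variable {ψ χ : Sp d → ℝ}

theorem neg (hψ : PwCont K ψ) : PwCont K fun x => -ψ x :=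
  hψ.comp₂ (const (0 : ℝ)) (op := fun a _ => -a) (by fun_prop)

theorem add (hψ : PwCont K ψ) (hχ : PwCont K χ) : PwCont K fun x => ψ x + χ x :=
  hψ.comp₂ hχ continuous_add

theorem sub (hψ : PwCont K ψ) (hχ : PwCont K χ) : PwCont K fun x => ψ x - χ x :=
  hψ.comp₂ hχ continuous_sub

theorem mul (hψ : PwCont K ψ) (hχ : PwCont K χ) : PwCont K fun x => ψ x * χ x :=
  hψ.comp₂ hχ continuous_mul

theorem inner {ψ χ : Sp d → Sp d} (hψ : PwCont K ψ) (hχ : PwCont K χ) :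
    PwCont K fun x => inner ℝ (ψ x) (χ x) :=
  hψ.comp₂ hχ (op := fun a b => Inner.inner ℝ a b) continuous_inner

theorem integrableOn_interior (hψ : PwCont K ψ) (hs : s ∈ elements K) :
    IntegrableOn ψ (interior (simplex s)) := by
  obtain ⟨ψ', hψ', heq⟩ := hψ s hs
  exact ((hψ'.integrableOn_compact (isCompact_simplex s)).mono_set interior_subset).congr_fun
    heq.symm isOpen_interior.measurableSet

end PwCont

theorem interior_simplex_ae_eq (s : Finset (Sp d)) :
    interior (simplex s) =ᵐ[volume] simplex s :=
  interior_ae_eq_of_null_frontier ((convex_simplex s).addHaar_frontier volume)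

theorem volume_real_interior_simplex (s : Finset (Sp d)) :
    volume.real (interior (simplex s)) = volume.real (simplex s) :=
  measureReal_congr (interior_simplex_ae_eq s)

theorem volume_interior_simplex_pos (hs : s ∈ elements K) : 0 < volume (interior (simplex s)) :=
  isOpen_interior.measure_pos _ ⟨_, centroid_mem_interior hs⟩

theorem volume_real_simplex_pos (hs : s ∈ elements K) : 0 < volume.real (simplex s) := by
  rw [← volume_real_interior_simplex]
  exact ENNReal.toReal_pos (volume_interior_simplex_pos hs).ne'
    ((measure_mono interior_subset).trans_lt (isCompact_simplex s).measure_lt_top).ne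

theorem IsMeshOf.ae_eq_biUnion (hK : IsMeshOf K D) :
    (⋃ s ∈ hK.finite_elements.toFinset, interior (simplex s)) =ᵐ[volume] D := by
  have hD : D = ⋃ s ∈ hK.finite_elements.toFinset, simplex s := by
    ext x
    simp only [Set.Finite.mem_toFinset, mem_iUnion, exists_prop]
    exact ⟨fun hx => hK.exists_element hx, fun ⟨s, hs, hx⟩ => hK.simplex_subset hs hx⟩
  have h := Finset.eventuallyEq_iUnion hK.finite_elements.toFinset
    fun s _ => interior_simplex_ae_eq s
  rwa [← hD] at h

theorem IsMeshOf.ae_mem_interior (hK : IsMeshOf K D) :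
    ∀ᵐ x ∂volume.restrict D, ∃ s ∈ elements K, x ∈ interior (simplex s) := by
  rw [← Measure.restrict_congr_set hK.ae_eq_biUnion]
  filter_upwards [ae_restrict_mem (Finset.measurableSet_biUnion _
    fun s _ => isOpen_interior.measurableSet)] with x hx
  simpa using hx

theorem PwCont.integrableOn {ψ : Sp d → ℝ} (hK : IsMeshOf K D) (hψ : PwCont K ψ) :
    IntegrableOn ψ D := by
  rw [← integrableOn_congr_set_ae hK.ae_eq_biUnion, integrableOn_finset_iUnion]
  exact fun s hs => hψ.integrableOn_interior (hK.finite_elements.mem_toFinset.1 hs)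

theorem PwCont.integral_eq_sum {ψ : Sp d → ℝ} (hK : IsMeshOf K D) (hψ : PwCont K ψ) :
    ∫ x in D, ψ x = ∑ s ∈ hK.finite_elements.toFinset, ∫ x in interior (simplex s), ψ x := by
  rw [← setIntegral_congr_set hK.ae_eq_biUnion, integral_biUnion_finset]
  · exact fun s _ => isOpen_interior.measurableSet
  · intro s hs t ht hst
    exact disjoint_interior_simplex (hK.finite_elements.mem_toFinset.1 hs)
      (hK.finite_elements.mem_toFinset.1 ht) hst
  · exact fun s hs => hψ.integrableOn_interior (hK.finite_elements.mem_toFinset.1 hs)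

/-! ### Averages against normalised hat functions -/

theorem integral_abs_hat (hK : IsMeshOf K D) (y : Sp d) :
    ∫ z in K.space, |hat K y z| = ∫ x in D, hat K y x := by
  rw [hK.space_eq]
  simp only [abs_of_nonneg (hat_nonneg K y _)]

theorem integral_hat_pos (hK : IsMeshOf K D) (hy : y ∈ K.vertices) : 0 < ∫ x in D, hat K y x := by
  obtain ⟨s, hs, hys⟩ := hK.exists_element_of_mem_vertices hy
  have hp : PwCont K (hat K y) := PwCont.of_mem_P1 (hat_mem_P1 hK y)
  rw [hp.integral_eq_sum hK]
  refine Finset.sum_pos' (fun t _ => integral_nonneg fun x => hat_nonneg K y x)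
    ⟨s, hK.finite_elements.mem_toFinset.2 hs, ?_⟩
  rw [setIntegral_pos_iff_support_of_nonneg_ae
    (Eventually.of_forall fun x => hat_nonneg K y x) (hp.integrableOn_interior hs)]
  exact (volume_interior_simplex_pos hs).trans_le
    (measure_mono fun x hx => ⟨(hat_pos_of_mem_interior hs hx hys).ne', hx⟩)

theorem integral_nhat (hK : IsMeshOf K D) (hy : y ∈ K.vertices) : ∫ x in D, nhat K y x = 1 := by
  simp only [nhat, integral_abs_hat hK]
  rw [integral_div, div_self (integral_hat_pos hK hy).ne']

theorem nhat_eq_zero_of_notMem (hs : s ∈ K.faces) (hx : x ∈ simplex s) (hy : y ∉ s) :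
    nhat K y x = 0 := by
  rw [nhat, hat_eq_zero_of_notMem hs hx hy, zero_div]

theorem pwCont_nhat (hK : IsMeshOf K D) (y : Sp d) : PwCont K (nhat K y) :=
  PwCont.of_mem_P1 (nhat_mem_P1 hK y)

theorem setIntegral_nhat_le_one (hK : IsMeshOf K D) (hy : y ∈ K.vertices) (hs : s ∈ elements K) :
    ∫ x in interior (simplex s), nhat K y x ≤ 1 := by
  rw [← integral_nhat hK hy]
  exact setIntegral_mono_set ((pwCont_nhat hK y).integrableOn hK)
    (Eventually.of_forall fun x => nhat_nonneg K y x)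
    (interior_subset.trans (hK.simplex_subset hs)).eventuallyLE

theorem le_integral_mul_nhat (hK : IsMeshOf K D) (hy : y ∈ K.vertices) {ψ : Sp d → ℝ}
    (hψ : PwCont K ψ) {c : ℝ}
    (h : ∀ s ∈ elements K, y ∈ s → ∀ x ∈ interior (simplex s), c ≤ ψ x) :
    c ≤ ∫ x in D, ψ x * nhat K y x := by
  have hn := pwCont_nhat hK y
  calc c = ∫ x in D, c * nhat K y x := by rw [integral_const_mul, integral_nhat hK hy, mul_one]
    _ ≤ ∫ x in D, ψ x * nhat K y x := by
      rw [((PwCont.const c).mul hn).integral_eq_sum hK, (hψ.mul hn).integral_eq_sum hK]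
      refine Finset.sum_le_sum fun s hs => ?_
      have hs := hK.finite_elements.mem_toFinset.1 hs
      refine setIntegral_mono_on (((PwCont.const c).mul hn).integrableOn_interior hs)
        ((hψ.mul hn).integrableOn_interior hs) isOpen_interior.measurableSet fun x hx => ?_
      by_cases hys : y ∈ s
      · exact mul_le_mul_of_nonneg_right (h s hs hys x hx) (nhat_nonneg K y x)
      · simp [nhat_eq_zero_of_notMem hs.1 (interior_subset hx) hys]

theorem abs_integral_mul_nhat_le (hK : IsMeshOf K D) (hy : y ∈ K.vertices) {ψ : Sp d → ℝ}
    (hψ : PwCont K ψ) {c : ℝ}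
    (h : ∀ s ∈ elements K, y ∈ s → ∀ x ∈ interior (simplex s), |ψ x| ≤ c) :
    |∫ x in D, ψ x * nhat K y x| ≤ c := by
  have hlower := le_integral_mul_nhat hK hy hψ (c := -c)
    fun s hs hys x hx => (abs_le.1 (h s hs hys x hx)).1
  have hupper := le_integral_mul_nhat hK hy hψ.neg (c := -c)
    fun s hs hys x hx => neg_le_neg (abs_le.1 (h s hs hys x hx)).2
  simp only [neg_mul, integral_neg] at hupper
  exact abs_le.2 ⟨hlower, neg_le_neg_iff.1 hupper⟩

/-! ### The operators at interior nodes -/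

/-- The weak form of `w ↦ -a Δw - b·∇w + c w` in the domain `D`, tested with `nhat K y`. -/
noncomputable def weakOp (K : Mesh d) (D : Set (Sp d)) (a : ℝ) (b : Sp d → Sp d) (c : Sp d → ℝ)
    (w : Sp d → ℝ) (y : Sp d) : ℝ :=
  a * (∫ x in D, inner ℝ (gradient w x) (gradient (nhat K y) x)) +
    ∫ x in D, (-inner ℝ (b x) (gradient w x) + c x * w x) * nhat K y x

/-- The contribution of the element `s` to `weakOp`. -/
noncomputable def elementOp (K : Mesh d) (s : Finset (Sp d)) (a : ℝ) (b : Sp d → Sp d)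
    (c : Sp d → ℝ) (w : Sp d → ℝ) (y : Sp d) : ℝ :=
  a * (volume.real (simplex s) * inner ℝ (elemGrad K s w) (elemGrad K s (nhat K y))) +
    ∫ x in interior (simplex s), (-inner ℝ (b x) (elemGrad K s w) + c x * w x) * nhat K y x

section LowerOrder

variable {a : ℝ} {b : Sp d → Sp d} {c : Sp d → ℝ}

theorem pwCont_lowerOrder (hK : IsMeshOf K D) (hb : ContinuousOn b D) (hc : ContinuousOn c D)
    (hw : w ∈ P1 K) : PwCont K fun x => -inner ℝ (b x) (gradient w x) + c x * w x :=
  ((PwCont.of_continuousOn hK hb).inner (PwCont.gradient hK hw)).neg.add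
    ((PwCont.of_continuousOn hK hc).mul (PwCont.of_mem_P1 hw))

theorem weakOp_eq_sum (hK : IsMeshOf K D) (hb : ContinuousOn b D) (hc : ContinuousOn c D)
    (hw : w ∈ P1 K) (y : Sp d) :
    weakOp K D a b c w y = ∑ s ∈ hK.finite_elements.toFinset, elementOp K s a b c w y := by
  have hn := nhat_mem_P1 hK y
  rw [weakOp, ((PwCont.gradient hK hw).inner (PwCont.gradient hK hn)).integral_eq_sum hK,
    ((pwCont_lowerOrder hK hb hc hw).mul (pwCont_nhat hK y)).integral_eq_sum hK,
    Finset.mul_sum, ← Finset.sum_add_distrib]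
  refine Finset.sum_congr rfl fun s hs => ?_
  have hs := hK.finite_elements.mem_toFinset.1 hs
  have hm : MeasurableSet (interior (simplex s)) := isOpen_interior.measurableSet
  have hdiffusion : ∫ x in interior (simplex s), inner ℝ (gradient w x) (gradient (nhat K y) x) =
      volume.real (simplex s) * inner ℝ (elemGrad K s w) (elemGrad K s (nhat K y)) := by
    rw [setIntegral_congr_fun hm
        (g := fun _ => inner ℝ (elemGrad K s w) (elemGrad K s (nhat K y)))
        fun x hx => by simp only [P1.gradient_eq hK hw hs hx, P1.gradient_eq hK hn hs hx],
      setIntegral_const, volume_real_interior_simplex, smul_eq_mul]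
  rw [elementOp, hdiffusion]
  congr 1
  exact setIntegral_congr_fun hm fun x hx => by simp only [P1.gradient_eq hK hw hs hx]

theorem elementOp_eq_zero (hs : s ∈ K.faces) (hy : y ∉ s) : elementOp K s a b c w y = 0 := by
  have hlower : ∫ x in interior (simplex s),
      (-inner ℝ (b x) (elemGrad K s w) + c x * w x) * nhat K y x = 0 :=
    setIntegral_eq_zero_of_forall_eq_zero fun x hx => by
      rw [nhat_eq_zero_of_notMem hs (interior_subset hx) hy, mul_zero]
  rw [elementOp, hlower, elemGrad_nhat, elemGrad_hat_eq_zero hs hy, smul_zero, inner_zero_right,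
    mul_zero, mul_zero, add_zero]

theorem weakOp_add_smul (hK : IsMeshOf K D) (hb : ContinuousOn b D) (hc : ContinuousOn c D)
    (hu : u ∈ P1 K) (hv : v ∈ P1 K) (r : ℝ) (y : Sp d) :
    weakOp K D a b c (u + r • v) y = weakOp K D a b c u y + r * weakOp K D a b c v y := by
  have hfin := hK.finite_elements
  rw [weakOp_eq_sum hK hb hc hu, weakOp_eq_sum hK hb hc hv,
    weakOp_eq_sum hK hb hc ((P1 K).add_mem hu ((P1 K).smul_mem r hv)), Finset.mul_sum,
    ← Finset.sum_add_distrib]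
  refine Finset.sum_congr rfl fun s hs => ?_
  have hs := hfin.mem_toFinset.1 hs
  have hint {w : Sp d → ℝ} (hw : w ∈ P1 K) : IntegrableOn
      (fun x => (-inner ℝ (b x) (elemGrad K s w) + c x * w x) * nhat K y x)
      (interior (simplex s)) :=
    ((((PwCont.of_continuousOn hK hb).inner (PwCont.const _)).neg.add
      ((PwCont.of_continuousOn hK hc).mul (PwCont.of_mem_P1 hw))).mul
        (pwCont_nhat hK y)).integrableOn_interior hs
  have hlower : ∫ x in interior (simplex s),
        (-inner ℝ (b x) (elemGrad K s (u + r • v)) + c x * (u + r • v) x) * nhat K y x =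
      (∫ x in interior (simplex s),
        (-inner ℝ (b x) (elemGrad K s u) + c x * u x) * nhat K y x) +
      r * ∫ x in interior (simplex s),
        (-inner ℝ (b x) (elemGrad K s v) + c x * v x) * nhat K y x := by
    rw [← integral_const_mul, ← integral_add (hint hu) ((hint hv).const_mul r)]
    congr 1 with x
    rw [map_add, map_smul, inner_add_right, real_inner_smul_right, Pi.add_apply, Pi.smul_apply,
      smul_eq_mul]
    ring
  rw [elementOp, elementOp, elementOp, hlower, map_add, map_smul, inner_add_left,
    real_inner_smul_left]
  ring

theorem weakOp_unit_nonneg (hK : IsMeshOf K D) (hb : ContinuousOn b D) (hc : ContinuousOn c D)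
    (hc0 : ∀ x ∈ D, 0 ≤ c x) (y : Sp d) : 0 ≤ weakOp K D a b c (unit K) y := by
  rw [weakOp_eq_sum hK hb hc (unit_mem_P1 K)]
  refine Finset.sum_nonneg fun s hs => ?_
  have hs := hK.finite_elements.mem_toFinset.1 hs
  rw [elementOp, elemGrad_unit hK hs, inner_zero_left, mul_zero, mul_zero, zero_add]
  refine setIntegral_nonneg isOpen_interior.measurableSet fun x hx => ?_
  have hxD := hK.simplex_subset hs (interior_subset hx)
  rw [inner_zero_right, hK.unit_apply hxD, neg_zero, zero_add, mul_one]
  exact mul_nonneg (hc0 x hxD) (nhat_nonneg K y x)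

end LowerOrder

section Element

variable {a θ : ℝ} {b : Sp d → Sp d} {c : Sp d → ℝ}

/-! ### Acute elements and artificial diffusion -/

theorem abs_le_supOn {S : Set (Sp d)} (hS : IsCompact S) (hc : ContinuousOn c S) (hx : x ∈ S) :
    |c x| ≤ supOn S c := by
  obtain ⟨M, hM⟩ := hS.bddAbove_image hc.abs
  exact le_ciSup (f := fun x : S => |c x|)
    ⟨M, forall_mem_range.2 fun z => hM (mem_image_of_mem _ z.2)⟩ ⟨x, hx⟩

theorem norm_le_vecSupOn {S : Set (Sp d)} (hS : IsCompact S) (hb : ContinuousOn b S)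
    (hx : x ∈ S) : ‖b x‖ ≤ vecSupOn S b := by
  rw [EuclideanSpace.norm_eq, vecSupOn]
  refine Real.sqrt_le_sqrt (Finset.sum_le_sum fun j _ => ?_)
  rw [Real.norm_eq_abs]
  refine pow_le_pow_left₀ (abs_nonneg _) (abs_le_supOn (c := fun x => b x j) hS ?_ hx) 2
  exact (EuclideanSpace.proj (𝕜 := ℝ) j).continuous.comp_continuousOn hb

theorem supOn_nonneg (S : Set (Sp d)) (c : Sp d → ℝ) : 0 ≤ supOn S c :=
  Real.iSup_nonneg fun _ => abs_nonneg _

theorem vecSupOn_nonneg (S : Set (Sp d)) (b : Sp d → Sp d) : 0 ≤ vecSupOn S b := Real.sqrt_nonneg _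

theorem norm_elemGrad_hat_pos (hK : IsMeshOf K D) (hd : 1 ≤ d) (hs : s ∈ elements K)
    (hy : y ∈ s) : 0 < ‖elemGrad K s (hat K y)‖ :=
  pos_of_mul_pos_left (one_pos.trans_le (one_le_norm_elemGrad_hat_mul_diam hK hd hs hy))
    Metric.diam_nonneg

theorem norm_elemGrad_le_sum (hs : s ∈ K.faces) (hu : ∀ z ∈ s, 0 ≤ u z) :
    ‖elemGrad K s u‖ ≤ ∑ z ∈ s, u z * ‖elemGrad K s (hat K z)‖ := by
  rw [elemGrad_eq_sum hs]
  refine (norm_sum_le _ _).trans (Finset.sum_le_sum fun z hz => ?_)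
  rw [norm_smul, Real.norm_of_nonneg (hu z hz)]

theorem abs_sub_le_norm_elemGrad_mul_diam (hK : IsMeshOf K D) (hu : u ∈ P1 K)
    (hs : s ∈ elements K) {x x' : Sp d} (hx : x ∈ simplex s) (hx' : x' ∈ simplex s) :
    |u x - u x'| ≤ ‖elemGrad K s u‖ * Metric.diam (simplex s) := by
  rw [P1.sub_eq_inner hK hu hs hx hx']
  refine (abs_real_inner_le_norm _ _).trans (mul_le_mul_of_nonneg_left ?_ (norm_nonneg _))
  rw [← dist_eq_norm]
  exact Metric.dist_le_diam_of_mem (isCompact_simplex s).isBounded hx hx'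

namespace StrictlyAcute

theorem inner_elemGrad_hat_le (h : StrictlyAcute K θ) (hK : IsMeshOf K D) (hs : s ∈ elements K)
    (hy : y ∈ s) (hz : z ∈ s) (hyz : y ≠ z) :
    inner ℝ (elemGrad K s (hat K y)) (elemGrad K s (hat K z)) ≤
      -Real.sin θ * ‖elemGrad K s (hat K y)‖ * ‖elemGrad K s (hat K z)‖ := by
  have hx := centroid_mem_interior hs
  simpa only [P1.gradient_eq hK (hat_mem_P1 hK _) hs hx] using
    h y (mem_vertices_of_mem hs.1 hy) z (mem_vertices_of_mem hs.1 hz) hyz s hs _ hx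

/-- The gradients of the `d + 1 ≥ 3` barycentric coordinates sum to zero; pair this relation with
the shortest of them. -/
theorem sin_le_half (h : StrictlyAcute K θ) (hK : IsMeshOf K D) (hd : 2 ≤ d)
    (hθ : 0 ≤ Real.sin θ) (hs : s ∈ elements K) : Real.sin θ ≤ 1 / 2 := by
  classical
  set g := fun z => elemGrad K s (hat K z)
  obtain ⟨y, hy, hmin⟩ := s.exists_min_image (fun y => ‖g y‖) (K.nonempty_of_mem_faces hs.1)
  have hpos : 0 < ‖g y‖ ^ 2 := pow_pos (norm_elemGrad_hat_pos hK (by lia) hs hy) 2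
  have hpair : ‖g y‖ ^ 2 + ∑ z ∈ s.erase y, inner ℝ (g y) (g z) = 0 := by
    rw [← real_inner_self_eq_norm_sq, ← inner_sum, ← inner_add_right, Finset.add_sum_erase s g hy,
      sum_elemGrad_hat hK hs, inner_zero_right]
  have hoff : ∀ z ∈ s.erase y, inner ℝ (g y) (g z) ≤ -(Real.sin θ * ‖g y‖ ^ 2) := fun z hz => by
    obtain ⟨hzy, hz⟩ := Finset.mem_erase.1 hz
    have hle := mul_le_mul_of_nonneg_left (hmin z hz) (mul_nonneg hθ (norm_nonneg (g y)))
    linarith [h.inner_elemGrad_hat_le hK hs hy hz hzy.symm]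
  have hsum := Finset.sum_le_card_nsmul _ _ _ hoff
  rw [Finset.card_erase_of_mem hy, hs.2, Nat.add_sub_cancel, nsmul_eq_mul] at hsum
  have htwo : 2 * (Real.sin θ * ‖g y‖ ^ 2) ≤ d * (Real.sin θ * ‖g y‖ ^ 2) :=
    mul_le_mul_of_nonneg_right (by exact_mod_cast hd) (by positivity)
  nlinarith

theorem inner_elemGrad_nhat_le (h : StrictlyAcute K θ) (hK : IsMeshOf K D) (hs : s ∈ elements K)
    (hy : y ∈ s) (hu : ∀ z ∈ s, 0 ≤ u z) (huy : u y = 0) :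
    inner ℝ (elemGrad K s u) (elemGrad K s (nhat K y)) ≤
      -(Real.sin θ * (∑ z ∈ s, u z * ‖elemGrad K s (hat K z)‖) * ‖elemGrad K s (nhat K y)‖) := by
  have hhat : inner ℝ (elemGrad K s u) (elemGrad K s (hat K y)) ≤
      -(Real.sin θ * (∑ z ∈ s, u z * ‖elemGrad K s (hat K z)‖) * ‖elemGrad K s (hat K y)‖) := by
    rw [elemGrad_eq_sum hs.1, sum_inner, Finset.mul_sum, Finset.sum_mul, ← Finset.sum_neg_distrib]
    refine Finset.sum_le_sum fun z hz => ?_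
    rw [real_inner_smul_left]
    obtain rfl | hzy := eq_or_ne z y
    · simp [huy]
    · linarith [mul_le_mul_of_nonneg_left (h.inner_elemGrad_hat_le hK hs hz hy hzy) (hu z hz)]
  have hI : 0 ≤ (∫ z in K.space, |hat K y z|)⁻¹ := by positivity
  rw [elemGrad_nhat, real_inner_smul_right, norm_smul, Real.norm_of_nonneg hI]
  linarith [mul_le_mul_of_nonneg_left hhat hI]

end StrictlyAcute

theorem setIntegral_lowerOrder_le (hK : IsMeshOf K D) (hy : y ∈ K.vertices)
    (hs : s ∈ elements K) (hb : ContinuousOn b D) (hc : ContinuousOn c D) {g : Sp d} {q : Sp d → ℝ}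
    (hq : PwCont K q) {B : ℝ} (hB : 0 ≤ B)
    (h : ∀ x ∈ simplex s, -inner ℝ (b x) g + c x * q x ≤ B) :
    ∫ x in interior (simplex s), (-inner ℝ (b x) g + c x * q x) * nhat K y x ≤ B := by
  have hn := pwCont_nhat hK y
  have hp : PwCont K fun x => -inner ℝ (b x) g + c x * q x :=
    ((PwCont.of_continuousOn hK hb).inner (PwCont.const g)).neg.add
      ((PwCont.of_continuousOn hK hc).mul hq)
  calc ∫ x in interior (simplex s), (-inner ℝ (b x) g + c x * q x) * nhat K y x
      ≤ ∫ x in interior (simplex s), B * nhat K y x :=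
        setIntegral_mono_on ((hp.mul hn).integrableOn_interior hs)
          (((PwCont.const B).mul hn).integrableOn_interior hs) isOpen_interior.measurableSet
          fun x hx => mul_le_mul_of_nonneg_right (h x (interior_subset hx)) (nhat_nonneg K y x)
    _ = B * ∫ x in interior (simplex s), nhat K y x := integral_const_mul _ _
    _ ≤ B := mul_le_of_le_one_right hB (setIntegral_nhat_le_one hK hy hs)

theorem neg_inner_add_mul_le (hK : IsMeshOf K D) (hs : s ∈ elements K) (hy : y ∈ simplex s)
    (hb : ContinuousOn b (simplex s)) (hc : ContinuousOn c (simplex s)) (hu : u ∈ P1 K)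
    (huy : u y = 0) (hx : x ∈ simplex s) :
    -inner ℝ (b x) (elemGrad K s u) + c x * u x ≤ ‖elemGrad K s u‖ *
      (vecSupOn (simplex s) b + Metric.diam (simplex s) * supOn (simplex s) c) := by
  have hdrift : -inner ℝ (b x) (elemGrad K s u) ≤ vecSupOn (simplex s) b * ‖elemGrad K s u‖ :=
    (neg_le_abs _).trans ((abs_real_inner_le_norm _ _).trans (mul_le_mul_of_nonneg_right
      (norm_le_vecSupOn (isCompact_simplex s) hb hx) (norm_nonneg _)))
  have hvalue : |u x| ≤ ‖elemGrad K s u‖ * Metric.diam (simplex s) := by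
    simpa only [huy, sub_zero] using abs_sub_le_norm_elemGrad_mul_diam hK hu hs hx hy
  have hpotential : c x * u x ≤
      supOn (simplex s) c * (‖elemGrad K s u‖ * Metric.diam (simplex s)) := by
    refine (le_abs_self _).trans ?_
    rw [abs_mul]
    exact mul_le_mul (abs_le_supOn (isCompact_simplex s) hc hx) hvalue (abs_nonneg _)
      (supOn_nonneg _ _)
  linarith

theorem elementOp_nonpos (hK : IsMeshOf K D) (hs : s ∈ elements K) (hy : y ∈ s)
    (hacute : StrictlyAcute K θ) (hb : ContinuousOn b D) (hc : ContinuousOn c D) (ha : 0 ≤ a)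
    (hdiff : vecSupOn (simplex s) b + Metric.diam (simplex s) * supOn (simplex s) c ≤
      a * Real.sin θ * ‖elemGrad K s (nhat K y)‖ * volume.real (simplex s))
    (hu : u ∈ P1 K) (hu0 : ∀ z ∈ s, 0 ≤ u z) (huy : u y = 0) :
    elementOp K s a b c u y ≤ 0 := by
  set m := ∑ z ∈ s, u z * ‖elemGrad K s (hat K z)‖
  set V := volume.real (simplex s)
  set G := ‖elemGrad K s (nhat K y)‖
  set β := vecSupOn (simplex s) b + Metric.diam (simplex s) * supOn (simplex s) c
  have hsub := hK.simplex_subset hs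
  have hβ : 0 ≤ β := add_nonneg (vecSupOn_nonneg _ _)
    (mul_nonneg Metric.diam_nonneg (supOn_nonneg _ _))
  have hm : 0 ≤ m := Finset.sum_nonneg fun z hz => mul_nonneg (hu0 z hz) (norm_nonneg _)
  have hdiffusion : a * (V * inner ℝ (elemGrad K s u) (elemGrad K s (nhat K y))) ≤
      a * (V * -(Real.sin θ * m * G)) :=
    mul_le_mul_of_nonneg_left (mul_le_mul_of_nonneg_left
      (hacute.inner_elemGrad_nhat_le hK hs hy hu0 huy) (volume_real_simplex_pos hs).le) ha
  have hlower : ∫ x in interior (simplex s),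
      (-inner ℝ (b x) (elemGrad K s u) + c x * u x) * nhat K y x ≤ m * β :=
    setIntegral_lowerOrder_le hK (mem_vertices_of_mem hs.1 hy) hs hb hc (PwCont.of_mem_P1 hu)
      (mul_nonneg hm hβ) fun x hx =>
        (neg_inner_add_mul_le hK hs (mem_simplex_of_mem hy) (hb.mono hsub) (hc.mono hsub) hu huy
          hx).trans (mul_le_mul_of_nonneg_right (norm_elemGrad_le_sum hs.1 hu0) hβ)
  rw [elementOp]
  linarith [mul_le_mul_of_nonneg_left hdiff hm]

theorem neg_vecSupOn_mul_le_setIntegral (hK : IsMeshOf K D) (hs : s ∈ elements K)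
    (hy : y ∈ K.vertices) (hb : ContinuousOn b D) (hc : ContinuousOn c D)
    (hc0 : ∀ x ∈ D, 0 ≤ c x) :
    -(vecSupOn (simplex s) b * ‖elemGrad K s (hat K y)‖) ≤ ∫ x in interior (simplex s),
      (-inner ℝ (b x) (elemGrad K s (hat K y)) + c x * hat K y x) * nhat K y x := by
  have hsub := hK.simplex_subset hs
  have hneg := setIntegral_lowerOrder_le (b := -b) (c := -c) hK hy hs hb.neg hc.neg
    (PwCont.of_mem_P1 (hat_mem_P1 hK y))
    (mul_nonneg (vecSupOn_nonneg _ b) (norm_nonneg (elemGrad K s (hat K y)))) fun x hx => by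
      have hdrift := (real_inner_le_norm (b x) (elemGrad K s (hat K y))).trans
        (mul_le_mul_of_nonneg_right (norm_le_vecSupOn (isCompact_simplex s) (hb.mono hsub) hx)
          (norm_nonneg _))
      have hpotential := mul_nonneg (hc0 x (hsub hx)) (hat_nonneg K y x)
      rw [Pi.neg_apply, Pi.neg_apply, inner_neg_left, neg_neg, neg_mul]
      linarith
  rw [neg_le, ← integral_neg]
  refine (le_of_eq ?_).trans hneg
  congr 1 with x
  rw [Pi.neg_apply, Pi.neg_apply, inner_neg_left]
  ring

theorem le_elementOp_hat (hK : IsMeshOf K D) (hs : s ∈ elements K) (hy : y ∈ s)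
    (hb : ContinuousOn b D) (hc : ContinuousOn c D) (hc0 : ∀ x ∈ D, 0 ≤ c x)
    (hdiff : vecSupOn (simplex s) b + Metric.diam (simplex s) * supOn (simplex s) c ≤
      a * Real.sin θ * ‖elemGrad K s (nhat K y)‖ * volume.real (simplex s)) :
    (1 - Real.sin θ) * (a * ‖elemGrad K s (hat K y)‖ * ‖elemGrad K s (nhat K y)‖ *
      volume.real (simplex s)) ≤ elementOp K s a b c (hat K y) y := by
  have hinner : inner ℝ (elemGrad K s (hat K y)) (elemGrad K s (nhat K y)) =
      ‖elemGrad K s (hat K y)‖ * ‖elemGrad K s (nhat K y)‖ := by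
    rw [elemGrad_nhat, real_inner_smul_right, norm_smul, Real.norm_of_nonneg (by positivity),
      real_inner_self_eq_norm_sq]
    ring
  have hb_le : vecSupOn (simplex s) b ≤
      a * Real.sin θ * ‖elemGrad K s (nhat K y)‖ * volume.real (simplex s) :=
    le_of_add_le_of_nonneg_left hdiff (mul_nonneg Metric.diam_nonneg (supOn_nonneg _ _))
  rw [elementOp, hinner]
  linarith [mul_le_mul_of_nonneg_right hb_le (norm_nonneg (elemGrad K s (hat K y))),
    neg_vecSupOn_mul_le_setIntegral hK hs (mem_vertices_of_mem hs.1 hy) hb hc hc0]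

end Element

/-! ### One-sided derivatives of finite element functions -/

section Segment

variable {p : Sp d}

theorem IsMeshOf.exists_element_segment (hK : IsMeshOf K D) (hp : p ∈ tangentDirections D y) :
    ∃ s ∈ elements K, y ∈ simplex s ∧ ∃ Λ : ℝ, 0 < Λ ∧ ∀ r ∈ Icc 0 Λ, y + r • p ∈ simplex s := by
  obtain ⟨Λ, hΛ, hmem⟩ := hp
  obtain ⟨s, hs, hfreq⟩ : ∃ s ∈ elements K, ∃ᶠ r in 𝓝[>] (0 : ℝ), y + r • p ∈ simplex s := by
    by_contra! hcon
    obtain ⟨r, hr, hrΛ⟩ :=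
      (((eventually_all_finite hK.finite_elements).2 hcon).and (Ioc_mem_nhdsGT hΛ)).exists
    obtain ⟨s, hs, hrs⟩ := hK.exists_element (hmem r ⟨hrΛ.1.le, hrΛ.2⟩)
    exact hr s hs hrs
  have hys : y ∈ simplex s := by
    have htend : Tendsto (fun r : ℝ => y + r • p) (𝓝[>] 0) (𝓝 y) :=
      ((by fun_prop : Continuous fun r : ℝ => y + r • p).tendsto' 0 y (by simp)).mono_left
        nhdsWithin_le_nhds
    rw [← (isCompact_simplex s).isClosed.closure_eq]
    exact mem_closure_iff_frequently.2 (htend.frequently hfreq)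
  obtain ⟨r₀, hr₀, hpos : 0 < r₀⟩ := (hfreq.and_eventually self_mem_nhdsWithin).exists
  refine ⟨s, hs, hys, r₀, hpos, fun r hr => ?_⟩
  have hscaled := (convex_simplex s).add_smul_mem hys hr₀ (t := r / r₀)
    ⟨div_nonneg hr.1 hpos.le, (div_le_one hpos).2 hr.2⟩
  rwa [smul_smul, div_mul_cancel₀ _ hpos.ne'] at hscaled

theorem diniDeriv_eq (hK : IsMeshOf K D) (hv : v ∈ P1 K) (hs : s ∈ elements K)
    (hy : y ∈ simplex s) {Λ : ℝ} (hΛ : 0 < Λ) (h : ∀ r ∈ Icc 0 Λ, y + r • p ∈ simplex s) :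
    diniDeriv p v y = -inner ℝ (elemGrad K s v) p := by
  refine Tendsto.limUnder_eq (Tendsto.congr' ?_ tendsto_const_nhds)
  filter_upwards [Ioc_mem_nhdsGT hΛ] with r hr
  have hr0 : r ≠ 0 := hr.1.ne'
  rw [P1.sub_eq_inner hK hv hs hy (h r ⟨hr.1.le, hr.2⟩), sub_add_cancel_left, inner_neg_right,
    real_inner_smul_right]
  field_simp

theorem diniDeriv_add_smul (hK : IsMeshOf K D) (hp : p ∈ tangentDirections D y) (hu : u ∈ P1 K)
    (hv : v ∈ P1 K) (r : ℝ) :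
    diniDeriv p (u + r • v) y = diniDeriv p u y + r * diniDeriv p v y := by
  obtain ⟨s, hs, hy, Λ, hΛ, h⟩ := hK.exists_element_segment hp
  rw [diniDeriv_eq hK hu hs hy hΛ h, diniDeriv_eq hK hv hs hy hΛ h,
    diniDeriv_eq hK ((P1 K).add_mem hu ((P1 K).smul_mem r hv)) hs hy hΛ h, map_add, map_smul,
    inner_add_left, real_inner_smul_left]
  ring

theorem diniDeriv_unit (hK : IsMeshOf K D) (hp : p ∈ tangentDirections D y) :
    diniDeriv p (unit K) y = 0 := by
  obtain ⟨s, hs, hy, Λ, hΛ, h⟩ := hK.exists_element_segment hp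
  rw [diniDeriv_eq hK (unit_mem_P1 K) hs hy hΛ h, elemGrad_unit hK hs, inner_zero_left, neg_zero]

theorem diniDeriv_zero_left (v : Sp d → ℝ) (y : Sp d) : diniDeriv 0 v y = 0 :=
  Tendsto.limUnder_eq (by simp)

theorem diniDeriv_nonpos (hK : IsMeshOf K D) (hp : p ∈ tangentDirections D y) (hu : u ∈ P1 K)
    (hu0 : ∀ x ∈ D, 0 ≤ u x) (huy : u y = 0) : diniDeriv p u y ≤ 0 := by
  obtain ⟨s, hs, hy, Λ, hΛ, h⟩ := hK.exists_element_segment hp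
  have hΛs := h Λ (right_mem_Icc.2 hΛ.le)
  have hslope := P1.sub_eq_inner hK hu hs hΛs hy
  rw [huy, sub_zero, add_sub_cancel_left, real_inner_smul_right] at hslope
  rw [diniDeriv_eq hK hu hs hy hΛ h, neg_nonpos]
  exact nonneg_of_mul_nonneg_right (hslope ▸ hu0 _ (hK.simplex_subset hs hΛs)) hΛ

end Segment

/-! ### Monotone nodal operators -/

open Classical in
/-- The common form of the explicit operators (`δ = 0`) and the implicit operators (`δ = 1`) of the
scheme; `δ` is the coefficient of the value at Dirichlet nodes. -/
noncomputable def nodeOp (G : MixedDomain d) (K : Mesh d) (a : Sp d → ℝ) (b : Sp d → Sp d)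
    (c : Sp d → ℝ) (bB : Sp d → Sp d) (cB : Sp d → ℝ) (δ : ℝ) (w : Sp d → ℝ) (y : Sp d) : ℝ :=
  if y ∈ interior G.cl then weakOp K G.cl (a y) b c w y
  else if y ∈ G.bdD then δ * w y
  else diniDeriv (bB y) w y + cB y * w y

/-- Coefficients for which the nodal operators are monotone: on an acute mesh the diffusion
dominates the lower order terms in the interior, and off the Dirichlet boundary the boundary drift
points into the domain. -/
structure MonotoneCoefficients (G : MixedDomain d) (K : Mesh d) (θ : ℝ) (a : Sp d → ℝ)
    (b : Sp d → Sp d) (c : Sp d → ℝ) (bB : Sp d → Sp d) (cB : Sp d → ℝ) : Prop where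
  isMesh : IsMeshOf K G.cl
  acute : StrictlyAcute K θ
  b_cont : ContinuousOn b G.cl
  c_cont : ContinuousOn c G.cl
  c_nonneg : ∀ x ∈ G.cl, 0 ≤ c x
  cB_nonneg : ∀ x ∈ frontier G.cl, 0 ≤ cB x
  cone : ∀ y ∈ K.vertices, y ∈ G.bdT ∪ G.bdR → bB y ∈ tangentDirections G.cl y
  a_nonneg : ∀ y ∈ K.vertices, y ∈ interior G.cl → 0 ≤ a y
  diffusion : ∀ y ∈ K.vertices, y ∈ interior G.cl → ∀ s ∈ elements K, y ∈ s →
    vecSupOn (simplex s) b + Metric.diam (simplex s) * supOn (simplex s) c ≤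
      a y * Real.sin θ * ‖elemGrad K s (nhat K y)‖ * volume.real (simplex s)

namespace MixedDomain

theorem mem_cases (G : MixedDomain d) (hy : y ∈ G.cl) :
    y ∈ interior G.cl ∨ (y ∉ interior G.cl ∧ y ∈ G.bdD) ∨
      (y ∉ interior G.cl ∧ y ∉ G.bdD ∧ y ∈ G.bdT ∪ G.bdR ∧ y ∈ frontier G.cl) := by
  by_cases h : y ∈ interior G.cl
  · exact Or.inl h
  · have hf : y ∈ frontier G.cl := ⟨subset_closure hy, h⟩
    by_cases hD : y ∈ G.bdD
    · exact Or.inr (Or.inl ⟨h, hD⟩)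
    · exact Or.inr (Or.inr ⟨h, hD, (G.union_eq ▸ hf).resolve_right hD, hf⟩)

theorem notMem_interior (G : MixedDomain d) (hy : y ∈ G.bdT ∪ G.bdR ∪ G.bdD) :
    y ∉ interior G.cl := by
  rw [G.union_eq] at hy
  exact hy.2

theorem notMem_bdD (G : MixedDomain d) (hy : y ∈ G.bdT ∪ G.bdR) : y ∉ G.bdD :=
  hy.elim (Set.disjoint_left.1 G.disjoint_TD ·) (Set.disjoint_left.1 G.disjoint_RD ·)

theorem CFamily.continuousOn {G : MixedDomain d} {A F : Type*} [TopologicalSpace A]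
    [TopologicalSpace F] {q : A → Sp d → F} (h : G.CFamily q) (α : A) : ContinuousOn (q α) G.cl :=
  ContinuousOn.comp (g := fun p : A × Sp d => q p.1 p.2) h
    (f := fun x => (α, x)) (by fun_prop) fun _ hx => ⟨mem_univ _, hx⟩

end MixedDomain

section NodeOp

variable {G : MixedDomain d} {a : Sp d → ℝ} {b : Sp d → Sp d} {c : Sp d → ℝ} {bB : Sp d → Sp d}
  {cB : Sp d → ℝ} {δ θ : ℝ}

theorem nodeOp_of_interior (hy : y ∈ interior G.cl) :
    nodeOp G K a b c bB cB δ w y = weakOp K G.cl (a y) b c w y := if_pos hy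

theorem nodeOp_of_dirichlet (hy : y ∉ interior G.cl) (hD : y ∈ G.bdD) :
    nodeOp G K a b c bB cB δ w y = δ * w y := by
  rw [nodeOp, if_neg hy, if_pos hD]

theorem nodeOp_of_boundary (hy : y ∉ interior G.cl) (hD : y ∉ G.bdD) :
    nodeOp G K a b c bB cB δ w y = diniDeriv (bB y) w y + cB y * w y := by
  rw [nodeOp, if_neg hy, if_neg hD]

namespace MonotoneCoefficients

theorem add_smul (H : MonotoneCoefficients G K θ a b c bB cB) (hy : y ∈ K.vertices)
    (hu : u ∈ P1 K) (hv : v ∈ P1 K) (r : ℝ) : nodeOp G K a b c bB cB δ (u + r • v) y =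
      nodeOp G K a b c bB cB δ u y + r * nodeOp G K a b c bB cB δ v y := by
  rcases G.mem_cases (H.isMesh.vertices_subset hy) with h | ⟨h, hD⟩ | ⟨h, hD, hTR, -⟩
  · simp only [nodeOp_of_interior h, weakOp_add_smul H.isMesh H.b_cont H.c_cont hu hv]
  · simp only [nodeOp_of_dirichlet h hD, Pi.add_apply, Pi.smul_apply, smul_eq_mul]
    ring
  · simp only [nodeOp_of_boundary h hD, diniDeriv_add_smul H.isMesh (H.cone y hy hTR) hu hv,
      Pi.add_apply, Pi.smul_apply, smul_eq_mul]
    ring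

theorem sub (H : MonotoneCoefficients G K θ a b c bB cB) (hy : y ∈ K.vertices) (hu : u ∈ P1 K)
    (hv : v ∈ P1 K) : nodeOp G K a b c bB cB δ (u - v) y =
      nodeOp G K a b c bB cB δ u y - nodeOp G K a b c bB cB δ v y := by
  have h := H.add_smul (δ := δ) hy hu hv (-1)
  rwa [neg_one_smul, ← sub_eq_add_neg, neg_one_mul, ← sub_eq_add_neg] at h

theorem unit_nonneg (H : MonotoneCoefficients G K θ a b c bB cB) (hy : y ∈ K.vertices)
    (hδ : 0 ≤ δ) : 0 ≤ nodeOp G K a b c bB cB δ (unit K) y := by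
  have hyc := H.isMesh.vertices_subset hy
  rcases G.mem_cases hyc with h | ⟨h, hD⟩ | ⟨h, hD, hTR, hf⟩
  · rw [nodeOp_of_interior h]
    exact weakOp_unit_nonneg H.isMesh H.b_cont H.c_cont H.c_nonneg y
  · rw [nodeOp_of_dirichlet h hD, H.isMesh.unit_apply hyc, mul_one]
    exact hδ
  · rw [nodeOp_of_boundary h hD, diniDeriv_unit H.isMesh (H.cone y hy hTR),
      H.isMesh.unit_apply hyc, zero_add, mul_one]
    exact H.cB_nonneg y hf

theorem nonpos (H : MonotoneCoefficients G K θ a b c bB cB) (hy : y ∈ K.vertices)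
    (hu : u ∈ P1 K) (hu0 : ∀ z ∈ K.vertices, 0 ≤ u z) (huy : u y = 0) :
    nodeOp G K a b c bB cB δ u y ≤ 0 := by
  rcases G.mem_cases (H.isMesh.vertices_subset hy) with h | ⟨h, hD⟩ | ⟨h, hD, hTR, -⟩
  · rw [nodeOp_of_interior h, weakOp_eq_sum H.isMesh H.b_cont H.c_cont hu]
    refine Finset.sum_nonpos fun s hs => ?_
    have hs := H.isMesh.finite_elements.mem_toFinset.1 hs
    by_cases hys : y ∈ s
    · exact elementOp_nonpos H.isMesh hs hys H.acute H.b_cont H.c_cont (H.a_nonneg y hy h)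
        (H.diffusion y hy h s hs hys) hu (fun z hz => hu0 z (mem_vertices_of_mem hs.1 hz)) huy
    · exact (elementOp_eq_zero hs.1 hys).le
  · rw [nodeOp_of_dirichlet h hD, huy, mul_zero]
  · rw [nodeOp_of_boundary h hD, huy, mul_zero, add_zero]
    exact diniDeriv_nonpos H.isMesh (H.cone y hy hTR) hu
      (fun x hx => P1.nonneg H.isMesh hu hu0 hx) huy

/-- Touching `w` from below at `y` by a multiple of `v`: with `v = unit K` this is the discrete
minimum principle, with `v = hat K y` the bound of the operator by its diagonal entry. -/
theorem le_mul_of_touching (H : MonotoneCoefficients G K θ a b c bB cB) (hy : y ∈ K.vertices)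
    (hw : w ∈ P1 K) (hv : v ∈ P1 K) (hvy : v y = 1)
    (hle : ∀ z ∈ K.vertices, w y * v z ≤ w z) :
    nodeOp G K a b c bB cB δ w y ≤ w y * nodeOp G K a b c bB cB δ v y := by
  have h := H.nonpos (δ := δ) (u := w + (-w y) • v) hy
    ((P1 K).add_mem hw ((P1 K).smul_mem _ hv))
    (fun z hz => by
      simpa only [Pi.add_apply, Pi.smul_apply, smul_eq_mul, neg_mul, ← sub_eq_add_neg,
        sub_nonneg] using hle z hz)
    (by simp [hvy])
  rw [H.add_smul hy hw hv] at h
  linarith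

theorem le_of_min (H : MonotoneCoefficients G K θ a b c bB cB) (hy : y ∈ K.vertices)
    (hw : w ∈ P1 K) (hmin : ∀ z ∈ K.vertices, w y ≤ w z) :
    nodeOp G K a b c bB cB δ w y ≤ w y * nodeOp G K a b c bB cB δ (unit K) y :=
  H.le_mul_of_touching hy hw (unit_mem_P1 K) (H.isMesh.unit_apply (H.isMesh.vertices_subset hy))
    fun z hz => by
      rw [H.isMesh.unit_apply (H.isMesh.vertices_subset hz), mul_one]
      exact hmin z hz

theorem nonpos_of_min (H : MonotoneCoefficients G K θ a b c bB cB) (hy : y ∈ K.vertices)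
    (hw : w ∈ P1 K) (hmin : ∀ z ∈ K.vertices, w y ≤ w z) (hwy : w y ≤ 0) (hδ : 0 ≤ δ) :
    nodeOp G K a b c bB cB δ w y ≤ 0 :=
  (H.le_of_min hy hw hmin).trans (mul_nonpos_of_nonpos_of_nonneg hwy (H.unit_nonneg hy hδ))

theorem le_diagonal_mul (H : MonotoneCoefficients G K θ a b c bB cB) (hy : y ∈ K.vertices)
    (hw : w ∈ P1 K) (hw0 : ∀ z ∈ K.vertices, 0 ≤ w z) :
    nodeOp G K a b c bB cB δ w y ≤ w y * nodeOp G K a b c bB cB δ (hat K y) y :=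
  H.le_mul_of_touching hy hw (hat_mem_P1 H.isMesh y) (hat_self hy) fun z hz => by
    obtain rfl | hyz := eq_or_ne y z
    · rw [hat_self hz, mul_one]
    · rw [hat_of_ne hz hyz, mul_zero]
      exact hw0 z hz

end MonotoneCoefficients

end NodeOp

/-! ### Comparison for the scheme -/

namespace Discretisation

variable {A : Type*} [TopologicalSpace A] {pb : BellmanProblem d A} {S : Discretisation pb}
  {i : ℕ}

theorem opE_eq (S : Discretisation pb) (i : ℕ) (α : A) (w : Sp d → ℝ) (y : Sp d) :
    S.opE i α w y = nodeOp pb.toMixedDomain (S.mesh i) (S.aE i α) (S.bE i α) (S.cE i α)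
      (S.bBE i α) (S.cBE i α) 0 w y := by
  rw [opE, nodeOp, zero_mul]
  rfl

theorem opI_eq (S : Discretisation pb) (i : ℕ) (α : A) (w : Sp d → ℝ) (y : Sp d) :
    S.opI i α w y = nodeOp pb.toMixedDomain (S.mesh i) (S.aI i α) (S.bI i α) (S.cI i α)
      (S.bBI i α) (S.cBI i α) 1 w y := by
  rw [opI, nodeOp, one_mul]
  rfl

theorem monotoneCoefficients (hcons : S.ConsistentCoefficients) (hmono : S.ArtificialDiffusion)
    (i : ℕ) : ∃ θ : ℝ, 0 ≤ Real.sin θ ∧ ∀ α,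
      MonotoneCoefficients pb.toMixedDomain (S.mesh i) θ (S.aE i α) (S.bE i α) (S.cE i α)
        (S.bBE i α) (S.cBE i α) ∧
      MonotoneCoefficients pb.toMixedDomain (S.mesh i) θ (S.aI i α) (S.bI i α) (S.cI i α)
        (S.bBI i α) (S.cBI i α) := by
  obtain ⟨θ, hθ, hacute, hν⟩ := hmono i
  have hK := S.isMesh i
  have hsin : 0 ≤ Real.sin θ :=
    Real.sin_nonneg_of_nonneg_of_le_pi hθ.1.le (by linarith [hθ.2, Real.pi_pos])
  have hraise {ν a : ℝ} {y : Sp d} {s : Finset (Sp d)} (hle : ν ≤ a) {x : Sp d}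
      (hs : s ∈ elements (S.mesh i)) (hx : x ∈ interior (simplex s)) :
      ν * Real.sin θ * ‖gradient (nhat (S.mesh i) y) x‖ * volume.real (simplex s) ≤
        a * Real.sin θ * ‖elemGrad (S.mesh i) s (nhat (S.mesh i) y)‖ *
          volume.real (simplex s) := by
    rw [P1.gradient_eq hK (nhat_mem_P1 hK y) hs hx]
    gcongr
  refine ⟨θ, hsin, fun α => ⟨⟨hK, hacute, (hcons.bE_cont i).continuousOn α,
    (hcons.cE_cont i).continuousOn α, hcons.cE_nonneg i α, hcons.cBE_nonneg i α,
    fun y hy hTR => (hcons.cone i α y hy hTR).1, fun y hy hyi => ?_, fun y hy hyi s hs hys => ?_⟩,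
    ⟨hK, hacute, (hcons.bI_cont i).continuousOn α, (hcons.cI_cont i).continuousOn α,
    hcons.cI_nonneg i α, hcons.cBI_nonneg i α, fun y hy hTR => (hcons.cone i α y hy hTR).2,
    fun y hy hyi => ?_, fun y hy hyi s hs hys => ?_⟩⟩⟩
  all_goals obtain ⟨νE, νI, hE0, hI0, hE, hI, hdiff⟩ := hν α y hy hyi
  · exact hE0.trans hE
  · exact (hdiff s hs hys _ (centroid_mem_interior hs)).1.trans
      (hraise hE hs (centroid_mem_interior hs))
  · exact hI0.trans hI
  · exact (hdiff s hs hys _ (centroid_mem_interior hs)).2.trans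
      (hraise hI hs (centroid_mem_interior hs))

theorem h_pos (S : Discretisation pb) (i : ℕ) : 0 < S.h i :=
  div_pos pb.T_pos (by exact_mod_cast S.n_pos i)

theorem h_mul_opE_le (hcons : S.ConsistentCoefficients) (hmono : S.ArtificialDiffusion)
    (htime : S.TimeStepRestriction) (α : A) (hy : y ∈ (S.mesh i).vertices)
    (hyi : y ∈ interior pb.cl ∪ pb.bdT) (hw : w ∈ P1 (S.mesh i))
    (hw0 : ∀ z ∈ (S.mesh i).vertices, 0 ≤ w z) : S.h i * S.opE i α w y ≤ w y := by
  obtain ⟨θ, -, hM⟩ := monotoneCoefficients hcons hmono i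
  have hdiag : S.opE i α w y ≤ w y * S.opE i α (hat (S.mesh i) y) y := by
    simpa only [opE_eq] using (hM α).1.le_diagonal_mul hy hw hw0
  calc S.h i * S.opE i α w y ≤ S.h i * (w y * S.opE i α (hat (S.mesh i) y) y) :=
        mul_le_mul_of_nonneg_left hdiag (S.h_pos i).le
    _ = w y * (S.h i * S.opE i α (hat (S.mesh i) y) y) := by ring
    _ ≤ w y := mul_le_of_le_one_right (hw0 y hy) (htime i α y hy hyi)

theorem opE_of_bdR (hcons : S.ConsistentCoefficients) (i : ℕ) (α : A) (hy : y ∈ pb.bdR)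
    (w : Sp d → ℝ) : S.opE i α w y = 0 := by
  obtain ⟨-, -, -, hb, hc, -⟩ := hcons.implicit_R i α y hy
  rw [opE_eq, nodeOp_of_boundary (pb.notMem_interior (Or.inl (Or.inr hy)))
    (pb.notMem_bdD (Or.inr hy)), hb, hc, diniDeriv_zero_left, zero_mul, add_zero]

theorem rhs_nonneg (hcons : S.ConsistentCoefficients) (α : A)
    (hy : y ∈ (S.mesh i).vertices) : 0 ≤ S.rhs i α y := by
  have hyc := (S.isMesh i).vertices_subset hy
  rcases pb.mem_cases hyc with h | ⟨h, hD⟩ | ⟨h, hD, -, hf⟩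
  · rw [rhs, if_pos h]
    exact setIntegral_nonneg pb.isCompact_cl.measurableSet fun x hx =>
      mul_nonneg (hcons.fh_nonneg i α x hx) (nhat_nonneg _ _ _)
  · rw [rhs, if_neg h, if_pos hD]
    exact pb.g_nonneg y ⟨subset_closure hyc, h⟩
  · rw [rhs, if_neg h, if_neg hD]
    exact hcons.gh_nonneg i α y hf

theorem timeDiff_of_mem (hy : y ∈ interior pb.cl ∪ pb.bdT) (v : ℕ → Sp d → ℝ) (k : ℕ) :
    S.timeDiff i v k y = (v (k + 1) y - v k y) / S.h i := if_pos hy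

theorem timeDiff_of_mem_bdR_union_bdD (hy : y ∈ pb.bdR ∪ pb.bdD) (v : ℕ → Sp d → ℝ) (k : ℕ) :
    S.timeDiff i v k y = 0 := by
  refine if_neg fun h => ?_
  rcases h with h | h
  · exact pb.notMem_interior (hy.elim (fun hR => Or.inl (Or.inr hR)) Or.inr) h
  · exact hy.elim (Set.disjoint_left.1 pb.disjoint_TR h) (Set.disjoint_left.1 pb.disjoint_TD h)

theorem mem_node_cases (S : Discretisation pb) (hy : y ∈ (S.mesh i).vertices) :
    y ∈ interior pb.cl ∪ pb.bdT ∨ y ∈ pb.bdR ∨ y ∈ pb.bdD := by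
  rcases pb.mem_cases ((S.isMesh i).vertices_subset hy) with h | ⟨-, hD⟩ | ⟨-, -, hT | hR, -⟩
  · exact Or.inl (Or.inl h)
  · exact Or.inr (Or.inr hD)
  · exact Or.inl (Or.inr hT)
  · exact Or.inr (Or.inl hR)

theorem vertices_nonempty (S : Discretisation pb) (i : ℕ) : (S.mesh i).vertices.Nonempty := by
  obtain ⟨x, hx⟩ := pb.nonempty_interior
  obtain ⟨s, hs, -⟩ := (S.isMesh i).exists_element (interior_subset hx)
  obtain ⟨y, hy⟩ := (S.mesh i).nonempty_of_mem_faces hs.1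
  exact ⟨y, mem_vertices_of_mem hs.1 hy⟩

theorem nonneg_of_min (S : Discretisation pb) (i : ℕ) {e : Sp d → ℝ}
    (h : ∀ y ∈ (S.mesh i).vertices, (∀ z ∈ (S.mesh i).vertices, e y ≤ e z) → 0 ≤ e y) :
    ∀ y ∈ (S.mesh i).vertices, 0 ≤ e y := by
  obtain ⟨y₀, hy₀, hmin⟩ := exists_min_image _ e (S.isMesh i).finite_vertices
    (S.vertices_nonempty i)
  exact fun y hy => (h y₀ hy₀ hmin).trans (hmin y hy)

namespace IsNumericalSolution

variable {v : ℕ → Sp d → ℝ} {k : ℕ}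

theorem eq_g_of_bdD [Nonempty A] (hv : S.IsNumericalSolution i v) (hk : k < S.n i)
    (hy : y ∈ (S.mesh i).vertices) (hD : y ∈ pb.bdD) : v k y = pb.g y := by
  have hni := pb.notMem_interior (Or.inr hD)
  have hresidual : (fun α : A => S.opE i α (v (k + 1)) y + S.opI i α (v k) y - S.rhs i α y) =
      fun _ => v k y - pb.g y := by
    funext α
    rw [opE_eq, opI_eq, nodeOp_of_dirichlet hni hD, nodeOp_of_dirichlet hni hD, rhs, if_neg hni,
      if_pos hD, zero_mul, zero_add, one_mul]
  have hstep := hv.step k hk y hy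
  rw [timeDiff_of_mem_bdR_union_bdD (Or.inr hD), hresidual, range_const] at hstep
  exact sub_eq_zero.1 (hstep.unique isLUB_singleton).symm

theorem nonneg_of_min_of_mem (hv : S.IsNumericalSolution i v) (hcons : S.ConsistentCoefficients)
    (hmono : S.ArtificialDiffusion) (htime : S.TimeStepRestriction) (hk : k < S.n i)
    (hnext : ∀ z ∈ (S.mesh i).vertices, 0 ≤ v (k + 1) z) (hy : y ∈ (S.mesh i).vertices)
    (hyi : y ∈ interior pb.cl ∪ pb.bdT) (hmin : ∀ z ∈ (S.mesh i).vertices, v k y ≤ v k z) :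
    0 ≤ v k y := by
  by_contra! hneg
  obtain ⟨θ, -, hM⟩ := monotoneCoefficients hcons hmono i
  have hstep := hv.step k hk y hy
  rw [timeDiff_of_mem hyi] at hstep
  have hle : (v (k + 1) y - v k y) / S.h i ≤ v (k + 1) y / S.h i := by
    refine hstep.2 (forall_mem_range.2 fun α => ?_)
    have hexplicit : S.opE i α (v (k + 1)) y ≤ v (k + 1) y / S.h i := by
      rw [le_div_iff₀' (S.h_pos i)]
      exact h_mul_opE_le hcons hmono htime α hy hyi (hv.mem (k + 1) hk) hnext
    have himplicit : S.opI i α (v k) y ≤ 0 := by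
      rw [opI_eq]
      exact (hM α).2.nonpos_of_min hy (hv.mem k hk.le) hmin hneg.le zero_le_one
    linarith [rhs_nonneg hcons α hy]
  rw [div_le_div_iff_of_pos_right (S.h_pos i)] at hle
  linarith

theorem nonneg_of_min_of_bdR [CompactSpace A] [Nonempty A] (hv : S.IsNumericalSolution i v)
    (hcons : S.ConsistentCoefficients) (hmono : S.ArtificialDiffusion) (hk : k < S.n i)
    (hy : y ∈ (S.mesh i).vertices) (hR : y ∈ pb.bdR)
    (hmin : ∀ z ∈ (S.mesh i).vertices, v k y ≤ v k z) : 0 ≤ v k y := by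
  by_contra! hneg
  obtain ⟨θ, -, hM⟩ := monotoneCoefficients hcons hmono i
  have hf : y ∈ frontier pb.cl := pb.union_eq ▸ Or.inl (Or.inr hR)
  have hcont : Continuous fun α => S.cBI i α y :=
    continuous_iff_continuousAt.2 fun α => ((hcons.cBI_pc i).continuous_control α).tendsto_at hf
  obtain ⟨α₀, -, hα₀⟩ := isCompact_univ.exists_isMinOn univ_nonempty hcont.continuousOn
  have hpos : 0 < S.cBI i α₀ y := (hcons.implicit_R i α₀ y hR).2.2.2.2.2
  have hstep := hv.step k hk y hy
  rw [timeDiff_of_mem_bdR_union_bdD (Or.inl hR)] at hstep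
  have hle : 0 ≤ S.cBI i α₀ y * v k y := by
    refine hstep.2 (forall_mem_range.2 fun α => ?_)
    have himplicit := (hM α).2.le_of_min (δ := 1) hy (hv.mem k hk.le) hmin
    rw [← opI_eq, nodeOp_of_boundary (pb.notMem_interior (Or.inl (Or.inr hR)))
      (pb.notMem_bdD (Or.inr hR)),
      diniDeriv_unit (S.isMesh i) (hcons.cone i α y hy (Or.inr hR)).2,
      (S.isMesh i).unit_apply ((S.isMesh i).vertices_subset hy), zero_add, mul_one] at himplicit
    rw [opE_of_bdR hcons i α hR]
    linarith [rhs_nonneg hcons α hy, mul_le_mul_of_nonpos_left (hα₀ (mem_univ α)) hneg.le]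
  exact (mul_neg_of_pos_of_neg hpos hneg).not_ge hle

theorem nonneg [CompactSpace A] [Nonempty A] (hv : S.IsNumericalSolution i v)
    (hcons : S.ConsistentCoefficients) (hmono : S.ArtificialDiffusion)
    (htime : S.TimeStepRestriction) (hk : k ≤ S.n i) :
    ∀ y ∈ (S.mesh i).vertices, 0 ≤ v k y := by
  induction hk using Nat.decreasingInduction with
  | self =>
    intro y hy
    rw [hv.final y hy]
    exact pb.vT_nonneg y ((S.isMesh i).vertices_subset hy)
  | of_succ k hk ih =>
    refine S.nonneg_of_min i fun y hy hmin => ?_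
    rcases S.mem_node_cases hy with h | hR | hD
    · exact hv.nonneg_of_min_of_mem hcons hmono htime hk ih hy h hmin
    · exact hv.nonneg_of_min_of_bdR hcons hmono hk hy hR hmin
    · rw [hv.eq_g_of_bdD hk hy hD]
      exact pb.g_nonneg y (pb.union_eq ▸ Or.inr hD)

/-- A supersolution for one control `α` suffices, since the supremum over all controls dominates the
residual of `α`. -/
theorem le_of_supersolution [Nonempty A] (hv : S.IsNumericalSolution i v)
    (hcons : S.ConsistentCoefficients) (hmono : S.ArtificialDiffusion)
    (htime : S.TimeStepRestriction) (hk : k < S.n i) (α : A) {W W' : Sp d → ℝ}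
    (hW : W ∈ P1 (S.mesh i)) (hW' : W' ∈ P1 (S.mesh i))
    (hnext : ∀ y ∈ (S.mesh i).vertices, v (k + 1) y ≤ W' y)
    (hD : ∀ y ∈ (S.mesh i).vertices, y ∈ pb.bdD → pb.g y ≤ W y)
    (hT : ∀ y ∈ (S.mesh i).vertices, y ∈ interior pb.cl ∪ pb.bdT →
      0 < -((W' y - W y) / S.h i) + (S.opE i α W' y + S.opI i α W y) - S.rhs i α y)
    (hR : ∀ y ∈ (S.mesh i).vertices, y ∈ pb.bdR → 0 < S.opI i α W y - S.rhs i α y) :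
    ∀ y ∈ (S.mesh i).vertices, v k y ≤ W y := by
  suffices h : ∀ y ∈ (S.mesh i).vertices, 0 ≤ (W - v k) y from
    fun y hy => sub_nonneg.1 (h y hy)
  refine S.nonneg_of_min i fun y hy hmin => ?_
  by_contra! hneg
  have hlt : W y < v k y := sub_neg.1 hneg
  obtain ⟨θ, -, hM⟩ := monotoneCoefficients hcons hmono i
  have hmem := hv.mem k hk.le
  have hmem' := hv.mem (k + 1) hk
  have hstep := (hv.step k hk y hy).1 (mem_range_self α)
  have himplicit : S.opI i α W y ≤ S.opI i α (v k) y := by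
    have h := (hM α).2.nonpos_of_min hy ((P1 _).sub_mem hW hmem) hmin hneg.le zero_le_one
    rwa [(hM α).2.sub hy hW hmem, ← opI_eq, ← opI_eq, sub_nonpos] at h
  rcases S.mem_node_cases hy with h | h | h
  · have hexplicit : S.opE i α W' y - S.opE i α (v (k + 1)) y ≤ (W' y - v (k + 1) y) / S.h i := by
      have hle := h_mul_opE_le hcons hmono htime α hy h ((P1 _).sub_mem hW' hmem')
        (fun z hz => sub_nonneg.2 (hnext z hz))
      rwa [opE_eq, (hM α).1.sub hy hW' hmem', ← opE_eq, ← opE_eq, ← le_div_iff₀' (S.h_pos i)]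
        at hle
    rw [timeDiff_of_mem h] at hstep
    have hquot : W y / S.h i < v k y / S.h i := div_lt_div_of_pos_right hlt (S.h_pos i)
    have hsuper := hT y hy h
    simp only [sub_div] at hstep hexplicit hsuper
    linarith
  · rw [timeDiff_of_mem_bdR_union_bdD (Or.inl h), opE_of_bdR hcons i α h] at hstep
    linarith [hR y hy h]
  · linarith [hD y hy h, hv.eq_g_of_bdD hk hy h]

end IsNumericalSolution

end Discretisation

/-! ### Green's formula for hat functions of interior nodes -/

theorem hat_lineMap (hs : s ∈ elements K) (hy : y ∈ s) (hx : x ∈ simplex s) {τ : ℝ}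
    (hτ : τ ∈ Icc (0 : ℝ) 1) :
    hat K y (AffineMap.lineMap y x τ) = AffineMap.lineMap 1 (hat K y x) τ := by
  rw [hat_eq_coord hs ((convex_simplex s).lineMap_mem (mem_simplex_of_mem hy) hx hτ) hy,
    AffineMap.apply_lineMap, ← hat_eq_coord hs (mem_simplex_of_mem hy) hy,
    ← hat_eq_coord hs hx hy, hat_self (mem_vertices_of_mem hs.1 hy)]

theorem mem_simplex_of_lineMap_mem (hs : s ∈ elements K) (hy : y ∈ s) {τ : ℝ} (hτ : 0 < τ)
    (h : AffineMap.lineMap y x τ ∈ simplex s) (hx : 0 ≤ (elementBasis hs).coord ⟨y, hy⟩ x) :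
    x ∈ simplex s := by
  rw [simplex_eq_coord_nonneg hs] at h ⊢
  rintro ⟨z, hz⟩
  obtain rfl | hzy := eq_or_ne z y
  · exact hx
  · have hcoord : (elementBasis hs).coord ⟨z, hz⟩ y = 0 := by
      rw [← hat_eq_coord hs (mem_simplex_of_mem hy) hz,
        hat_of_ne (mem_vertices_of_mem hs.1 hy) hzy]
    have hcoord_nonneg := h ⟨z, hz⟩
    rw [AffineMap.apply_lineMap, hcoord, AffineMap.lineMap_apply_ring', sub_zero,
      add_zero] at hcoord_nonneg
    exact nonneg_of_mul_nonneg_right hcoord_nonneg hτ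

theorem eventually_mem_simplex_of_lineMap_mem (hs : s ∈ elements K) (hy : y ∈ s)
    (hxs : x ∈ simplex s) (hx : 0 < hat K y x) (ht : t ∈ elements K) {τ : ℝ}
    (hτ : τ ∈ Ioo (0 : ℝ) 1) :
    ∀ᶠ q in 𝓝 x, AffineMap.lineMap y q τ ∈ simplex t → q ∈ simplex t := by
  by_cases hxt : AffineMap.lineMap y x τ ∈ simplex t
  · have hval := hat_lineMap hs hy hxs (Ioo_subset_Icc_self hτ)
    have hyt : y ∈ t := by
      by_contra hyt
      rw [hat_eq_zero_of_notMem ht.1 hxt hyt, AffineMap.lineMap_apply_ring'] at hval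
      nlinarith [hτ.1, hτ.2, mul_pos hτ.1 hx]
    set L := (elementBasis ht).coord ⟨y, hyt⟩ with hL
    have hLx : L x = hat K y x := by
      rw [hat_eq_coord ht hxt hyt, ← hL, AffineMap.apply_lineMap, hL,
        ← hat_eq_coord ht (mem_simplex_of_mem hyt) hyt,
        hat_self (mem_vertices_of_mem ht.1 hyt)] at hval
      rw [AffineMap.lineMap_apply_ring', AffineMap.lineMap_apply_ring'] at hval
      linarith [mul_left_cancel₀ hτ.1.ne' (add_right_cancel hval)]
    filter_upwards [L.continuous_of_finiteDimensional.continuousAt.eventually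
      (lt_mem_nhds (hLx ▸ hx))] with q hq hqt
    exact mem_simplex_of_lineMap_mem ht hyt hτ.1 hqt hq.le
  · have hcont : ContinuousAt (fun q : Sp d => AffineMap.lineMap y q τ) x := by
      simp only [AffineMap.lineMap_apply, vsub_eq_sub, vadd_eq_add]
      fun_prop
    filter_upwards [hcont.eventually
      ((isCompact_simplex t).isClosed.isOpen_compl.mem_nhds hxt)] with q hq hqt
    exact absurd hqt hq

theorem mem_interior_of_hat_ne_zero (hK : IsMeshOf K D) (hyi : y ∈ interior D)
    (hx : hat K y x ≠ 0) : x ∈ interior D := by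
  obtain ⟨s, hs, hxs⟩ : ∃ s ∈ elements K, x ∈ simplex s := hK.exists_element <| by
    by_contra h
    exact hx (hat_eq_zero_of_notMem_space (by rwa [hK.space_eq]) y)
  have hys : y ∈ s := by
    by_contra h
    exact hx (hat_eq_zero_of_notMem hs.1 hxs h)
  -- Near `x`, a point lies in every element which contains its contraction towards `y`.
  obtain ⟨τ, hτD, hτ⟩ : ∃ τ : ℝ, AffineMap.lineMap y x τ ∈ interior D ∧ τ ∈ Ioo (0 : ℝ) 1 := by
    have hlim : Tendsto (fun τ : ℝ => AffineMap.lineMap y x τ) (𝓝[>] 0) (𝓝 y) := by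
      have h := (AffineMap.lineMap_continuous (R := ℝ) (p := y) (q := x)).tendsto 0
      rw [AffineMap.lineMap_apply_zero] at h
      exact h.mono_left nhdsWithin_le_nhds
    exact ((hlim.eventually (isOpen_interior.mem_nhds hyi)).and
      (Ioo_mem_nhdsGT zero_lt_one)).exists
  have hcont : ContinuousAt (fun q : Sp d => AffineMap.lineMap y q τ) x := by
    simp only [AffineMap.lineMap_apply, vsub_eq_sub, vadd_eq_add]
    fun_prop
  rw [mem_interior_iff_mem_nhds]
  filter_upwards [(eventually_all_finite hK.finite_elements).2 fun e he =>
      eventually_mem_simplex_of_lineMap_mem hs hys hxs ((hat_nonneg K y x).lt_of_ne' hx) he hτ,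
    hcont.eventually (isOpen_interior.mem_nhds hτD)] with q hq hqD
  obtain ⟨e, he, hqe⟩ := hK.exists_element (interior_subset hqD)
  exact hK.simplex_subset he (hq e he hqe)

section Lipschitz

variable {E : Type*} [NormedAddCommGroup E] {f : E → ℝ} {L : NNReal}

theorem continuous_of_eventually_abs_sub_le
    (h : ∀ x, ∀ᶠ q in 𝓝 x, |f q - f x| ≤ L * ‖q - x‖) : Continuous f := by
  refine continuous_iff_continuousAt.2 fun x => ?_
  rw [ContinuousAt, tendsto_iff_dist_tendsto_zero]
  have hlim : Tendsto (fun q : E => L * ‖q - x‖) (𝓝 x) (𝓝 0) := by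
    have hcont : Continuous fun q : E => L * ‖q - x‖ := by fun_prop
    simpa using hcont.tendsto x
  exact squeeze_zero' (Eventually.of_forall fun _ => dist_nonneg) (h x) hlim

theorem sub_le_of_eventually_abs_sub_le [NormedSpace ℝ E]
    (h : ∀ x, ∀ᶠ q in 𝓝 x, |f q - f x| ≤ L * ‖q - x‖) (p q : E) :
    f q - f p ≤ L * ‖q - p‖ := by
  have hline : Continuous fun τ : ℝ => p + τ • (q - p) := by fun_prop
  have hslope (τ : ℝ) : ∀ᶠ τ' in 𝓝[>] τ,
      slope (fun τ : ℝ => f (p + τ • (q - p)) - f p) τ τ' ≤ L * ‖q - p‖ := by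
    filter_upwards [nhdsWithin_le_nhds (hline.continuousAt.eventually (h _)),
      self_mem_nhdsWithin] with τ' hτ' hlt
    have hlt : 0 < τ' - τ := sub_pos.2 hlt
    have hdiff : p + τ' • (q - p) - (p + τ • (q - p)) = (τ' - τ) • (q - p) := by
      rw [sub_smul]; abel
    rw [hdiff, norm_smul, Real.norm_eq_abs, abs_of_pos hlt] at hτ'
    rw [slope_def_field, div_le_iff₀ hlt]
    linarith [(le_abs_self _).trans hτ']
  have hbound := image_le_of_liminf_slope_right_le_deriv_boundary
    (f := fun τ : ℝ => f (p + τ • (q - p)) - f p) (a := 0) (b := 1)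
    (B := fun τ => L * ‖q - p‖ * τ) (B' := fun _ => L * ‖q - p‖)
    (((continuous_of_eventually_abs_sub_le h).comp hline).sub continuous_const).continuousOn
    (by simp) (by fun_prop)
    (fun τ _ => by simpa using ((hasDerivAt_id τ).const_mul (L * ‖q - p‖)).hasDerivWithinAt)
    (fun τ _ r hr => ((hslope τ).mono fun _ hτ' => hτ'.trans_lt hr).frequently)
    (right_mem_Icc.2 zero_le_one)
  simpa using hbound

theorem lipschitzWith_of_eventually_abs_sub_le [NormedSpace ℝ E]
    (h : ∀ x, ∀ᶠ q in 𝓝 x, |f q - f x| ≤ L * ‖q - x‖) : LipschitzWith L f :=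
  LipschitzWith.of_le_add_mul L fun p q => by
    rw [dist_eq_norm]
    linarith [sub_le_of_eventually_abs_sub_le h q p]

end Lipschitz

theorem IsMeshOf.eventually_mem_simplex_of_mem (hK : IsMeshOf K D) (x : Sp d) :
    ∀ᶠ q in 𝓝 x, ∀ s ∈ elements K, q ∈ simplex s → x ∈ simplex s := by
  refine (eventually_all_finite hK.finite_elements).2 fun s _ => ?_
  by_cases hxs : x ∈ simplex s
  · exact Eventually.of_forall fun _ _ => hxs
  · filter_upwards [(isCompact_simplex s).isClosed.isOpen_compl.mem_nhds hxs] with q hq hqs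
    exact absurd hqs hq

theorem eventually_mem_or_hat_eq_zero (hK : IsMeshOf K D) (hyi : y ∈ interior D)
    (x : Sp d) : ∀ᶠ q in 𝓝 x, q ∈ D ∨ hat K y x = 0 := by
  by_cases hx : hat K y x = 0
  · exact Eventually.of_forall fun _ => .inr hx
  · filter_upwards [mem_interior_iff_mem_nhds.1 (mem_interior_of_hat_ne_zero hK hyi hx)]
      with q hq using .inl hq

theorem exists_lipschitzWith_hat (hK : IsMeshOf K D) (hyi : y ∈ interior D) :
    ∃ L : NNReal, LipschitzWith L (hat K y) := by
  set E := hK.finite_elements.toFinset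
  refine ⟨∑ s ∈ E, ‖elemGrad K s (hat K y)‖₊, lipschitzWith_of_eventually_abs_sub_le fun x => ?_⟩
  have hgrad : ∀ s ∈ elements K, ‖elemGrad K s (hat K y)‖ ≤
      ((∑ s ∈ E, ‖elemGrad K s (hat K y)‖₊ : NNReal) : ℝ) := fun s hs => by
    push_cast
    exact Finset.single_le_sum (f := fun s => ‖elemGrad K s (hat K y)‖) (fun s _ => norm_nonneg _)
      (hK.finite_elements.mem_toFinset.2 hs)
  have hout : ∀ q ∉ D, hat K y q = 0 := fun q hq =>
    hat_eq_zero_of_notMem_space (by rwa [hK.space_eq]) y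
  filter_upwards [hK.eventually_mem_simplex_of_mem x,
    eventually_mem_or_hat_eq_zero hK hyi x] with q hqx hq
  by_cases hqD : q ∈ D
  · obtain ⟨s, hs, hqs⟩ := hK.exists_element hqD
    rw [P1.sub_eq_inner hK (hat_mem_P1 hK y) hs hqs (hqx s hs hqs)]
    exact (abs_real_inner_le_norm _ _).trans
      (mul_le_mul_of_nonneg_right (hgrad s hs) (norm_nonneg _))
  · rw [hq.resolve_left hqD, hout q hqD, sub_zero, abs_zero]
    positivity

theorem exists_lipschitzWith_nhat (hK : IsMeshOf K D) (hyi : y ∈ interior D) :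
    ∃ L : NNReal, LipschitzWith L (nhat K y) := by
  obtain ⟨L, hL⟩ := exists_lipschitzWith_hat hK hyi
  refine ⟨‖(∫ z in K.space, |hat K y z|)⁻¹‖₊ * L, ?_⟩
  rw [nhat_eq_smul]
  exact (lipschitzWith_smul _).comp hL

theorem nhat_eq_zero_of_notMem_space (hx : x ∉ K.space) (y : Sp d) : nhat K y x = 0 := by
  rw [nhat, hat_eq_zero_of_notMem_space hx, zero_div]

theorem laplacian_eq_sum_fderiv (u : Sp d → ℝ) (x : Sp d) : Laplacian.laplacian u x =
    ∑ j, fderiv ℝ (fderiv ℝ u) x (EuclideanSpace.basisFun (Fin d) ℝ j)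
      (EuclideanSpace.basisFun (Fin d) ℝ j) := by
  rw [InnerProductSpace.laplacian_eq_iteratedFDeriv_orthonormalBasis u
    (EuclideanSpace.basisFun (Fin d) ℝ)]
  simp [iteratedFDeriv_two_apply]

theorem inner_gradient_left (u : Sp d → ℝ) (x p : Sp d) :
    inner ℝ (gradient u x) p = fderiv ℝ u x p := by
  rw [gradient, InnerProductSpace.toDual_symm_apply]

theorem continuous_gradient {n : WithTop ℕ∞} (hu : ContDiff ℝ n u) (hn : 1 ≤ n) :
    Continuous (gradient u) :=
  (InnerProductSpace.toDual ℝ (Sp d)).symm.continuous.comp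
    (hu.continuous_fderiv (fun h => by simp [h] at hn))

theorem continuous_laplacian (hu : ContDiff ℝ 2 u) :
    Continuous (Laplacian.laplacian u : Sp d → ℝ) := by
  have hfderiv : ContDiff ℝ 1 (fderiv ℝ u) := hu.fderiv_right (by norm_num)
  have : Continuous (fderiv ℝ (fderiv ℝ u)) := hfderiv.continuous_fderiv (by norm_num)
  rw [show (Laplacian.laplacian u : Sp d → ℝ) = fun x => _ from
    funext (laplacian_eq_sum_fderiv u)]
  fun_prop

theorem integral_lineDeriv_nhat_mul (hK : IsMeshOf K D) (hD : IsClosed D) (e : Sp d) :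
    ∫ x, lineDeriv ℝ (nhat K y) x e * u x =
      ∫ x in D, u x * inner ℝ e (gradient (nhat K y) x) := by
  rw [← setIntegral_eq_integral_of_forall_compl_eq_zero (s := D)]
  · refine integral_congr_ae ?_
    filter_upwards [hK.ae_mem_interior] with x ⟨s, hs, hx⟩
    have hgrad := P1.hasGradientAt hK (nhat_mem_P1 hK y) hs hx
    rw [hgrad.gradient, hgrad.differentiableAt.lineDeriv_eq_fderiv, hgrad.hasFDerivAt.fderiv,
      InnerProductSpace.toDual_apply_apply, real_inner_comm, mul_comm]
  · intro x hx
    have hzero : nhat K y =ᶠ[𝓝 x] fun _ => 0 := by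
      filter_upwards [hD.isOpen_compl.mem_nhds hx] with q hq
      exact nhat_eq_zero_of_notMem_space (by rwa [hK.space_eq]) y
    rw [hzero.lineDeriv_eq]
    simp [lineDeriv]

theorem integral_mul_inner_gradient_nhat (hK : IsMeshOf K D) (hD : IsClosed D)
    (hyi : y ∈ interior D) (hu : ContDiff ℝ 1 u) (hsupp : HasCompactSupport u) (e : Sp d) :
    ∫ x in D, u x * inner ℝ e (gradient (nhat K y) x) =
      ∫ x in D, -fderiv ℝ u x e * nhat K y x := by
  obtain ⟨L, hL⟩ := exists_lipschitzWith_nhat hK hyi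
  obtain ⟨C, hC⟩ := hu.lipschitzWith_of_hasCompactSupport hsupp (by norm_num)
  rw [← integral_lineDeriv_nhat_mul hK hD, hL.integral_lineDeriv_mul_eq hC hsupp e,
    ← setIntegral_eq_integral_of_forall_compl_eq_zero (s := D)]
  · congr 1
    funext x
    rw [(hu.differentiable (by norm_num) x).lineDeriv_eq_fderiv, map_neg]
  · exact fun x hx => by
      rw [nhat_eq_zero_of_notMem_space (by rwa [hK.space_eq]), mul_zero]

/-- For an interior node there is no boundary term. -/
theorem integral_inner_gradient_nhat (hK : IsMeshOf K D) (hD : IsClosed D)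
    (hyi : y ∈ interior D) (hu : ContDiff ℝ 2 u) (hsupp : HasCompactSupport u) :
    ∫ x in D, inner ℝ (gradient u x) (gradient (nhat K y) x) =
      ∫ x in D, -Laplacian.laplacian u x * nhat K y x := by
  set e := EuclideanSpace.basisFun (Fin d) ℝ
  have hfderiv : ContDiff ℝ 1 (fderiv ℝ u) := hu.fderiv_right (by norm_num)
  have hpartial : ∀ j, ContDiff ℝ 1 fun x => fderiv ℝ u x (e j) := fun j =>
    hfderiv.clm_apply contDiff_const
  have : Continuous (fderiv ℝ (fderiv ℝ u)) := hfderiv.continuous_fderiv (by norm_num)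
  have hsecond : ∀ j x, fderiv ℝ (fun x => fderiv ℝ u x (e j)) x (e j) =
      fderiv ℝ (fderiv ℝ u) x (e j) (e j) := fun j x => by
    rw [((hfderiv.differentiable (by norm_num) x).hasFDerivAt.clm_apply
      (hasFDerivAt_const (e j) x)).fderiv]
    simp
  calc ∫ x in D, inner ℝ (gradient u x) (gradient (nhat K y) x)
      = ∫ x in D, ∑ j, fderiv ℝ u x (e j) * inner ℝ (e j) (gradient (nhat K y) x) := by
        congr 1
        funext x
        rw [← e.sum_inner_mul_inner]
        exact Finset.sum_congr rfl fun j _ => by rw [inner_gradient_left]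
    _ = ∑ j, ∫ x in D, fderiv ℝ u x (e j) * inner ℝ (e j) (gradient (nhat K y) x) :=
        integral_finsetSum _ fun j _ =>
          ((PwCont.of_continuousOn hK (hpartial j).continuous.continuousOn).mul
            ((PwCont.const (e j)).inner (PwCont.gradient hK (nhat_mem_P1 hK y)))).integrableOn hK
    _ = ∑ j, ∫ x in D, -(fderiv ℝ (fderiv ℝ u) x (e j) (e j)) * nhat K y x :=
        Finset.sum_congr rfl fun j _ => by
          simp only [integral_mul_inner_gradient_nhat hK hD hyi (hpartial j)
            (hsupp.fderiv_apply ℝ (e j)), hsecond]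
    _ = ∫ x in D, ∑ j, -(fderiv ℝ (fderiv ℝ u) x (e j) (e j)) * nhat K y x :=
        (integral_finsetSum _ fun j _ => ((PwCont.of_continuousOn hK (by fun_prop)).mul
          (pwCont_nhat hK y)).integrableOn hK).symm
    _ = ∫ x in D, -Laplacian.laplacian u x * nhat K y x := by
        congr 1
        funext x
        rw [laplacian_eq_sum_fderiv, ← Finset.sum_mul, Finset.sum_neg_distrib]

/-! ### Approximation by smooth functions -/

section Mollification

open scoped Convolution ContDiff

variable {E : Type*} [NormedAddCommGroup E] {F : Type*} [NormedAddCommGroup F] [NormedSpace ℝ F]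

theorem exists_contDiffBump_rOut_le (E : Type*) [NormedAddCommGroup E] {η : ℝ} (hη : 0 < η) :
    ∃ φ : ContDiffBump (0 : E), φ.rOut ≤ η :=
  ⟨⟨η / 2, η, half_pos hη, half_lt_self hη⟩, le_rfl⟩

variable [InnerProductSpace ℝ E] [FiniteDimensional ℝ E]

theorem exists_hasCompactSupport_eventuallyEq {n : ℕ∞} {f : E → F} (hf : ContDiff ℝ n f)
    {C : Set E} (hC : IsCompact C) :
    ∃ f' : E → F, ContDiff ℝ n f' ∧ HasCompactSupport f' ∧ ∀ x ∈ C, f' =ᶠ[𝓝 x] f := by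
  obtain ⟨R, hR⟩ := hC.isBounded.subset_ball 0
  set ρ := max R 1
  let χ : ContDiffBump (0 : E) := ⟨ρ, ρ + 1, by positivity, by linarith⟩
  refine ⟨fun x => χ x • f x, χ.contDiff.smul hf, χ.hasCompactSupport.smul_right, fun x hx => ?_⟩
  have hxρ : x ∈ Metric.ball (0 : E) ρ := Metric.ball_subset_ball (le_max_left _ _) (hR hx)
  filter_upwards [Metric.isOpen_ball.mem_nhds hxρ] with z hz
  rw [χ.one_of_mem_closedBall (Metric.ball_subset_closedBall hz), one_smul]

variable [MeasurableSpace E] [BorelSpace E]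

theorem contDiff_normed_convolution {f : E → F} (hf : Continuous f) (φ : ContDiffBump (0 : E)) :
    ContDiff ℝ ∞ (φ.normed volume ⋆[ContinuousLinearMap.lsmul ℝ ℝ, volume] f) :=
  φ.hasCompactSupport_normed.contDiff_convolution_left _ φ.contDiff_normed hf.locallyIntegrable

theorem hasCompactSupport_normed_convolution {f : E → F} (hc : HasCompactSupport f)
    (φ : ContDiffBump (0 : E)) :
    HasCompactSupport (φ.normed volume ⋆[ContinuousLinearMap.lsmul ℝ ℝ, volume] f) :=
  φ.hasCompactSupport_normed.convolution _ hc

theorem fderiv_normed_convolution {f : E → F} (hf : ContDiff ℝ 1 f) (hc : HasCompactSupport f)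
    (φ : ContDiffBump (0 : E)) :
    fderiv ℝ (φ.normed volume ⋆[ContinuousLinearMap.lsmul ℝ ℝ, volume] f) =
      φ.normed volume ⋆[ContinuousLinearMap.lsmul ℝ ℝ, volume] (fderiv ℝ f) := by
  have hprecompR : (ContinuousLinearMap.lsmul ℝ ℝ : ℝ →L[ℝ] F →L[ℝ] F).precompR E =
      ContinuousLinearMap.lsmul ℝ ℝ := by
    ext; simp
  funext x
  rw [(hc.hasFDerivAt_convolution_right (ContinuousLinearMap.lsmul ℝ ℝ)
    φ.continuous_normed.locallyIntegrable hf x).fderiv, hprecompR]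

variable [CompleteSpace F]

theorem exists_forall_dist_normed_convolution_le {f : E → F} (hf : Continuous f)
    (hc : HasCompactSupport f) {δ : ℝ} (hδ : 0 < δ) :
    ∃ η > 0, ∀ φ : ContDiffBump (0 : E), φ.rOut ≤ η → ∀ x,
      dist ((φ.normed volume ⋆[ContinuousLinearMap.lsmul ℝ ℝ, volume] f) x) (f x) ≤ δ := by
  obtain ⟨η, hη, h⟩ := Metric.uniformContinuous_iff.1 (hf.uniformContinuous_of_tendsto_cocompact
    hc.is_zero_at_infty) δ hδ
  refine ⟨η, hη, fun φ hφ x => φ.dist_normed_convolution_le hf.aestronglyMeasurable fun z hz => ?_⟩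
  exact (h (hz.trans_le hφ)).le

theorem exists_smooth_approx {f : E → F} (hf : Continuous f) {C : Set E} (hC : IsCompact C)
    {δ : ℝ} (hδ : 0 < δ) :
    ∃ u : E → F, ContDiff ℝ ∞ u ∧ HasCompactSupport u ∧ ∀ x ∈ C, dist (u x) (f x) ≤ δ := by
  obtain ⟨f', hf', hf'c, hff'⟩ := exists_hasCompactSupport_eventuallyEq (n := 0)
    (by exact_mod_cast contDiff_zero.2 hf) hC
  obtain ⟨η, hη, hconv⟩ := exists_forall_dist_normed_convolution_le hf'.continuous hf'c hδ
  obtain ⟨φ, hφ⟩ := exists_contDiffBump_rOut_le E hη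
  refine ⟨_, contDiff_normed_convolution hf'.continuous φ,
    hasCompactSupport_normed_convolution hf'c φ, fun x hx => ?_⟩
  rw [← (hff' x hx).eq_of_nhds]
  exact hconv φ hφ x

theorem exists_smooth_approx_fderiv {f : E → F} (hf : ContDiff ℝ 2 f) {C : Set E}
    (hC : IsCompact C) {δ : ℝ} (hδ : 0 < δ) :
    ∃ u : E → F, ContDiff ℝ ∞ u ∧ HasCompactSupport u ∧ ∀ x ∈ C, dist (u x) (f x) ≤ δ ∧
      dist (fderiv ℝ u x) (fderiv ℝ f x) ≤ δ ∧
      dist (fderiv ℝ (fderiv ℝ u) x) (fderiv ℝ (fderiv ℝ f) x) ≤ δ := by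
  obtain ⟨f', hf', hf'c, hff'⟩ :=
    exists_hasCompactSupport_eventuallyEq (n := 2) (by exact_mod_cast hf) hC
  have hf'₂ : ContDiff ℝ 2 f' := by exact_mod_cast hf'
  have hf'₁ : ContDiff ℝ 1 (fderiv ℝ f') := hf'₂.fderiv_right (by norm_num)
  have hc₁ : HasCompactSupport (fderiv ℝ f') := hf'c.fderiv ℝ
  obtain ⟨η₀, hη₀, hconv₀⟩ := exists_forall_dist_normed_convolution_le hf'.continuous hf'c hδ
  obtain ⟨η₁, hη₁, hconv₁⟩ := exists_forall_dist_normed_convolution_le hf'₁.continuous hc₁ hδ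
  obtain ⟨η₂, hη₂, hconv₂⟩ := exists_forall_dist_normed_convolution_le
    (hf'₁.continuous_fderiv (by norm_num)) (hc₁.fderiv ℝ) hδ
  obtain ⟨φ, hφ⟩ := exists_contDiffBump_rOut_le E (lt_min hη₀ (lt_min hη₁ hη₂))
  simp only [le_min_iff] at hφ
  have happrox₁ := hconv₁ φ hφ.2.1
  have happrox₂ := hconv₂ φ hφ.2.2
  have hfderiv := fderiv_normed_convolution (hf'₂.of_le (by norm_num)) hf'c φ
  rw [← hfderiv] at happrox₁
  rw [← fderiv_normed_convolution hf'₁ hc₁, ← hfderiv] at happrox₂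
  refine ⟨_, contDiff_normed_convolution hf'.continuous φ,
    hasCompactSupport_normed_convolution hf'c φ, fun x hx => ⟨?_, ?_, ?_⟩⟩
  · rw [← (hff' x hx).eq_of_nhds]
    exact hconv₀ φ hφ.1 x
  · rw [← (hff' x hx).fderiv_eq]
    exact happrox₁ x
  · rw [← (hff' x hx).fderiv.fderiv_eq]
    exact happrox₂ x

theorem norm_gradient_sub (u f : Sp d → ℝ) (x : Sp d) :
    ‖gradient u x - gradient f x‖ = ‖fderiv ℝ u x - fderiv ℝ f x‖ := by
  rw [gradient, gradient, ← map_sub, LinearIsometryEquiv.norm_map]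

theorem abs_laplacian_sub_le (u f : Sp d → ℝ) (x : Sp d) :
    |Laplacian.laplacian u x - Laplacian.laplacian f x| ≤
      d * ‖fderiv ℝ (fderiv ℝ u) x - fderiv ℝ (fderiv ℝ f) x‖ := by
  set e := EuclideanSpace.basisFun (Fin d) ℝ
  have hterm : ∀ j, |fderiv ℝ (fderiv ℝ u) x (e j) (e j) - fderiv ℝ (fderiv ℝ f) x (e j) (e j)| ≤
      ‖fderiv ℝ (fderiv ℝ u) x - fderiv ℝ (fderiv ℝ f) x‖ := fun j => by
    simpa only [e.norm_eq_one, mul_one, Real.norm_eq_abs, sub_apply] using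
      (fderiv ℝ (fderiv ℝ u) x - fderiv ℝ (fderiv ℝ f) x).le_opNorm₂ (e j) (e j)
  rw [laplacian_eq_sum_fderiv, laplacian_eq_sum_fderiv, ← Finset.sum_sub_distrib]
  refine (Finset.abs_sum_le_sum_abs _ _).trans
    ((Finset.sum_le_card_nsmul _ _ _ fun j _ => hterm j).trans_eq ?_)
  rw [Finset.card_univ, Fintype.card_fin, nsmul_eq_mul]

theorem exists_smooth_approx_gradient_laplacian {f : Sp d → ℝ} (hf : ContDiff ℝ 2 f)
    {C : Set (Sp d)} (hC : IsCompact C) {δ : ℝ} (hδ : 0 < δ) :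
    ∃ u : Sp d → ℝ, ContDiff ℝ ∞ u ∧ HasCompactSupport u ∧ ∀ x ∈ C, |u x - f x| ≤ δ ∧
      ‖gradient u x - gradient f x‖ ≤ δ ∧
      |Laplacian.laplacian u x - Laplacian.laplacian f x| ≤ δ := by
  have hle : δ / (d + 1) ≤ δ := div_le_self hδ.le (by simp)
  obtain ⟨u, hu, huc, happrox⟩ :=
    exists_smooth_approx_fderiv hf hC (δ := δ / (d + 1)) (by positivity)
  refine ⟨u, hu, huc, fun x hx => ?_⟩
  obtain ⟨hval, hgrad, hhess⟩ := happrox x hx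
  refine ⟨hval.trans hle, (norm_gradient_sub u f x).trans_le
    ((dist_eq_norm _ _).symm.trans_le (hgrad.trans hle)), (abs_laplacian_sub_le u f x).trans ?_⟩
  have hhess' : ‖fderiv ℝ (fderiv ℝ u) x - fderiv ℝ (fderiv ℝ f) x‖ ≤ δ / (d + 1) :=
    (dist_eq_norm (fderiv ℝ (fderiv ℝ u) x) (fderiv ℝ (fderiv ℝ f) x)).ge.trans hhess
  calc (d : ℝ) * ‖fderiv ℝ (fderiv ℝ u) x - fderiv ℝ (fderiv ℝ f) x‖
      ≤ (d + 1) * (δ / (d + 1)) := by gcongr; linarith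
    _ = δ := mul_div_cancel₀ _ (by positivity)

end Mollification

/-! ### Elliptic projections -/

section Approximation

open scoped ContDiff

/-- The finite element function `v` approximates `u` up to `δ` in `W^{1,∞}(D)`. The gradients are
compared on closed elements, so that the bound is available at the nodes. -/
structure IsW1infApprox (K : Mesh d) (D : Set (Sp d)) (v u : Sp d → ℝ) (δ : ℝ) : Prop where
  mem : v ∈ P1 K
  abs_sub_le : ∀ x ∈ D, |v x - u x| ≤ δ
  norm_elemGrad_sub_le : ∀ s ∈ elements K, ∀ x ∈ simplex s, ‖elemGrad K s v - gradient u x‖ ≤ δ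

theorem le_of_ae_le_of_isOpen {U : Set (Sp d)} (hU : IsOpen U) {f : Sp d → ℝ}
    (hf : ContinuousOn f U) {δ : ℝ} (h : ∀ᵐ x ∂volume.restrict U, f x ≤ δ) :
    ∀ x ∈ U, f x ≤ δ := by
  have hae : (fun x => max (f x) δ) =ᵐ[volume.restrict U] fun _ => δ := by
    filter_upwards [h] with x hx using max_eq_right hx
  have heq := Measure.eqOn_open_of_ae_eq hae hU (hf.sup continuousOn_const) continuousOn_const
  exact fun x hx => max_eq_right_iff.1 (heq hx)

theorem le_on_simplex_of_ae_le (hK : IsMeshOf K D) (hs : s ∈ elements K) {f : Sp d → ℝ}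
    (hf : ContinuousOn f (simplex s)) {δ : ℝ}
    (h : ∀ᵐ x ∂volume.restrict D, x ∈ interior (simplex s) → f x ≤ δ) :
    ∀ x ∈ simplex s, f x ≤ δ := by
  have hinterior : ∀ x ∈ interior (simplex s), f x ≤ δ := by
    refine le_of_ae_le_of_isOpen isOpen_interior (hf.mono interior_subset) ?_
    filter_upwards [ae_restrict_of_ae_restrict_of_subset
      (interior_subset.trans (hK.simplex_subset hs)) h,
      ae_restrict_mem isOpen_interior.measurableSet] with x hle hx using hle hx
  intro x hx
  rw [← closure_interior_simplex hs] at hx hf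
  exact le_on_closure hinterior hf continuousOn_const hx

theorem ae_norm_le_of_eLpNorm_top_le {F : Type*} [NormedAddCommGroup F] {f : Sp d → F}
    {μ : Measure (Sp d)} {δ : ℝ} (hδ : 0 ≤ δ) (h : eLpNorm f ∞ μ ≤ ENNReal.ofReal δ) :
    ∀ᵐ x ∂μ, ‖f x‖ ≤ δ := by
  rw [eLpNorm_exponent_top] at h
  filter_upwards [ae_le_eLpNormEssSup (f := f) (μ := μ)] with x hx
  have hle := hx.trans h
  rwa [← ofReal_norm, ENNReal.ofReal_le_ofReal_iff hδ] at hle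

theorem isW1infApprox_of_w1infNorm_le (hK : IsMeshOf K D) (hv : v ∈ P1 K) (hu : ContDiff ℝ 1 u)
    {δ : ℝ} (hδ : 0 ≤ δ) (h : w1infNorm D (v - u) ≤ ENNReal.ofReal δ) :
    IsW1infApprox K D v u δ := by
  have hvalue := ae_norm_le_of_eLpNorm_top_le hδ (le_self_add.trans h)
  have hgradient := ae_norm_le_of_eLpNorm_top_le hδ (le_add_self.trans h)
  refine ⟨hv, fun x hx => ?_, fun s hs => ?_⟩
  · obtain ⟨s, hs, hxs⟩ := hK.exists_element hx
    refine le_on_simplex_of_ae_le hK hs (f := fun x => |v x - u x|)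
      ((P1.continuousOn_simplex hv hs.1).sub hu.continuous.continuousOn).abs ?_ x hxs
    filter_upwards [hvalue] with x hx _ using hx
  · refine le_on_simplex_of_ae_le hK hs
      (continuousOn_const.sub (continuous_gradient hu le_rfl).continuousOn).norm ?_
    filter_upwards [hgradient] with x hx hxs
    have hdiff : HasGradientAt (v - u) (elemGrad K s v - gradient u x) x := by
      have := (P1.hasGradientAt hK hv hs hxs).hasFDerivAt.sub
        ((hu.differentiable one_ne_zero) x).hasGradientAt.hasFDerivAt
      rwa [← map_sub] at this
    rwa [hdiff.gradient] at hx

theorem IsW1infApprox.abs_diniDeriv_add_le {δ : ℝ} (hK : IsMeshOf K D)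
    (h : IsW1infApprox K D v u δ) {p : Sp d} (hp : p ∈ tangentDirections D y) :
    |diniDeriv p v y + inner ℝ (gradient u y) p| ≤ δ * ‖p‖ := by
  obtain ⟨s, hs, hy, Λ, hΛ, hseg⟩ := hK.exists_element_segment hp
  have herror : diniDeriv p v y + inner ℝ (gradient u y) p =
      -inner ℝ (elemGrad K s v - gradient u y) p := by
    rw [diniDeriv_eq hK h.mem hs hy hΛ hseg, inner_sub_left]
    ring
  rw [herror, abs_neg]
  exact (abs_real_inner_le_norm _ _).trans
    (mul_le_mul_of_nonneg_right (h.norm_elemGrad_sub_le s hs y hy) (norm_nonneg p))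

theorem mem_tsupport_nhat (hK : IsMeshOf K D) (hs : s ∈ elements K) (hy : y ∈ s)
    (hx : x ∈ interior (simplex s)) : x ∈ tsupport (nhat K y) := by
  refine subset_tsupport _ ?_
  rw [Function.mem_support, nhat, integral_abs_hat hK]
  exact (div_pos (hat_pos_of_mem_interior hs hx hy)
    (integral_hat_pos hK (mem_vertices_of_mem hs.1 hy))).ne'

theorem self_mem_tsupport_nhat (hK : IsMeshOf K D) (hy : y ∈ K.vertices) :
    y ∈ tsupport (nhat K y) := by
  refine subset_tsupport _ ?_
  rw [Function.mem_support, nhat, integral_abs_hat hK, hat_self hy]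
  exact (div_pos one_pos (integral_hat_pos hK hy)).ne'

theorem weakOp_add_weakOp (hK : IsMeshOf K D) {a a' : ℝ} {b b' : Sp d → Sp d} {c c' : Sp d → ℝ}
    (hb : ContinuousOn b D) (hb' : ContinuousOn b' D) (hc : ContinuousOn c D)
    (hc' : ContinuousOn c' D) (hv : v ∈ P1 K) (y : Sp d) :
    weakOp K D a b c v y + weakOp K D a' b' c' v y =
      weakOp K D (a + a') (b + b') (c + c') v y := by
  have hn := pwCont_nhat hK y
  have hlower : ∫ x in D, (-inner ℝ ((b + b') x) (gradient v x) + (c + c') x * v x) * nhat K y x =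
      (∫ x in D, (-inner ℝ (b x) (gradient v x) + c x * v x) * nhat K y x) +
        ∫ x in D, (-inner ℝ (b' x) (gradient v x) + c' x * v x) * nhat K y x := by
    rw [← integral_add (((pwCont_lowerOrder hK hb hc hv).mul hn).integrableOn hK)
      (((pwCont_lowerOrder hK hb' hc' hv).mul hn).integrableOn hK)]
    congr 1
    funext x
    rw [Pi.add_apply, Pi.add_apply, inner_add_left]
    ring
  rw [weakOp, weakOp, weakOp, hlower]
  ring

namespace Discretisation

variable {A : Type*} [TopologicalSpace A] {pb : BellmanProblem d A} {S : Discretisation pb}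
  {U : ℕ → Sp d → ℝ} {a : ℝ} {b : Sp d → Sp d} {c : Sp d → ℝ}

/-- `U i` are elliptic projections of the test function `u` which converge in `W^{1,∞}(Ω)`. -/
structure IsEllipticProjectionSeq (S : Discretisation pb) (u : Sp d → ℝ) (U : ℕ → Sp d → ℝ) :
    Prop where
  smooth : ContDiff ℝ ∞ u
  compact : HasCompactSupport u
  mem : ∀ i, U i ∈ P1 (S.mesh i)
  orth : ∀ i, ∀ y ∈ (S.mesh i).vertices, y ∈ interior pb.cl →
    ∫ x in pb.cl, inner ℝ (gradient (U i) x) (gradient (nhat (S.mesh i) y) x) =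
      ∫ x in pb.cl, inner ℝ (gradient u x) (gradient (nhat (S.mesh i) y) x)
  approx : ∀ δ > 0, ∀ᶠ i in atTop, IsW1infApprox (S.mesh i) pb.cl (U i) u δ

theorem HasEllipticProjections.exists_isEllipticProjectionSeq (h : S.HasEllipticProjections)
    (hu : ContDiff ℝ ∞ u) (hc : HasCompactSupport u) : ∃ U, S.IsEllipticProjectionSeq u U := by
  obtain ⟨P, horth, -, hconv⟩ := h
  refine ⟨fun i => P i ⟨u, hu⟩, hu, hc, fun i => (P i ⟨u, hu⟩).2,
    fun i y hy hyi => horth i ⟨u, hu⟩ y hy hyi, fun δ hδ => ?_⟩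
  filter_upwards [(hconv ⟨u, hu⟩).eventually
    (eventually_le_nhds (ENNReal.ofReal_pos.2 hδ))] with i hi
  exact isW1infApprox_of_w1infNorm_le (S.isMesh i) (P i ⟨u, hu⟩).2 (contDiff_infty.1 hu 1) hδ.le hi

namespace IsEllipticProjectionSeq

theorem contDiff_two (h : S.IsEllipticProjectionSeq u U) : ContDiff ℝ 2 u :=
  contDiff_infty.1 h.smooth 2

theorem pwCont_operator (h : S.IsEllipticProjectionSeq u U) (i : ℕ) (a : ℝ)
    (hb : ContinuousOn b pb.cl) (hc : ContinuousOn c pb.cl) :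
    PwCont (S.mesh i) fun x => -(a * Laplacian.laplacian u x) +
      (-inner ℝ (b x) (gradient (U i) x) + c x * U i x) :=
  ((PwCont.const a).mul (PwCont.of_continuousOn (S.isMesh i)
    (continuous_laplacian h.contDiff_two).continuousOn)).neg.add
      (pwCont_lowerOrder (S.isMesh i) hb hc (h.mem i))

/-- Orthogonality replaces the discrete Dirichlet form of `U i` by the Laplacian of `u`. -/
theorem weakOp_eq (h : S.IsEllipticProjectionSeq u U) (i : ℕ) (hy : y ∈ (S.mesh i).vertices)
    (hyi : y ∈ interior pb.cl) (hb : ContinuousOn b pb.cl) (hc : ContinuousOn c pb.cl) :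
    weakOp (S.mesh i) pb.cl a b c (U i) y = ∫ x in pb.cl, (-(a * Laplacian.laplacian u x) +
      (-inner ℝ (b x) (gradient (U i) x) + c x * U i x)) * nhat (S.mesh i) y x := by
  have hK := S.isMesh i
  have hΔ : PwCont (S.mesh i) (Laplacian.laplacian u : Sp d → ℝ) :=
    PwCont.of_continuousOn hK (continuous_laplacian h.contDiff_two).continuousOn
  rw [weakOp, h.orth i y hy hyi, integral_inner_gradient_nhat hK pb.isCompact_cl.isClosed hyi
    h.contDiff_two h.compact, ← integral_const_mul, ← integral_add]
  · congr 1
    funext x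
    ring
  · exact ((PwCont.const a).mul (hΔ.neg.mul (pwCont_nhat hK y))).integrableOn hK
  · exact ((pwCont_lowerOrder hK hb hc (h.mem i)).mul (pwCont_nhat hK y)).integrableOn hK

end IsEllipticProjectionSeq

end Discretisation

/-! ### Consistency -/

variable {M η : ℝ}

theorem exists_pos_mul_le {C δ : ℝ} (hC : 0 ≤ C) (hδ : 0 < δ) : ∃ η > 0, η ≤ 1 ∧ η * C ≤ δ := by
  refine ⟨min 1 (δ / (C + 1)), lt_min one_pos (by positivity), min_le_left _ _, ?_⟩
  calc min 1 (δ / (C + 1)) * C ≤ δ / (C + 1) * (C + 1) := by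
        gcongr
        exacts [min_le_right _ _, by linarith]
    _ = δ := div_mul_cancel₀ _ (by positivity)

theorem abs_mul_le_of_abs_le {p q P Q : ℝ} (hp : |p| ≤ P) (hq : |q| ≤ Q) : |p * q| ≤ P * Q := by
  rw [abs_mul]
  exact mul_le_mul hp hq (abs_nonneg _) ((abs_nonneg _).trans hp)

theorem abs_inner_le_of_norm_le {E : Type*} [NormedAddCommGroup E] [InnerProductSpace ℝ E]
    {p q : E} {P Q : ℝ} (hp : ‖p‖ ≤ P) (hq : ‖q‖ ≤ Q) : |inner ℝ p q| ≤ P * Q :=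
  (abs_real_inner_le_norm p q).trans (mul_le_mul hp hq (norm_nonneg _) ((norm_nonneg _).trans hp))

theorem abs_inner_sub_inner_le {E : Type*} [NormedAddCommGroup E] [InnerProductSpace ℝ E]
    {p q p' q' : E} (hp : ‖p‖ ≤ M) (hq : ‖q‖ ≤ M) (hpp : ‖p - p'‖ ≤ η) (hqq : ‖q' - q‖ ≤ η)
    (hη : η ≤ 1) : |inner ℝ p' q' - inner ℝ p q| ≤ η * (2 * M + 1) := by
  have hsplit : inner ℝ p' q' - inner ℝ p q = inner ℝ (p' - p) q' + inner ℝ p (q' - q) := by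
    rw [inner_sub_left, inner_sub_right]
    ring
  have hq' : ‖q'‖ ≤ M + 1 := by linarith [norm_le_norm_add_norm_sub' q' q]
  rw [norm_sub_rev] at hpp
  calc |inner ℝ p' q' - inner ℝ p q| ≤ |inner ℝ (p' - p) q'| + |inner ℝ p (q' - q)| :=
        hsplit ▸ abs_add_le _ _
    _ ≤ η * (M + 1) + M * η :=
        add_le_add (abs_inner_le_of_norm_le hpp hq') (abs_inner_le_of_norm_le hp hqq)
    _ = η * (2 * M + 1) := by ring

theorem abs_mul_sub_mul_le {p q p' q' : ℝ} (hp : |p| ≤ M) (hq : |q| ≤ M) (hpp : |p - p'| ≤ η)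
    (hqq : |q' - q| ≤ η) (hη : η ≤ 1) : |p' * q' - p * q| ≤ η * (2 * M + 1) := by
  simpa [mul_comm] using abs_inner_sub_inner_le (p := p) (p' := p') hp hq hpp hqq hη

namespace BellmanProblem

variable {A : Type*} [TopologicalSpace A] {pb : BellmanProblem d A} {α : A}

/-- The operator `Lᵅ u = -aᵅ Δu - bᵅ·∇u + cᵅ u` of the interior equation. -/
noncomputable def lin (pb : BellmanProblem d A) (α : A) (u : Sp d → ℝ) (x : Sp d) : ℝ :=
  -(pb.a α x * Laplacian.laplacian u x) - inner ℝ (pb.b α x) (gradient u x) + pb.c α x * u x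

/-- The operator `Lᵅ_∂ u = -bBᵅ·∇u + cBᵅ u` of the boundary conditions. -/
noncomputable def linB (pb : BellmanProblem d A) (α : A) (u : Sp d → ℝ) (x : Sp d) : ℝ :=
  -inner ℝ (pb.bB α x) (gradient u x) + pb.cB α x * u x

/-- `M` bounds the coefficients for the control `α` and the test function `u` together with its
derivatives. -/
structure IsDataBound (pb : BellmanProblem d A) (α : A) (u : Sp d → ℝ) (M : ℝ) : Prop where
  abs_a_le : ∀ x ∈ pb.cl, |pb.a α x| ≤ M
  norm_b_le : ∀ x ∈ pb.cl, ‖pb.b α x‖ ≤ M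
  abs_c_le : ∀ x ∈ pb.cl, |pb.c α x| ≤ M
  abs_laplacian_le : ∀ x ∈ pb.cl, |Laplacian.laplacian u x| ≤ M
  norm_gradient_le : ∀ x ∈ pb.cl, ‖gradient u x‖ ≤ M
  abs_le : ∀ x ∈ pb.cl, |u x| ≤ M
  abs_lin_le : ∀ x ∈ pb.cl, |pb.lin α u x| ≤ M
  norm_bB_le : ∀ x ∈ frontier pb.cl, ‖pb.bB α x‖ ≤ M
  abs_cB_le : ∀ x ∈ frontier pb.cl, |pb.cB α x| ≤ M

theorem continuousOn_lin (hu : ContDiff ℝ 2 u) : ContinuousOn (pb.lin α u) pb.cl := by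
  have hΔ : ContinuousOn (Laplacian.laplacian u : Sp d → ℝ) pb.cl :=
    (continuous_laplacian hu).continuousOn
  have hgrad : ContinuousOn (gradient u) pb.cl :=
    (continuous_gradient hu one_le_two).continuousOn
  exact (((pb.a_cont.continuousOn α).mul hΔ).neg.sub
    ((pb.b_cont.continuousOn α).inner (𝕜 := ℝ) hgrad)).add
      ((pb.c_cont.continuousOn α).mul hu.continuous.continuousOn)

theorem exists_isDataBound (pb : BellmanProblem d A) (α : A) (hu : ContDiff ℝ 2 u) :
    ∃ M, pb.IsDataBound α u M := by
  obtain ⟨Mi, hMi⟩ := pb.isCompact_cl.exists_bound_of_continuousOn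
    ((pb.a_cont.continuousOn α).prodMk <| (pb.b_cont.continuousOn α).prodMk <|
      (pb.c_cont.continuousOn α).prodMk <| (continuous_laplacian hu).continuousOn.prodMk <|
      (continuous_gradient hu one_le_two).continuousOn.prodMk <|
      hu.continuous.continuousOn.prodMk (continuousOn_lin (pb := pb) (α := α) hu))
  obtain ⟨Mb, hMb⟩ := pb.bB_pc.bounded α
  obtain ⟨Mc, hMc⟩ := pb.cB_pc.bounded α
  simp only [norm_prod_le_iff, Real.norm_eq_abs] at hMi hMc
  have hi : Mi ≤ max Mi (max Mb Mc) := le_max_left _ _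
  have hb : Mb ≤ max Mi (max Mb Mc) := (le_max_left _ _).trans (le_max_right _ _)
  have hc : Mc ≤ max Mi (max Mb Mc) := (le_max_right _ _).trans (le_max_right _ _)
  exact ⟨max Mi (max Mb Mc), fun x hx => (hMi x hx).1.trans hi,
    fun x hx => (hMi x hx).2.1.trans hi, fun x hx => (hMi x hx).2.2.1.trans hi,
    fun x hx => (hMi x hx).2.2.2.1.trans hi, fun x hx => (hMi x hx).2.2.2.2.1.trans hi,
    fun x hx => (hMi x hx).2.2.2.2.2.1.trans hi, fun x hx => (hMi x hx).2.2.2.2.2.2.trans hi,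
    fun x hx => (hMb x hx).trans hb, fun x hx => (hMc x hx).trans hc⟩

theorem IsDataBound.nonneg (hM : pb.IsDataBound α u M) : 0 ≤ M := by
  obtain ⟨x, hx⟩ := pb.nonempty_interior
  exact (abs_nonneg _).trans (hM.abs_le x (interior_subset hx))

theorem IsDataBound.abs_sub_lin_le (hM : pb.IsDataBound α u M) (hx : x ∈ pb.cl) (hη : η ≤ 1)
    {a c r : ℝ} {b g : Sp d} (ha : |pb.a α x - a| ≤ η) (hb : ‖pb.b α x - b‖ ≤ η)
    (hc : |pb.c α x - c| ≤ η) (hg : ‖g - gradient u x‖ ≤ η) (hr : |r - u x| ≤ η) :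
    |-(a * Laplacian.laplacian u x) + (-inner ℝ b g + c * r) - pb.lin α u x| ≤
      η * (5 * M + 2) := by
  have hdiffusion := abs_mul_le_of_abs_le ha (hM.abs_laplacian_le x hx)
  have hdrift := abs_inner_sub_inner_le (hM.norm_b_le x hx) (hM.norm_gradient_le x hx) hb hg hη
  have hpotential := abs_mul_sub_mul_le (hM.abs_c_le x hx) (hM.abs_le x hx) hc hr hη
  rw [lin]
  rw [_root_.abs_le] at *
  constructor <;> linarith

end BellmanProblem

namespace MonotoneCoefficients

variable {G : MixedDomain d} {θ δ : ℝ} {a : Sp d → ℝ} {b : Sp d → Sp d} {c : Sp d → ℝ}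
  {bB : Sp d → Sp d} {cB : Sp d → ℝ}

theorem half_mul_le_nodeOp_hat (H : MonotoneCoefficients G K θ a b c bB cB) (hd : 2 ≤ d)
    (hθ : 0 ≤ Real.sin θ) (hyi : y ∈ interior G.cl) (hs : s ∈ elements K) (hys : y ∈ s) :
    1 / 2 * (a y * ‖elemGrad K s (hat K y)‖ * ‖elemGrad K s (nhat K y)‖ *
      volume.real (simplex s)) ≤ nodeOp G K a b c bB cB δ (hat K y) y := by
  have hK := H.isMesh
  have hy := mem_vertices_of_mem hs.1 hys
  have ha := H.a_nonneg y hy hyi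
  have hlower : ∀ t ∈ elements K, y ∈ t →
      1 / 2 * (a y * ‖elemGrad K t (hat K y)‖ * ‖elemGrad K t (nhat K y)‖ *
        volume.real (simplex t)) ≤ elementOp K t (a y) b c (hat K y) y := fun t ht hyt =>
    (mul_le_mul_of_nonneg_right (by linarith [H.acute.sin_le_half hK hd hθ ht])
      (by positivity)).trans
      (le_elementOp_hat hK ht hyt H.b_cont H.c_cont H.c_nonneg (H.diffusion y hy hyi t ht hyt))
  rw [nodeOp_of_interior hyi, weakOp_eq_sum hK H.b_cont H.c_cont (hat_mem_P1 hK y)]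
  refine (hlower s hs hys).trans (Finset.single_le_sum
    (f := fun t => elementOp K t (a y) b c (hat K y) y) (fun t ht => ?_)
    (hK.finite_elements.mem_toFinset.2 hs))
  have ht := hK.finite_elements.mem_toFinset.1 ht
  by_cases hyt : y ∈ t
  · exact le_trans (by positivity) (hlower t ht hyt)
  · exact (elementOp_eq_zero ht.1 hyt).ge

theorem norm_drift_le (H : MonotoneCoefficients G K θ a b c bB cB) (hyi : y ∈ interior G.cl)
    (hs : s ∈ elements K) (hys : y ∈ s) (hx : x ∈ simplex s) :
    ‖b x‖ ≤ a y * ‖elemGrad K s (nhat K y)‖ * volume.real (simplex s) := by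
  have hy := mem_vertices_of_mem hs.1 hys
  have ha := H.a_nonneg y hy hyi
  calc ‖b x‖ ≤ vecSupOn (simplex s) b := norm_le_vecSupOn (isCompact_simplex s)
        (H.b_cont.mono (H.isMesh.simplex_subset hs)) hx
    _ ≤ vecSupOn (simplex s) b + Metric.diam (simplex s) * supOn (simplex s) c :=
        le_add_of_nonneg_right (mul_nonneg Metric.diam_nonneg (supOn_nonneg _ _))
    _ ≤ a y * Real.sin θ * ‖elemGrad K s (nhat K y)‖ * volume.real (simplex s) :=
        H.diffusion y hy hyi s hs hys
    _ ≤ a y * ‖elemGrad K s (nhat K y)‖ * volume.real (simplex s) := by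
        gcongr
        exact mul_le_of_le_one_right ha (Real.sin_le_one θ)

/-- The time step restriction bounds `h` by the inverse of the diagonal entry, which is at least of
the order of the artificial diffusion and hence, relative to the element size, of the drift. -/
theorem mul_norm_drift_le (H : MonotoneCoefficients G K θ a b c bB cB) (hd : 2 ≤ d)
    (hθ : 0 ≤ Real.sin θ) {h : ℝ} (hh : 0 ≤ h) (hyi : y ∈ interior G.cl)
    (hstep : h * nodeOp G K a b c bB cB δ (hat K y) y ≤ 1) (hs : s ∈ elements K) (hys : y ∈ s)
    (hx : x ∈ simplex s) : h * ‖b x‖ ≤ 2 * Metric.diam (simplex s) := by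
  set g := ‖elemGrad K s (hat K y)‖
  set q := h * (a y * ‖elemGrad K s (nhat K y)‖ * volume.real (simplex s)) with hq
  have hdrift : h * ‖b x‖ ≤ q := mul_le_mul_of_nonneg_left (H.norm_drift_le hyi hs hys hx) hh
  have hq0 : 0 ≤ q := (mul_nonneg hh (norm_nonneg _)).trans hdrift
  have hqg : q * g ≤ 2 := by
    have := (mul_le_mul_of_nonneg_left (H.half_mul_le_nodeOp_hat hd hθ hyi hs hys) hh).trans hstep
    rw [hq]
    linarith
  calc h * ‖b x‖ ≤ q := hdrift
    _ ≤ q * (g * Metric.diam (simplex s)) :=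
        le_mul_of_one_le_right hq0 (one_le_norm_elemGrad_hat_mul_diam H.isMesh (by lia) hs hys)
    _ = q * g * Metric.diam (simplex s) := by ring
    _ ≤ 2 * Metric.diam (simplex s) := mul_le_mul_of_nonneg_right hqg Metric.diam_nonneg

end MonotoneCoefficients

theorem abs_le_add_one_of_abs_sub_add_le_one {m p q M : ℝ} (hp : 0 ≤ p) (hq : 0 ≤ q)
    (h : |m - (p + q)| ≤ 1) (hm : |m| ≤ M) : |p| ≤ M + 1 := by
  rw [abs_of_nonneg hp]
  linarith [(abs_le.1 h).1, (abs_le.1 hm).2]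

theorem abs_mul_operator_le {h η M a l c r : ℝ} {b g : Sp d} (hh : 0 ≤ h) (hη : h ≤ η)
    (ha : |a| ≤ M) (hl : |l| ≤ M) (hc : |c| ≤ M) (hr : |r| ≤ M) (hg : ‖g‖ ≤ M)
    (hb : h * ‖b‖ ≤ 2 * η) :
    |h * (-(a * l) + (-inner ℝ b g + c * r))| ≤ η * (2 * M ^ 2 + 2 * M) := by
  have hM : 0 ≤ M := (abs_nonneg a).trans ha
  have hal := abs_mul_le_of_abs_le ha hl
  have hcr := abs_mul_le_of_abs_le hc hr
  have htri : |-(a * l) + (-inner ℝ b g + c * r)| ≤ M * M + (‖b‖ * ‖g‖ + M * M) := by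
    have hbg := abs_real_inner_le_norm b g
    rw [abs_le] at *
    constructor <;> linarith
  calc |h * (-(a * l) + (-inner ℝ b g + c * r))|
      ≤ h * (M * M + (‖b‖ * ‖g‖ + M * M)) := by
        rw [abs_mul, abs_of_nonneg hh]
        gcongr
    _ = h * (2 * M ^ 2) + h * ‖b‖ * ‖g‖ := by ring
    _ ≤ η * (2 * M ^ 2) + 2 * η * M := by
        have hη0 := hh.trans hη
        gcongr
    _ = η * (2 * M ^ 2 + 2 * M) := by ring

namespace Discretisation

open BellmanProblem

variable {A : Type*} [TopologicalSpace A] {pb : BellmanProblem d A} {S : Discretisation pb}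
  {U : ℕ → Sp d → ℝ} {δ : ℝ}

theorem consistent_interior (hcons : S.ConsistentCoefficients)
    (h : S.IsEllipticProjectionSeq u U) (α : A) (hδ : 0 < δ) :
    ∀ᶠ i in atTop, ∀ y ∈ (S.mesh i).vertices, y ∈ interior pb.cl →
      |S.opE i α (U i) y + S.opI i α (U i) y -
        ∫ x in pb.cl, pb.lin α u x * nhat (S.mesh i) y x| ≤ δ := by
  obtain ⟨M, hM⟩ := exists_isDataBound pb α h.contDiff_two
  have hM0 := hM.nonneg
  obtain ⟨η, hη, hη1, hηδ⟩ := exists_pos_mul_le (C := 5 * M + 2) (by positivity) hδ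
  filter_upwards [hcons.consistent_a η hη, hcons.consistent_interior η hη, h.approx η hη]
    with i ha hbc happrox y hy hyi
  have hK := S.isMesh i
  have hb := (hcons.bE_cont i).continuousOn α
  have hb' := (hcons.bI_cont i).continuousOn α
  have hc := (hcons.cE_cont i).continuousOn α
  have hc' := (hcons.cI_cont i).continuousOn α
  have hnD : y ∉ pb.bdD := fun hD => pb.notMem_interior (Or.inr hD) hyi
  have hn := pwCont_nhat hK y
  have hop := h.pwCont_operator i (S.aE i α y + S.aI i α y) (hb.add hb') (hc.add hc')
  have hlin : PwCont (S.mesh i) (pb.lin α u) :=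
    PwCont.of_continuousOn hK (continuousOn_lin h.contDiff_two)
  rw [opE_eq, opI_eq, nodeOp_of_interior hyi, nodeOp_of_interior hyi,
    weakOp_add_weakOp hK hb hb' hc hc' (h.mem i), h.weakOp_eq i hy hyi (hb.add hb') (hc.add hc'),
    ← integral_sub ((hop.mul hn).integrableOn hK) ((hlin.mul hn).integrableOn hK)]
  simp only [← sub_mul]
  refine abs_integral_mul_nhat_le hK hy (hop.sub hlin) fun s hs hys x hx => ?_
  have hxs := interior_subset hx
  have hxc := hK.simplex_subset hs hxs
  rw [P1.gradient_eq hK (h.mem i) hs hx]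
  exact (hM.abs_sub_lin_le hxc hη1 (ha α y hy hnD x (mem_tsupport_nhat hK hs hys hx))
    (hbc α x hxc).1 (hbc α x hxc).2.1 (happrox.norm_elemGrad_sub_le s hs x hxs)
    (happrox.abs_sub_le x hxc)).trans hηδ

theorem h_mul_opE_interior (hd : 2 ≤ d) (hcons : S.ConsistentCoefficients)
    (hmono : S.ArtificialDiffusion) (htime : S.TimeStepRestriction)
    (h : S.IsEllipticProjectionSeq u U) (α : A) (hδ : 0 < δ) :
    ∀ᶠ i in atTop, ∀ y ∈ (S.mesh i).vertices, y ∈ interior pb.cl →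
      |S.h i * S.opE i α (U i) y| ≤ δ := by
  obtain ⟨M, hM⟩ := exists_isDataBound pb α h.contDiff_two
  have hM0 := hM.nonneg
  obtain ⟨η, hη, -, hηδ⟩ :=
    exists_pos_mul_le (C := 2 * (M + 1) ^ 2 + 2 * (M + 1)) (by positivity) hδ
  filter_upwards [hcons.consistent_a 1 one_pos, hcons.consistent_interior 1 one_pos,
    h.approx 1 one_pos, S.timeStep_tendsto.eventually (eventually_le_nhds hη),
    S.meshSize_tendsto.eventually (eventually_le_nhds hη)] with i ha hbc happrox hh hsize y hy hyi
  obtain ⟨θ, hθ, hMon⟩ := monotoneCoefficients hcons hmono i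
  have hK := S.isMesh i
  have hb := (hcons.bE_cont i).continuousOn α
  have hc := (hcons.cE_cont i).continuousOn α
  have hnD : y ∉ pb.bdD := fun hD => pb.notMem_interior (Or.inr hD) hyi
  have haM : |S.aE i α y| ≤ M + 1 := abs_le_add_one_of_abs_sub_add_le_one
    ((hMon α).1.a_nonneg y hy hyi) ((hMon α).2.a_nonneg y hy hyi)
    (ha α y hy hnD y (self_mem_tsupport_nhat hK hy)) (hM.abs_a_le y (hK.vertices_subset hy))
  have hstep := htime i α y hy (Or.inl hyi)
  rw [opE_eq] at hstep
  rw [opE_eq, nodeOp_of_interior hyi, h.weakOp_eq i hy hyi hb hc, ← integral_const_mul]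
  simp only [← mul_assoc]
  refine abs_integral_mul_nhat_le hK hy
    ((PwCont.const (S.h i)).mul (h.pwCont_operator i _ hb hc)) fun s hs hys x hx => ?_
  have hxs := interior_subset hx
  have hxc := hK.simplex_subset hs hxs
  have hdrift := (hMon α).1.mul_norm_drift_le hd hθ (S.h_pos i).le hyi hstep hs hys hxs
  rw [P1.gradient_eq hK (h.mem i) hs hx]
  refine (abs_mul_operator_le (S.h_pos i).le hh haM ?_ ?_ ?_ ?_ ?_).trans hηδ
  · exact (hM.abs_laplacian_le x hxc).trans (le_add_of_nonneg_right zero_le_one)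
  · exact abs_le_add_one_of_abs_sub_add_le_one (hcons.cE_nonneg i α x hxc)
      (hcons.cI_nonneg i α x hxc) (hbc α x hxc).2.1 (hM.abs_c_le x hxc)
  · linarith [abs_sub_abs_le_abs_sub (U i x) (u x), happrox.abs_sub_le x hxc, hM.abs_le x hxc]
  · linarith [norm_le_norm_add_norm_sub' (elemGrad (S.mesh i) s (U i)) (gradient u x),
      happrox.norm_elemGrad_sub_le s hs x hxs, hM.norm_gradient_le x hxc]
  · exact hdrift.trans (mul_le_mul_of_nonneg_left
      ((hK.diam_le_meshSize hs).trans hsize) zero_le_two)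

theorem consistent_value (h : S.IsEllipticProjectionSeq u U) (hδ : 0 < δ) :
    ∀ᶠ i in atTop, ∀ y ∈ (S.mesh i).vertices,
      |U i y - ∫ x in pb.cl, u x * nhat (S.mesh i) y x| ≤ δ := by
  obtain ⟨η, hη, hunif⟩ := Metric.uniformContinuous_iff.1
    (h.smooth.continuous.uniformContinuous_of_tendsto_cocompact h.compact.is_zero_at_infty)
    (δ / 2) (half_pos hδ)
  filter_upwards [h.approx (δ / 2) (half_pos hδ),
    S.meshSize_tendsto.eventually (eventually_lt_nhds hη)] with i happrox hsize y hy
  have hK := S.isMesh i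
  have hn := pwCont_nhat hK y
  have hu : PwCont (S.mesh i) u := PwCont.of_continuousOn hK h.smooth.continuous.continuousOn
  have hlocal := abs_integral_mul_nhat_le hK hy (hu.sub (PwCont.const (u y))) (c := δ / 2)
    fun s hs hys x hx => (hunif ((hK.dist_le_meshSize hs (interior_subset hx)
      (mem_simplex_of_mem hys)).trans_lt hsize)).le
  have hmean : ∫ x in pb.cl, (u x - u y) * nhat (S.mesh i) y x =
      (∫ x in pb.cl, u x * nhat (S.mesh i) y x) - u y := by
    simp only [sub_mul]
    rw [integral_sub ((hu.mul hn).integrableOn hK)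
      (((PwCont.const (u y)).mul hn).integrableOn hK), integral_const_mul,
      integral_nhat hK hy, mul_one]
  rw [hmean] at hlocal
  have hvalue := happrox.abs_sub_le y (hK.vertices_subset hy)
  rw [abs_le] at *
  constructor <;> linarith

theorem consistent_rhs (hcons : S.ConsistentCoefficients) (α : A) (hδ : 0 < δ) :
    ∀ᶠ i in atTop, ∀ y ∈ (S.mesh i).vertices, y ∈ interior pb.cl →
      |S.rhs i α y - ∫ x in pb.cl, pb.f α x * nhat (S.mesh i) y x| ≤ δ := by
  filter_upwards [hcons.consistent_interior δ hδ] with i hf y hy hyi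
  have hK := S.isMesh i
  have hn := pwCont_nhat hK y
  have hfh : PwCont (S.mesh i) (S.fh i α) :=
    PwCont.of_continuousOn hK ((hcons.fh_cont i).continuousOn α)
  have hlim : PwCont (S.mesh i) (pb.f α) := PwCont.of_continuousOn hK (pb.f_cont.continuousOn α)
  rw [rhs, if_pos hyi, integ, ← integral_sub ((hfh.mul hn).integrableOn hK)
    ((hlim.mul hn).integrableOn hK)]
  simp only [← sub_mul]
  refine abs_integral_mul_nhat_le hK hy (hfh.sub hlim) fun s hs _ x hx => ?_
  rw [abs_sub_comm]
  exact (hf α x (hK.simplex_subset hs (interior_subset hx))).2.2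

theorem exists_norm_boundary_drift_le (hcons : S.ConsistentCoefficients) (α : A) :
    ∃ B, 0 ≤ B ∧ ∀ᶠ i in atTop, ∀ y ∈ pb.bdT ∪ pb.bdR,
      ‖S.bBE i α y‖ ≤ B ∧ ‖S.bBI i α y‖ ≤ B := by
  obtain ⟨B, hB⟩ := hcons.bB_bounded
  obtain ⟨M, hM⟩ := pb.bB_pc.bounded α
  refine ⟨max 0 (max B (M + 1)), le_max_left _ _, ?_⟩
  filter_upwards [hcons.consistent_boundary 1 one_pos] with i hcons_i y hy
  rcases hy with hT | hR
  · obtain ⟨hE, hI⟩ := hB i α y hT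
    exact ⟨hE.trans (le_max_of_le_right (le_max_left _ _)),
      hI.trans (le_max_of_le_right (le_max_left _ _))⟩
  · have hf : y ∈ frontier pb.cl := pb.union_eq ▸ Or.inl (Or.inr hR)
    have hE : S.bBE i α y = 0 := (hcons.implicit_R i α y hR).2.2.2.1
    have hI := (hcons_i α y hf).1
    rw [hE, zero_add, norm_sub_rev] at hI
    rw [hE, norm_zero]
    exact ⟨le_max_left _ _, le_max_of_le_right (le_max_of_le_right (by
      linarith [norm_le_norm_add_norm_sub' (S.bBI i α y) (pb.bB α y), hM y hf]))⟩

theorem consistent_boundary (hcons : S.ConsistentCoefficients)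
    (h : S.IsEllipticProjectionSeq u U) (α : A) (hδ : 0 < δ) :
    ∀ᶠ i in atTop, ∀ y ∈ (S.mesh i).vertices, y ∈ pb.bdT ∪ pb.bdR →
      |S.opE i α (U i) y + S.opI i α (U i) y - pb.linB α u y| ≤ δ := by
  obtain ⟨M, hM⟩ := exists_isDataBound pb α h.contDiff_two
  have hM0 := hM.nonneg
  obtain ⟨B, hB0, hB⟩ := exists_norm_boundary_drift_le hcons α
  obtain ⟨η, hη, hη1, hηδ⟩ := exists_pos_mul_le (C := M + 2 * B + (2 * M + 1)) (by positivity) hδ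
  filter_upwards [hcons.consistent_boundary η hη, h.approx η hη, hB]
    with i hlim happrox hdrift y hy hTR
  have hK := S.isMesh i
  have hyc := hK.vertices_subset hy
  have hni := pb.notMem_interior (Or.inl hTR)
  have hnD := pb.notMem_bdD hTR
  have hf : y ∈ frontier pb.cl := pb.union_eq ▸ Or.inl hTR
  obtain ⟨hbB, hcB, -⟩ := hlim α y hf
  obtain ⟨hconeE, hconeI⟩ := hcons.cone i α y hy hTR
  have hE := (happrox.abs_diniDeriv_add_le hK hconeE).trans
    (mul_le_mul_of_nonneg_left (hdrift y hTR).1 hη.le)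
  have hI := (happrox.abs_diniDeriv_add_le hK hconeI).trans
    (mul_le_mul_of_nonneg_left (hdrift y hTR).2 hη.le)
  have hpotential := abs_mul_sub_mul_le (hM.abs_cB_le y hf) (hM.abs_le y hyc) hcB
    (happrox.abs_sub_le y hyc) hη1
  have hlimit := abs_inner_le_of_norm_le hbB (hM.norm_gradient_le y hyc)
  rw [opE_eq, opI_eq, nodeOp_of_boundary hni hnD, nodeOp_of_boundary hni hnD, linB]
  rw [inner_sub_left, inner_add_left] at hlimit
  rw [real_inner_comm] at hE hI
  rw [abs_le] at *
  constructor <;> linarith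

theorem h_mul_opE_boundary (hcons : S.ConsistentCoefficients)
    (h : S.IsEllipticProjectionSeq u U) (α : A) (hδ : 0 < δ) :
    ∀ᶠ i in atTop, ∀ y ∈ (S.mesh i).vertices, y ∈ pb.bdT → |S.h i * S.opE i α (U i) y| ≤ δ := by
  obtain ⟨M, hM⟩ := exists_isDataBound pb α h.contDiff_two
  have hM0 := hM.nonneg
  obtain ⟨B, hB0, hB⟩ := exists_norm_boundary_drift_le hcons α
  obtain ⟨η, hη, -, hηδ⟩ := exists_pos_mul_le (C := B + M * B + (M + 1) * (M + 1))
    (by positivity) hδ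
  filter_upwards [hcons.consistent_boundary 1 one_pos, h.approx 1 one_pos, hB,
    S.timeStep_tendsto.eventually (eventually_le_nhds hη)] with i hlim happrox hdrift hh y hy hT
  have hK := S.isMesh i
  have hyc := hK.vertices_subset hy
  have hTR : y ∈ pb.bdT ∪ pb.bdR := Or.inl hT
  have hf : y ∈ frontier pb.cl := pb.union_eq ▸ Or.inl hTR
  have hBE := (hdrift y hTR).1
  have hdini := happrox.abs_diniDeriv_add_le hK (hcons.cone i α y hy hTR).1
  have hinner := abs_inner_le_of_norm_le (hM.norm_gradient_le y hyc) hBE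
  have hU : |U i y| ≤ M + 1 := by
    linarith [abs_sub_abs_le_abs_sub (U i y) (u y), happrox.abs_sub_le y hyc, hM.abs_le y hyc]
  have hcB : |S.cBE i α y| ≤ M + 1 := abs_le_add_one_of_abs_sub_add_le_one
    (hcons.cBE_nonneg i α y hf) (hcons.cBI_nonneg i α y hf) (hlim α y hf).2.1 (hM.abs_cB_le y hf)
  have hpotential := abs_mul_le_of_abs_le hcB hU
  have hop : |S.opE i α (U i) y| ≤ B + M * B + (M + 1) * (M + 1) := by
    rw [opE_eq, nodeOp_of_boundary (pb.notMem_interior (Or.inl hTR)) (pb.notMem_bdD hTR)]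
    rw [abs_le] at *
    constructor <;> linarith
  rw [abs_mul, abs_of_pos (S.h_pos i)]
  exact (mul_le_mul hh hop (abs_nonneg _) hη.le).trans hηδ

end Discretisation

end Approximation

/-! ### Freezing the strict supersolution in time -/

section Slices

open scoped ContDiff

variable {E : Type*} [NormedAddCommGroup E] [NormedSpace ℝ E] {W : ℝ × E → ℝ}

theorem contDiff_slice {n : WithTop ℕ∞} (hW : ContDiff ℝ n W) (t : ℝ) :
    ContDiff ℝ n fun y => W (t, y) := hW.comp (contDiff_const.prodMk contDiff_id)

theorem fderiv_slice (hW : ContDiff ℝ 1 W) (t : ℝ) (x p : E) :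
    fderiv ℝ (fun y => W (t, y)) x p = fderiv ℝ W (t, x) (0, p) := by
  have hWd := (hW.differentiable one_ne_zero (t, x)).hasFDerivAt
  have hslice : HasFDerivAt (fun y => W (t, y)) _ x := hWd.comp x (hasFDerivAt_prodMk_right t x)
  rw [hslice.fderiv]
  simp

theorem deriv_slice (hW : ContDiff ℝ 1 W) (t : ℝ) (x : E) :
    deriv (fun τ => W (τ, x)) t = fderiv ℝ W (t, x) (1, 0) := by
  have hWd := (hW.differentiable one_ne_zero (t, x)).hasFDerivAt
  have hslice : HasFDerivAt (fun τ => W (τ, x)) _ t := hWd.comp t (hasFDerivAt_prodMk_left t x)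
  rw [hslice.hasDerivAt.deriv]
  simp

theorem contDiff_fderiv_apply (hW : ContDiff ℝ 2 W) (p : ℝ × E) :
    ContDiff ℝ 1 fun q => fderiv ℝ W q p :=
  (hW.fderiv_right one_add_one_eq_two.le).clm_apply contDiff_const

theorem fderiv_fderiv_slice (hW : ContDiff ℝ 2 W) (t : ℝ) (x p : E) :
    fderiv ℝ (fderiv ℝ fun y => W (t, y)) x p p =
      fderiv ℝ (fun q => fderiv ℝ W q (0, p)) (t, x) (0, p) := by
  have hgrad : ContDiff ℝ 1 (fderiv ℝ fun y => W (t, y)) :=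
    (contDiff_slice hW t).fderiv_right one_add_one_eq_two.le
  have happly := (hgrad.differentiable one_ne_zero x).hasFDerivAt.clm_apply (hasFDerivAt_const p x)
  rw [← fderiv_slice (contDiff_fderiv_apply hW (0, p)),
    funext fun y => (fderiv_slice (hW.of_le one_le_two) t y p).symm, happly.fderiv]
  simp

theorem continuous_fderiv_slice (hW : ContDiff ℝ 1 W) (x p : E) :
    Continuous fun t => fderiv ℝ (fun y => W (t, y)) x p := by
  simp only [fderiv_slice hW]
  exact ((hW.continuous_fderiv one_ne_zero).comp (by fun_prop)).clm_apply continuous_const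

theorem continuous_deriv_slice (hW : ContDiff ℝ 1 W) :
    Continuous fun q : ℝ × E => deriv (fun τ => W (τ, q.2)) q.1 := by
  simp only [deriv_slice hW]
  exact (hW.continuous_fderiv one_ne_zero).clm_apply continuous_const

theorem continuous_laplacian_slice {W : ℝ × Sp d → ℝ} (hW : ContDiff ℝ 2 W) (x : Sp d) :
    Continuous fun t => Laplacian.laplacian (fun y => W (t, y)) x := by
  simp only [laplacian_eq_sum_fderiv, fderiv_fderiv_slice hW]
  exact continuous_finsetSum _ fun j _ =>
    (((contDiff_fderiv_apply hW _).continuous_fderiv one_ne_zero).comp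
      (by fun_prop)).clm_apply continuous_const

end Slices

namespace BellmanProblem

open scoped ContDiff

variable {A : Type*} [TopologicalSpace A] {pb : BellmanProblem d A} {α : A} {ε η M δ : ℝ}
  {r : Sp d → ℝ} {W : ℝ × Sp d → ℝ}

/-- The inequalities for a strict supersolution at a fixed time, with value `u` and time derivative
`r`. -/
structure IsFrozenSupersolution (pb : BellmanProblem d A) (α : A) (η : ℝ) (u r : Sp d → ℝ) :
    Prop where
  interior_le : ∀ x ∈ interior pb.cl, η ≤ -r x + pb.lin α u x - pb.f α x
  bdT_le : ∀ x ∈ pb.bdT, η ≤ -r x + pb.linB α u x - pb.gB α x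
  bdR_le : ∀ x ∈ pb.bdR, η ≤ pb.linB α u x - pb.gB α x

theorem isFrozenSupersolution_of_linOp {t : ℝ} (ht : t ≠ pb.T)
    (h : ∀ x ∈ pb.cl, ε ≤ pb.linOp α t x (Laplacian.laplacian u x) (gradient u x) (r x) (u x)) :
    pb.IsFrozenSupersolution α ε u r := by
  have hcl : ∀ x ∈ pb.bdT ∪ pb.bdR, x ∈ pb.cl := fun x hx =>
    pb.isCompact_cl.isClosed.frontier_subset (pb.union_eq ▸ Or.inl hx)
  simp only [linOp, if_neg ht] at h
  refine ⟨fun x hx => ?_, fun x hx => ?_, fun x hx => ?_⟩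
  · simpa only [lin, if_neg fun hD => pb.notMem_interior (Or.inr hD) hx,
      if_neg fun hR => pb.notMem_interior (Or.inl (Or.inr hR)) hx,
      if_neg fun hT => pb.notMem_interior (Or.inl (Or.inl hT)) hx] using h x (interior_subset hx)
  · simpa only [linB, if_neg (Set.disjoint_left.1 pb.disjoint_TD hx),
      if_neg (Set.disjoint_left.1 pb.disjoint_TR hx), if_pos hx] using h x (hcl x (Or.inl hx))
  · simpa only [linB, if_neg (Set.disjoint_left.1 pb.disjoint_RD hx), if_pos hx]
      using h x (hcl x (Or.inr hx))

theorem continuous_lin_slice (hW : ContDiff ℝ 2 W) (α : A) (x : Sp d) :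
    Continuous fun t => pb.lin α (fun y => W (t, y)) x := by
  have hΔ := continuous_laplacian_slice hW x
  have hgrad := continuous_fderiv_slice (hW.of_le one_le_two) x (pb.b α x)
  have hvalue := hW.continuous
  simp only [lin, real_inner_comm (gradient _ _), inner_gradient_left]
  fun_prop

theorem continuous_linB_slice (hW : ContDiff ℝ 1 W) (α : A) (x : Sp d) :
    Continuous fun t => pb.linB α (fun y => W (t, y)) x := by
  have := continuous_fderiv_slice hW x (pb.bB α x)
  simp only [linB, real_inner_comm (gradient _ _), inner_gradient_left]
  fun_prop

theorem isFrozenSupersolution_slice (hW : ContDiff ℝ 2 W)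
    (h : ∀ t ∈ Icc (0 : ℝ) pb.T, ∀ x ∈ pb.cl,
      ε ≤ pb.linOp α t x (Laplacian.laplacian (fun y => W (t, y)) x)
        (gradient (fun y => W (t, y)) x) (deriv (fun τ => W (τ, x)) t) (W (t, x)))
    {t : ℝ} (ht : t ∈ Icc 0 pb.T) :
    pb.IsFrozenSupersolution α ε (fun y => W (t, y)) fun y => deriv (fun τ => W (τ, y)) t := by
  have hbefore : ∀ t ∈ Ico 0 pb.T,
      pb.IsFrozenSupersolution α ε (fun y => W (t, y)) fun y => deriv (fun τ => W (τ, y)) t :=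
    fun t ht => isFrozenSupersolution_of_linOp ht.2.ne (h t ⟨ht.1, ht.2.le⟩)
  rw [← closure_Ico pb.T_pos.ne] at ht
  have hextend : ∀ {f : ℝ → ℝ}, Continuous f → (∀ t ∈ Ico 0 pb.T, ε ≤ f t) → ε ≤ f t :=
    fun hf hle => le_on_closure hle continuousOn_const hf.continuousOn ht
  have hr : ∀ x, Continuous fun t => deriv (fun τ => W (τ, x)) t := fun x =>
    (continuous_deriv_slice (hW.of_le one_le_two)).comp (Continuous.prodMk_left x)
  have hlin := continuous_lin_slice (pb := pb) hW α
  have hlinB := continuous_linB_slice (pb := pb) (hW.of_le one_le_two) α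
  exact ⟨fun x hx => hextend (((hr x).neg.add (hlin x)).sub continuous_const)
      fun t ht => (hbefore t ht).interior_le x hx,
    fun x hx => hextend (((hr x).neg.add (hlinB x)).sub continuous_const)
      fun t ht => (hbefore t ht).bdT_le x hx,
    fun x hx => hextend ((hlinB x).sub continuous_const) fun t ht => (hbefore t ht).bdR_le x hx⟩

theorem IsDataBound.abs_lin_sub_lin_le (hM : pb.IsDataBound α w M) (hx : x ∈ pb.cl)
    (huv : |u x - v x| ≤ δ) (hgrad : ‖gradient u x - gradient v x‖ ≤ δ)
    (hΔ : |Laplacian.laplacian u x - Laplacian.laplacian v x| ≤ δ) :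
    |pb.lin α u x - pb.lin α v x| ≤ 3 * (M * δ) := by
  have hdiffusion := abs_mul_le_of_abs_le (hM.abs_a_le x hx) hΔ
  have hdrift := abs_inner_le_of_norm_le (hM.norm_b_le x hx) hgrad
  have hpotential := abs_mul_le_of_abs_le (hM.abs_c_le x hx) huv
  rw [inner_sub_right] at hdrift
  rw [lin, lin]
  rw [_root_.abs_le] at *
  constructor <;> linarith

theorem IsDataBound.abs_linB_sub_linB_le (hM : pb.IsDataBound α w M) (hx : x ∈ frontier pb.cl)
    (huv : |u x - v x| ≤ δ) (hgrad : ‖gradient u x - gradient v x‖ ≤ δ) :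
    |pb.linB α u x - pb.linB α v x| ≤ 2 * (M * δ) := by
  have hdrift := abs_inner_le_of_norm_le (hM.norm_bB_le x hx) hgrad
  have hpotential := abs_mul_le_of_abs_le (hM.abs_cB_le x hx) huv
  rw [inner_sub_right] at hdrift
  rw [linB, linB]
  rw [_root_.abs_le] at *
  constructor <;> linarith

theorem IsDataBound.abs_linB_le (hM : pb.IsDataBound α u M) (hx : x ∈ frontier pb.cl) :
    |pb.linB α u x| ≤ 2 * (M * M) := by
  have hxc := pb.isCompact_cl.isClosed.frontier_subset hx
  have hdrift := abs_inner_le_of_norm_le (hM.norm_bB_le x hx) (hM.norm_gradient_le x hxc)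
  have hpotential := abs_mul_le_of_abs_le (hM.abs_cB_le x hx) (hM.abs_le x hxc)
  rw [linB]
  rw [_root_.abs_le] at *
  constructor <;> linarith

theorem IsFrozenSupersolution.exists_smooth (h : pb.IsFrozenSupersolution α ε u r)
    (hu : ContDiff ℝ 2 u) (hr : Continuous r) (hη : η < ε) :
    ∃ u' r' : Sp d → ℝ, (ContDiff ℝ ∞ u' ∧ HasCompactSupport u') ∧
      (ContDiff ℝ ∞ r' ∧ HasCompactSupport r') ∧ pb.IsFrozenSupersolution α η u' r' := by
  obtain ⟨M, hM⟩ := exists_isDataBound pb α hu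
  have hM0 := hM.nonneg
  obtain ⟨δ, hδ, -, hδε⟩ := exists_pos_mul_le (C := 3 * M + 1) (by positivity) (sub_pos.2 hη)
  obtain ⟨u', hu', huc, hua⟩ := exists_smooth_approx_gradient_laplacian hu pb.isCompact_cl hδ
  obtain ⟨r', hr', hrc, hra⟩ := exists_smooth_approx hr pb.isCompact_cl hδ
  have hMδ : 0 ≤ M * δ := by positivity
  have hfrontier : ∀ x ∈ pb.bdT ∪ pb.bdR, x ∈ frontier pb.cl := fun x hx => pb.union_eq ▸ Or.inl hx
  have hrle : ∀ x ∈ pb.cl, r' x ≤ r x + δ := fun x hx => by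
    linarith [le_abs_self (r' x - r x), (Real.dist_eq _ _).symm.trans_le (hra x hx)]
  have hlinB : ∀ x ∈ frontier pb.cl, pb.linB α u x - 2 * (M * δ) ≤ pb.linB α u' x := by
    intro x hx
    obtain ⟨hvalue, hgrad, -⟩ := hua x (pb.isCompact_cl.isClosed.frontier_subset hx)
    linarith [(abs_le.1 (hM.abs_linB_sub_linB_le hx hvalue hgrad)).1]
  refine ⟨u', r', ⟨hu', huc⟩, ⟨hr', hrc⟩, fun x hx => ?_, fun x hx => ?_, fun x hx => ?_⟩
  · have hxc := interior_subset hx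
    obtain ⟨hvalue, hgrad, hΔ⟩ := hua x hxc
    have hlin := (abs_le.1 (hM.abs_lin_sub_lin_le hxc hvalue hgrad hΔ)).1
    linarith [h.interior_le x hx, hrle x hxc]
  · have hf := hfrontier x (Or.inl hx)
    linarith [h.bdT_le x hx, hlinB x hf, hrle x (pb.isCompact_cl.isClosed.frontier_subset hf)]
  · linarith [h.bdR_le x hx, hlinB x (hfrontier x (Or.inr hx))]

theorem IsFrozenSupersolution.le_integral (h : pb.IsFrozenSupersolution α η u r)
    (hK : IsMeshOf K pb.cl) (hy : y ∈ K.vertices) (hu : ContDiff ℝ 2 u) (hr : Continuous r) :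
    η ≤ -(∫ x in pb.cl, r x * nhat K y x) + (∫ x in pb.cl, pb.lin α u x * nhat K y x) -
      ∫ x in pb.cl, pb.f α x * nhat K y x := by
  have hn := pwCont_nhat hK y
  have hr := PwCont.of_continuousOn hK hr.continuousOn
  have hlin := PwCont.of_continuousOn hK (continuousOn_lin (α := α) hu)
  have hf := PwCont.of_continuousOn hK (pb.f_cont.continuousOn α)
  have hrn := (hr.mul hn).integrableOn hK
  have hlinn := (hlin.mul hn).integrableOn hK
  have hfn := (hf.mul hn).integrableOn hK
  have hdiff : IntegrableOn (fun x => pb.lin α u x * nhat K y x - r x * nhat K y x) pb.cl :=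
    hlinn.sub hrn
  have hle := le_integral_mul_nhat hK hy ((hlin.sub hr).sub hf) (c := η) fun s hs _ x hx => by
    linarith [h.interior_le x (interior_mono (hK.simplex_subset hs) hx)]
  simp only [sub_mul] at hle
  rw [integral_sub hdiff hfn, integral_sub hlinn hrn] at hle
  linarith

end BellmanProblem

/-! ### Discrete barriers -/

namespace Discretisation

open BellmanProblem
open scoped ContDiff

variable {A : Type*} [TopologicalSpace A] {pb : BellmanProblem d A} {S : Discretisation pb}
  {α : A} {i k : ℕ} {u r U R : Sp d → ℝ} {ρ C Δ η δ : ℝ}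

/-- The function `U + ρ R + C`; for elliptic projections `U`, `R` of the value and the time
derivative of a supersolution frozen at time `τ` it is used at time `τ + ρ`. -/
noncomputable def barrier (S : Discretisation pb) (i : ℕ) (U R : Sp d → ℝ) (ρ C : ℝ) :
    Sp d → ℝ := U + ρ • R + C • unit (S.mesh i)

theorem barrier_mem (hU : U ∈ P1 (S.mesh i)) (hR : R ∈ P1 (S.mesh i)) (ρ C : ℝ) :
    S.barrier i U R ρ C ∈ P1 (S.mesh i) :=
  (P1 _).add_mem ((P1 _).add_mem hU ((P1 _).smul_mem _ hR)) ((P1 _).smul_mem _ (unit_mem_P1 _))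

theorem barrier_apply (U R : Sp d → ℝ) (ρ C : ℝ) (hy : y ∈ (S.mesh i).vertices) :
    S.barrier i U R ρ C y = U y + ρ * R y + C := by
  simp [barrier, (S.isMesh i).unit_apply ((S.isMesh i).vertices_subset hy)]

theorem abs_barrier_sub_le {MU MR P : ℝ} (C : ℝ) (hy : y ∈ (S.mesh i).vertices) (hU : |U y| ≤ MU)
    (hR : |R y| ≤ MR) (hρ : |ρ| ≤ P) : |S.barrier i U R ρ C y - C| ≤ MU + P * MR := by
  rw [barrier_apply U R ρ C hy, add_sub_cancel_right]
  exact (abs_add_le _ _).trans (add_le_add hU (abs_mul_le_of_abs_le hρ hR))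

theorem le_nodeOp_barrier {σ ε : ℝ} {a c cB : Sp d → ℝ} {b bB : Sp d → Sp d}
    (H : MonotoneCoefficients pb.toMixedDomain (S.mesh i) σ a b c bB cB) (hε : 0 ≤ ε)
    (hy : y ∈ (S.mesh i).vertices) (hU : U ∈ P1 (S.mesh i)) (hR : R ∈ P1 (S.mesh i)) (ρ : ℝ)
    (hC : 0 ≤ C) :
    nodeOp pb.toMixedDomain (S.mesh i) a b c bB cB ε U y +
        ρ * nodeOp pb.toMixedDomain (S.mesh i) a b c bB cB ε R y ≤
      nodeOp pb.toMixedDomain (S.mesh i) a b c bB cB ε (S.barrier i U R ρ C) y := by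
  rw [barrier, H.add_smul hy ((P1 _).add_mem hU ((P1 _).smul_mem _ hR)) (unit_mem_P1 _),
    H.add_smul hy hU hR]
  exact le_add_of_nonneg_right (mul_nonneg hC (H.unit_nonneg hy hε))

theorem opE_add_opI_le_barrier (hcons : S.ConsistentCoefficients) (hmono : S.ArtificialDiffusion)
    (α : A) (hy : y ∈ (S.mesh i).vertices) (hU : U ∈ P1 (S.mesh i)) (hR : R ∈ P1 (S.mesh i))
    (ρ h : ℝ) (hC : 0 ≤ C) :
    S.opE i α U y + S.opI i α U y + ρ * (S.opE i α R y + S.opI i α R y) + h * S.opE i α R y ≤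
      S.opE i α (S.barrier i U R (ρ + h) C) y + S.opI i α (S.barrier i U R ρ C) y := by
  obtain ⟨θ, -, hM⟩ := monotoneCoefficients hcons hmono i
  have hE := le_nodeOp_barrier (hM α).1 le_rfl hy hU hR (ρ + h) hC
  have hI := le_nodeOp_barrier (hM α).2 zero_le_one hy hU hR ρ hC
  simp only [opE_eq, opI_eq]
  linarith

/-- The functions `S.barrier i U R ρ C` with `|ρ| ≤ Δ` and `0 ≤ C` satisfy the inequalities of
`IsNumericalSolution.le_of_supersolution` strictly, for the control `α`. -/
structure IsBarrierFamily (S : Discretisation pb) (i : ℕ) (α : A) (U R : Sp d → ℝ) (Δ : ℝ) :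
    Prop where
  left_mem : U ∈ P1 (S.mesh i)
  right_mem : R ∈ P1 (S.mesh i)
  parabolic : ∀ ρ : ℝ, |ρ| ≤ Δ → ∀ C : ℝ, 0 ≤ C → ∀ y ∈ (S.mesh i).vertices,
    y ∈ interior pb.cl ∪ pb.bdT → 0 < -R y + (S.opE i α (S.barrier i U R (ρ + S.h i) C) y +
      S.opI i α (S.barrier i U R ρ C) y) - S.rhs i α y
  elliptic : ∀ ρ : ℝ, |ρ| ≤ Δ → ∀ C : ℝ, 0 ≤ C → ∀ y ∈ (S.mesh i).vertices, y ∈ pb.bdR →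
    0 < S.opI i α (S.barrier i U R ρ C) y - S.rhs i α y

section Asymptotics

variable {U R : ℕ → Sp d → ℝ}

theorem exists_abs_opE_add_opI_le (hcons : S.ConsistentCoefficients)
    (hR : S.IsEllipticProjectionSeq r R) (α : A) :
    ∃ B, 0 ≤ B ∧ ∀ᶠ i in atTop, ∀ y ∈ (S.mesh i).vertices, y ∉ pb.bdD →
      |S.opE i α (R i) y + S.opI i α (R i) y| ≤ B := by
  obtain ⟨M, hM⟩ := exists_isDataBound pb α hR.contDiff_two
  have hM0 := hM.nonneg
  refine ⟨M + 2 * (M * M) + 1, by positivity, ?_⟩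
  filter_upwards [consistent_interior hcons hR α one_pos, consistent_boundary hcons hR α one_pos]
    with i hinterior hboundary y hy hyD
  have hK := S.isMesh i
  have hMM : 0 ≤ M * M := by positivity
  rcases pb.mem_cases (hK.vertices_subset hy) with hyi | ⟨-, hD⟩ | ⟨-, -, hTR, hf⟩
  · have hmean := abs_integral_mul_nhat_le hK hy
      (PwCont.of_continuousOn hK (continuousOn_lin (α := α) hR.contDiff_two)) (c := M)
      fun s hs _ x hx => hM.abs_lin_le x (hK.simplex_subset hs (interior_subset hx))
    have hclose := hinterior y hy hyi
    rw [abs_le] at *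
    constructor <;> linarith
  · exact absurd hD hyD
  · have hlinB := hM.abs_linB_le hf
    have hclose := hboundary y hy hTR
    rw [abs_le] at *
    constructor <;> linarith

theorem eventually_h_mul_opE (hd : 2 ≤ d) (hcons : S.ConsistentCoefficients)
    (hmono : S.ArtificialDiffusion) (htime : S.TimeStepRestriction)
    (hR : S.IsEllipticProjectionSeq r R) (α : A) (hδ : 0 < δ) :
    ∀ᶠ i in atTop, ∀ y ∈ (S.mesh i).vertices, y ∈ interior pb.cl ∪ pb.bdT →
      |S.h i * S.opE i α (R i) y| ≤ δ := by
  filter_upwards [h_mul_opE_interior hd hcons hmono htime hR α hδ, h_mul_opE_boundary hcons hR α hδ]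
    with i hinterior hboundary y hy hyi
  exact hyi.elim (hinterior y hy) (hboundary y hy)

theorem eventually_residual_ge (hcons : S.ConsistentCoefficients)
    (hfr : pb.IsFrozenSupersolution α η u r) (hU : S.IsEllipticProjectionSeq u U)
    (hR : S.IsEllipticProjectionSeq r R) (hδ : 0 < δ) :
    ∀ᶠ i in atTop, ∀ y ∈ (S.mesh i).vertices, y ∈ interior pb.cl ∪ pb.bdT →
      η - 3 * δ ≤ -R i y + (S.opE i α (U i) y + S.opI i α (U i) y) - S.rhs i α y := by
  filter_upwards [consistent_interior hcons hU α hδ, consistent_value hR hδ,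
    consistent_rhs hcons α hδ, consistent_boundary hcons hU α hδ, hR.approx δ hδ,
    hcons.consistent_boundary δ hδ] with i hinterior hvalue hrhs hboundary happrox hg y hy hy'
  have hK := S.isMesh i
  rcases hy' with hyi | hyT
  · have hop := (abs_le.1 (hinterior y hy hyi)).1
    have hvalue := (abs_le.1 (hvalue y hy)).2
    have hrhs := (abs_le.1 (hrhs y hy hyi)).2
    linarith [hfr.le_integral hK hy hU.contDiff_two hR.smooth.continuous]
  · have hTR : y ∈ pb.bdT ∪ pb.bdR := Or.inl hyT
    have hop := (abs_le.1 (hboundary y hy hTR)).1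
    have hvalue := (abs_le.1 (happrox.abs_sub_le y (hK.vertices_subset hy))).2
    have hrhs := (abs_le.1 (hg α y (pb.union_eq ▸ Or.inl hTR)).2.2).1
    rw [rhs, if_neg (pb.notMem_interior (Or.inl hTR)), if_neg (pb.notMem_bdD hTR)]
    linarith [hfr.bdT_le y hyT]

theorem eventually_residual_ge_of_bdR (hcons : S.ConsistentCoefficients)
    (hfr : pb.IsFrozenSupersolution α η u r) (hU : S.IsEllipticProjectionSeq u U) (hδ : 0 < δ) :
    ∀ᶠ i in atTop, ∀ y ∈ (S.mesh i).vertices, y ∈ pb.bdR →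
      η - 2 * δ ≤ S.opE i α (U i) y + S.opI i α (U i) y - S.rhs i α y := by
  filter_upwards [consistent_boundary hcons hU α hδ, hcons.consistent_boundary δ hδ]
    with i hboundary hg y hy hyR
  have hTR : y ∈ pb.bdT ∪ pb.bdR := Or.inr hyR
  have hop := (abs_le.1 (hboundary y hy hTR)).1
  have hrhs := (abs_le.1 (hg α y (pb.union_eq ▸ Or.inl hTR)).2.2).1
  rw [rhs, if_neg (pb.notMem_interior (Or.inl hTR)), if_neg (pb.notMem_bdD hTR)]
  linarith [hfr.bdR_le y hyR]

theorem exists_isBarrierFamily (hd : 2 ≤ d) (hcons : S.ConsistentCoefficients)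
    (hmono : S.ArtificialDiffusion) (htime : S.TimeStepRestriction) (hη : 0 < η)
    (hfr : pb.IsFrozenSupersolution α η u r) (hU : S.IsEllipticProjectionSeq u U)
    (hR : S.IsEllipticProjectionSeq r R) :
    ∃ Δ > 0, ∀ᶠ i in atTop, S.IsBarrierFamily i α (U i) (R i) Δ := by
  obtain ⟨B, hB, hbound⟩ := exists_abs_opE_add_opI_le hcons hR α
  obtain ⟨Δ, hΔ, -, hΔη⟩ := exists_pos_mul_le hB (half_pos hη)
  have hδ : 0 < η / 10 := by positivity
  refine ⟨Δ, hΔ, ?_⟩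
  filter_upwards [hbound, eventually_h_mul_opE hd hcons hmono htime hR α hδ,
    eventually_residual_ge hcons hfr hU hR hδ, eventually_residual_ge_of_bdR hcons hfr hU hδ]
    with i hbound hstep hparabolic helliptic
  have hslope : ∀ ρ : ℝ, |ρ| ≤ Δ → ∀ y ∈ (S.mesh i).vertices, y ∉ pb.bdD →
      -(η / 2) ≤ ρ * (S.opE i α (R i) y + S.opI i α (R i) y) := fun ρ hρ y hy hyD =>
    (abs_le.1 ((abs_mul_le_of_abs_le hρ (hbound y hy hyD)).trans hΔη)).1
  refine ⟨hU.mem i, hR.mem i, fun ρ hρ C hC y hy hy' => ?_, fun ρ hρ C hC y hy hyR => ?_⟩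
  · have hyD : y ∉ pb.bdD := fun hD =>
      hy'.elim (pb.notMem_interior (Or.inr hD)) fun hT => pb.notMem_bdD (Or.inl hT) hD
    have hbarrier := opE_add_opI_le_barrier hcons hmono α hy (hU.mem i) (hR.mem i) ρ (S.h i) hC
    linarith [hparabolic y hy hy', hslope ρ hρ y hy hyD, (abs_le.1 (hstep y hy hy')).1]
  · have hbarrier := opE_add_opI_le_barrier hcons hmono α hy (hU.mem i) (hR.mem i) ρ 0 hC
    rw [opE_of_bdR hcons i α hyR (S.barrier i _ _ _ _)] at hbarrier
    linarith [helliptic y hy hyR, hslope ρ hρ y hy (pb.notMem_bdD (Or.inr hyR))]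

end Asymptotics

theorem IsBarrierFamily.le_barrier_of_succ [Nonempty A] {v : ℕ → Sp d → ℝ}
    (hB : S.IsBarrierFamily i α U R Δ) (hv : S.IsNumericalSolution i v)
    (hcons : S.ConsistentCoefficients) (hmono : S.ArtificialDiffusion)
    (htime : S.TimeStepRestriction) (hk : k < S.n i) (hρ : |ρ| ≤ Δ) (hC : 0 ≤ C)
    (hD : ∀ y ∈ (S.mesh i).vertices, y ∈ pb.bdD → pb.g y ≤ S.barrier i U R ρ C y)
    (hnext : ∀ y ∈ (S.mesh i).vertices, v (k + 1) y ≤ S.barrier i U R (ρ + S.h i) C y) :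
    ∀ y ∈ (S.mesh i).vertices, v k y ≤ S.barrier i U R ρ C y := by
  refine hv.le_of_supersolution hcons hmono htime hk α (barrier_mem hB.left_mem hB.right_mem ρ C)
    (barrier_mem hB.left_mem hB.right_mem _ C) hnext hD (fun y hy hy' => ?_) (hB.elliptic ρ hρ C hC)
  have hquot : (S.barrier i U R (ρ + S.h i) C y - S.barrier i U R ρ C y) / S.h i = R y := by
    have hpos := S.h_pos i
    rw [barrier_apply _ _ _ _ hy, barrier_apply _ _ _ _ hy]
    field_simp
    ring
  rw [hquot]
  exact hB.parabolic ρ hρ C hC y hy hy'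

theorem n_mul_h (S : Discretisation pb) (i : ℕ) : S.n i * S.h i = pb.T :=
  mul_div_cancel₀ _ (by exact_mod_cast (S.n_pos i).ne')

theorem IsBarrierFamily.le_barrier [Nonempty A] {v : ℕ → Sp d → ℝ} {t τ : ℝ}
    (hB : S.IsBarrierFamily i α U R Δ) (hv : S.IsNumericalSolution i v)
    (hcons : S.ConsistentCoefficients) (hmono : S.ArtificialDiffusion)
    (htime : S.TimeStepRestriction) (hC : 0 ≤ C) (htT : t ≤ pb.T) (htτ : t ≤ τ + Δ)
    (hD : ∀ ρ, |ρ| ≤ Δ → ∀ y ∈ (S.mesh i).vertices, y ∈ pb.bdD → pb.g y ≤ S.barrier i U R ρ C y)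
    (hlate : ∀ k ≤ S.n i, t ≤ k * S.h i → ∀ ρ, |ρ| ≤ Δ + S.h i →
      ∀ y ∈ (S.mesh i).vertices, v k y ≤ S.barrier i U R ρ C y)
    (hk : k ≤ S.n i) (hτk : τ - Δ ≤ k * S.h i) (hkt : k * S.h i < t) :
    ∀ y ∈ (S.mesh i).vertices, v k y ≤ S.barrier i U R (k * S.h i - τ) C y := by
  induction hk using Nat.decreasingInduction with
  | self => exact absurd (hkt.trans_le htT) (by rw [S.n_mul_h]; exact lt_irrefl _)
  | of_succ k hk ih =>
    have hpos := S.h_pos i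
    have hρ : |k * S.h i - τ| ≤ Δ := abs_le.2 ⟨by linarith, by linarith⟩
    have hsucc : ((k + 1 : ℕ) : ℝ) * S.h i = k * S.h i + S.h i := by push_cast; ring
    refine hB.le_barrier_of_succ hv hcons hmono htime hk hρ hC (hD _ hρ) ?_
    rcases lt_or_ge (((k + 1 : ℕ) : ℝ) * S.h i) t with hnext | hnext
    · rw [← add_sub_right_comm, ← hsucc]
      exact ih (by linarith) hnext
    · refine hlate (k + 1) hk hnext _ ((abs_add_le _ _).trans ?_)
      rw [abs_of_pos hpos]
      gcongr

/-! ### The upper bound -/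

/-- The numerical solutions `v i` are eventually bounded above on the time interval `[t, T]`. -/
def BoundedAfter (S : Discretisation pb) (v : ℕ → ℕ → Sp d → ℝ) (t : ℝ) : Prop :=
  ∃ C : ℝ, ∀ᶠ i in atTop, ∀ k ≤ S.n i, t ≤ k * S.h i → ∀ y ∈ (S.mesh i).vertices, v i k y ≤ C

section UpperBound

variable {v : ℕ → ℕ → Sp d → ℝ}

theorem BoundedAfter.mono {t t' : ℝ} (h : S.BoundedAfter v t) (htt : t ≤ t') :
    S.BoundedAfter v t' := by
  obtain ⟨C, hC⟩ := h
  refine ⟨C, ?_⟩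
  filter_upwards [hC] with i hi k hk hk' using hi k hk (htt.trans hk')

theorem boundedAfter_final (hv : ∀ i, S.IsNumericalSolution i (v i)) : S.BoundedAfter v pb.T := by
  obtain ⟨M, hM⟩ := pb.isCompact_cl.exists_bound_of_continuousOn pb.vT_cont
  refine ⟨M, Eventually.of_forall fun i k hk hTk y hy => ?_⟩
  have hkn : k = S.n i := by
    refine le_antisymm hk ?_
    rw [← S.n_mul_h i] at hTk
    exact_mod_cast le_of_mul_le_mul_right hTk (S.h_pos i)
  rw [hkn, (hv i).final y hy]
  exact (le_abs_self _).trans (hM y ((S.isMesh i).vertices_subset hy))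

theorem IsEllipticProjectionSeq.exists_abs_le {U : ℕ → Sp d → ℝ}
    (h : S.IsEllipticProjectionSeq u U) :
    ∃ M : ℝ, 0 ≤ M ∧ ∀ᶠ i in atTop, ∀ y ∈ (S.mesh i).vertices, |U i y| ≤ M := by
  obtain ⟨M, hM⟩ := pb.isCompact_cl.exists_bound_of_continuousOn h.smooth.continuous.continuousOn
  refine ⟨|M| + 1, by positivity, ?_⟩
  filter_upwards [h.approx 1 one_pos] with i hi y hy
  have hyc := (S.isMesh i).vertices_subset hy
  have hu : |u y| ≤ M := hM y hyc
  linarith [abs_sub_abs_le_abs_sub (U i y) (u y), hi.abs_sub_le y hyc, le_abs_self M]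

theorem exists_boundedAfter_step [Nonempty A] (hd : 2 ≤ d) (hcons : S.ConsistentCoefficients)
    (hmono : S.ArtificialDiffusion) (htime : S.TimeStepRestriction)
    (hproj : S.HasEllipticProjections) (hv : ∀ i, S.IsNumericalSolution i (v i))
    (hη : 0 < η) (hfr : pb.IsFrozenSupersolution α η u r)
    (hu : ContDiff ℝ ∞ u ∧ HasCompactSupport u) (hr : ContDiff ℝ ∞ r ∧ HasCompactSupport r)
    (τ : ℝ) : ∃ Δ > 0, ∀ t ≤ pb.T, t ≤ τ + Δ → S.BoundedAfter v t → S.BoundedAfter v (τ - Δ) := by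
  obtain ⟨U, hU⟩ := hproj.exists_isEllipticProjectionSeq hu.1 hu.2
  obtain ⟨R, hR⟩ := hproj.exists_isEllipticProjectionSeq hr.1 hr.2
  obtain ⟨Δ, hΔ, hbarrier⟩ := exists_isBarrierFamily hd hcons hmono htime hη hfr hU hR
  refine ⟨Δ, hΔ, fun t htT htτ ⟨C₁, hC₁⟩ => ?_⟩
  obtain ⟨MU, hMU, hUb⟩ := hU.exists_abs_le
  obtain ⟨MR, hMR, hRb⟩ := hR.exists_abs_le
  obtain ⟨Cg, hCg⟩ := (pb.isCompact_cl.of_isClosed_subset isClosed_frontier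
    pb.isCompact_cl.isClosed.frontier_subset).exists_bound_of_continuousOn pb.g_cont
  -- The barriers with this constant `C` dominate `C₁` and the Dirichlet data.
  set N := MU + (Δ + 1) * MR
  set C := |C₁| + |Cg| + N
  have hN : 0 ≤ N := by positivity
  refine ⟨C + N, ?_⟩
  filter_upwards [hbarrier, hC₁, hUb, hRb,
    S.timeStep_tendsto.eventually (eventually_le_nhds one_pos)]
    with i hB hC₁ hUb hRb hh k hk hτk y hy
  have hnear : ∀ ρ, |ρ| ≤ Δ + 1 → ∀ y ∈ (S.mesh i).vertices,
      |S.barrier i (U i) (R i) ρ C y - C| ≤ N := fun ρ hρ y hy =>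
    abs_barrier_sub_le C hy (hUb y hy) (hRb y hy) hρ
  rcases le_or_gt t (k * S.h i) with htk | htk
  · linarith [hC₁ k hk htk y hy, le_abs_self C₁, abs_nonneg Cg]
  have hv_le := hB.le_barrier (τ := τ) (C := C) (hv i) hcons hmono htime (by positivity) htT htτ
    (fun ρ hρ y hy hyD => ?_) (fun k hk htk ρ hρ y hy => ?_) hk hτk htk y hy
  · have hρ : |k * S.h i - τ| ≤ Δ + 1 := abs_le.2 ⟨by linarith, by linarith⟩
    linarith [(abs_le.1 (hnear _ hρ y hy)).2]
  · have hg : |pb.g y| ≤ Cg := hCg y (pb.union_eq ▸ Or.inr hyD)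
    linarith [(abs_le.1 (hnear ρ (hρ.trans (by linarith)) y hy)).1, le_abs_self (pb.g y),
      le_abs_self Cg, abs_nonneg C₁]
  · linarith [(abs_le.1 (hnear ρ (hρ.trans (add_le_add le_rfl hh)) y hy)).1, hC₁ k hk htk y hy,
      le_abs_self C₁, abs_nonneg Cg]

/-- The infimum `τ` of the times after which the solutions are bounded is `0`: the supersolution
frozen at `τ` carries the bound from slightly after `τ` to slightly before `τ`. -/
theorem boundedAfter_zero [Nonempty A] (hd : 2 ≤ d) (hcons : S.ConsistentCoefficients)
    (hmono : S.ArtificialDiffusion) (htime : S.TimeStepRestriction)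
    (hproj : S.HasEllipticProjections) (hsuper : pb.HasStrictSupersolution)
    (hv : ∀ i, S.IsNumericalSolution i (v i)) : S.BoundedAfter v 0 := by
  obtain ⟨α, W, ε, hW, hε, hsup⟩ := hsuper
  set B := {t | t ∈ Icc 0 pb.T ∧ S.BoundedAfter v t}
  have hT : pb.T ∈ B := ⟨⟨pb.T_pos.le, le_rfl⟩, boundedAfter_final hv⟩
  have hbdd : BddBelow B := ⟨0, fun t ht => ht.1.1⟩
  have hτ : sInf B ∈ Icc 0 pb.T := ⟨le_csInf ⟨_, hT⟩ fun t ht => ht.1.1, csInf_le hbdd hT⟩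
  obtain ⟨u, r, hu, hr, hfr⟩ := (isFrozenSupersolution_slice hW hsup hτ).exists_smooth
    (contDiff_slice hW _) ((continuous_deriv_slice (hW.of_le one_le_two)).comp
      (Continuous.prodMk_right _)) (half_lt_self hε)
  obtain ⟨Δ, hΔ, hstep⟩ := exists_boundedAfter_step hd hcons hmono htime hproj hv
    (half_pos hε) hfr hu hr (sInf B)
  obtain ⟨t, ht, htlt⟩ := exists_lt_of_csInf_lt ⟨_, hT⟩ (lt_add_of_pos_right (sInf B) hΔ)
  have hbefore := hstep t ht.1.2 htlt.le ht.2
  rcases le_or_gt (sInf B - Δ) 0 with hle | hpos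
  · exact hbefore.mono hle
  · have hmem : sInf B - Δ ∈ B := ⟨⟨hpos.le, by linarith [hτ.2]⟩, hbefore⟩
    linarith [csInf_le hbdd hmem]

theorem IsNumericalSolution.exists_abs_le {v : ℕ → Sp d → ℝ} (hv : S.IsNumericalSolution i v) :
    ∃ C : ℝ, ∀ k ≤ S.n i, ∀ x ∈ pb.cl, |v k x| ≤ C := by
  have hK := S.isMesh i
  obtain ⟨C, hC⟩ := (((finite_Iic (S.n i)).prod hK.finite_vertices).image
    fun p : ℕ × Sp d => |v p.1 p.2|).bddAbove
  exact ⟨C, fun k hk x hx => P1.abs_le hK (hv.mem k hk)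
    (fun y hy => hC ⟨(k, y), ⟨hk, hy⟩, rfl⟩) hx⟩

end UpperBound

end Discretisation

end BellmanFEM

open BellmanFEM BellmanFEM.Discretisation in
theorem theorem7p2_general {d : ℕ} (hd : 2 ≤ d) {A : Type*} [TopologicalSpace A] [CompactSpace A]
    (pb : BellmanProblem d A) (S : Discretisation pb) (hcons : S.ConsistentCoefficients)
    (hmono : S.ArtificialDiffusion) (htime : S.TimeStepRestriction)
    (hproj : S.HasEllipticProjections) (hsuper : pb.HasStrictSupersolution)
    (v : ℕ → ℕ → Sp d → ℝ) (hv : ∀ i, S.IsNumericalSolution i (v i)) :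
    ∃ C : ℝ, 0 < C ∧ ∀ i, ∀ k ≤ S.n i, ∀ x ∈ pb.cl, |v i k x| ≤ C := by
  have : Nonempty A := ⟨hsuper.choose⟩
  choose B hB using fun i => (hv i).exists_abs_le
  obtain ⟨C, hC⟩ := boundedAfter_zero hd hcons hmono htime hproj hsuper hv
  have hlarge : ∀ᶠ i in atTop, ∀ k ≤ S.n i, ∀ x ∈ pb.cl, |v i k x| ≤ C := by
    filter_upwards [hC] with i hi k hk x hx
    refine P1.abs_le (S.isMesh i) ((hv i).mem k hk) (fun y hy => ?_) hx
    rw [abs_of_nonneg ((hv i).nonneg hcons hmono htime hk y hy)]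
    exact hi k hk (mul_nonneg k.cast_nonneg (S.h_pos i).le) y hy
  obtain ⟨N, hN⟩ := eventually_atTop.1 hlarge
  obtain ⟨B', hB'⟩ := ((finite_Iio N).image B).bddAbove
  refine ⟨max 1 (max C B'), by positivity, fun i k hk x hx => le_max_of_le_right ?_⟩
  rcases le_or_gt N i with hi | hi
  · exact (hN i hi k hk x hx).trans (le_max_left _ _)
  · exact (hB i k hk x hx).trans ((hB' (mem_image_of_mem B hi)).trans (le_max_right _ _))

theorem theorem7p2 {d : ℕ} (hd : 2 ≤ d) {A : Type*} [MetricSpace A] [CompactSpace A]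
    (pb : BellmanFEM.BellmanProblem d A) (S : BellmanFEM.Discretisation pb)
    (hcons : S.ConsistentCoefficients) (hmono : S.ArtificialDiffusion)
    (htime : S.TimeStepRestriction) (hproj : S.HasEllipticProjections)
    (hsuper : pb.HasStrictSupersolution)
    (v : ℕ → ℕ → BellmanFEM.Sp d → ℝ) (hv : ∀ i, S.IsNumericalSolution i (v i)) :
    ∃ C : ℝ, 0 < C ∧ ∀ i, ∀ k ≤ S.n i, ∀ x ∈ pb.cl, |v i k x| ≤ C :=
  theorem7p2_general hd pb S hcons hmono htime hproj hsuper v hv
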